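/- **Setting.** Consider $x'=f^{[a]}(x)+\varepsilon f^{[b]}(x)$ in $\mathbb R^D$ with smooth vector fields $f^{[a]},f^{[b]}$. Let $\varphi_\tau$, $\varphi^{[a]}_\tau$, $\varphi^{[b]}_\tau$ be the time-$\tau$ flows of $f^{[a]}+\varepsilon f^{[b]}$, $f^{[a]}$ and $\varepsilon f^{[b]}$, respectively (all of them are defined near a given point for small $\tau$). Real coefficients $a_1,\dots,a_{s+1}$ and $b_1,\dots,b_s$ define the splitting method $$\psi_\tau=\varphi^{[a]}_{a_{s+1}\tau}\circ\varphi^{[b]}_{b_s\tau}\circ\varphi^{[a]}_{a_s\tau}\circ\cdots\circ\varphi^{[b]}_{b_1\tau}\circ\varphi^{[a]}_{a_1\tau},\qquad c_i=a_1+\cdots+a_i\quad(1\le i\le s+1).$$ Let $m\ge 1$ and let $r_1\ge r_2\ge\cdots\ge r_m$ be nonnegative integers. The method has *generalized order* $(r_1,\dots,r_m)$ if for all $D$, all smooth $f^{[a]},f^{[b]}$ and all $x\in\mathbb R^D$ the local error is $\mathcal O(\varepsilon\tau^{r_1+1}+\varepsilon^2\tau^{r_2+1}+\cdots+\varepsilon^m\tau^{r_m+1})$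 as an expansion in powers of $\varepsilon$ up to $\varepsilon^m$, that is, $$\psi_\tau(x)-\varphi_\tau(x)=\sum_{k=1}^m\varepsilon^k e_k(\tau)+\mathcal O(\varepsilon^{m+1})\quad\text{as }(\tau,\varepsilon)\to(0,0),\qquad e_k(\tau)=\mathcal O(\tau^{r_k+1})\quad\text{as }\tau\to0 .$$ The method is *symmetric* if $\psi_{-\tau}=\psi_\tau^{-1}$ for all such problems (at each point, for all sufficiently small $\tau$). A *multi-index* is a tuple $(j_1,\dots,j_k)$ of positive integers, $k\ge 1$. It is a *Lyndon multi-index* if $(j_1,\dots,j_l)<(j_{l+1},\dots,j_k)$ in the lexicographical (dictionary) order for each $1\le l<k$. For a multi-index $(j_1,\dots,j_k)$ consider the condition $$\sum_{1\le i_1\le\cdots\le i_k\le s}\frac{b_{i_1}\cdots b_{i_k}}{\sigma_{i_1\cdots i_k}}\,c_{i_1}^{j_1-1}\cdots c_{i_k}^{j_k-1}=\frac{1}{(j_1+\cdots+j_k)\cdots(j_1+j_2)\,j_1},\tag{$*$}$$ where $\sigma_{i_1\cdots i_k}$ is the product of the factorials of the lengths of the maximal blocks of equal indices in $i_1\le\cdots\le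 i_k$. **Theorem 1.** The splitting method $\psi_\tau$ has generalized order $(r_1,\dots,r_m)$ if and only if $c_{s+1}=1$ and $(*)$ holds for each $k=1,\dots,m$ and each Lyndon multi-index $(j_1,\dots,j_k)$ with $j_1+\cdots+j_k\le r_k$. If the method is symmetric, then it has generalized order $(r_1,\dots,r_m)$ if and only if $c_{s+1}=1$ and $(*)$ holds for each $k=1,\dots,m$ and each Lyndon multi-index $(j_1,\dots,j_k)$ with $j_1+\cdots+j_k\le r_k$ and $j_1+\cdots+j_k$ odd. -/

import Mathlib

open Filter Topology Asymptotics
open scoped ContDiff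

noncomputable section

namespace Splitting

/-- The phase space `ℝ^D`. -/
abbrev Space (D : ℕ) : Type := EuclideanSpace ℝ (Fin D)

/-- The solution of `x' = f x`, `x 0 = x₀` exists on the whole (possibly backward) time interval
between `0` and `t`, and takes the value `y` at time `t`. -/
def Reaches {D : ℕ} (f : Space D → Space D) (t : ℝ) (x₀ y : Space D) : Prop :=
  ∃ γ : ℝ → Space D, γ 0 = x₀ ∧ γ t = y ∧ IsIntegralCurveOn γ (fun _ => f) (Set.uIcc 0 t)

open scoped Classical in
/-- The time-`t` flow map of `x' = f x`.  For smooth `f` the point reached is unique.  Where the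
solution blows up before time `t`, the flow map gets the default value `x₀`; for a fixed `x₀` this
does not happen for small `t`. -/
def flow {D : ℕ} (f : Space D → Space D) (t : ℝ) (x₀ : Space D) : Space D :=
  if h : ∃ y, Reaches f t x₀ y then h.choose else x₀

/-- One step of size `τ` of the splitting method with coefficients `a₁, …, a_{s+1}` and
`b₁, …, b_s` (indexed from `0` here) for `x' = fa x + ε • fb x`: the map
`φa_{a_{s+1} τ} ∘ φb_{b_s τ} ∘ φa_{a_s τ} ∘ ⋯ ∘ φb_{b_1 τ} ∘ φa_{a_1 τ}`,
where `φa` is the flow of `fa` and `φb` the flow of `ε • fb`. -/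
def step {s D : ℕ} (a : Fin (s + 1) → ℝ) (b : Fin s → ℝ) (fa fb : Space D → Space D)
    (τ ε : ℝ) (x : Space D) : Space D :=
  flow fa (a (Fin.last s) * τ)
    (Fin.foldl s
      (fun y i => flow (fun z => ε • fb z) (b i * τ) (flow fa (a i.castSucc * τ) y)) x)

/-- The local error `ψ_τ(x) - φ_τ(x)` at step size `τ` and perturbation parameter `ε`. -/
def localError {s D : ℕ} (a : Fin (s + 1) → ℝ) (b : Fin s → ℝ) (fa fb : Space D → Space D)
    (x : Space D) (τ ε : ℝ) : Space D :=
  step a b fa fb τ ε x - flow (fun z => fa z + ε • fb z) τ x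

/-- Generalized order `(r₁, …, r_m)`, with `r_{k+1} = r k`: for all smooth vector fields `fa`, `fb`
in all dimensions and all initial points, the local error is
`O(ε τ^{r₁+1} + ε² τ^{r₂+1} + ⋯ + ε^m τ^{r_m+1})` as an expansion in powers of `ε` up to `ε^m`, i.e.
`ψ_τ(x) - φ_τ(x) = ε e₁(τ) + ⋯ + ε^m e_m(τ) + O(ε^{m+1})` as `(τ, ε) → (0, 0)`, with
`e_k(τ) = O(τ^{r_k+1})` as `τ → 0`. -/
def HasGeneralizedOrder {s m : ℕ} (a : Fin (s + 1) → ℝ) (b : Fin s → ℝ) (r : Fin m → ℕ) : Prop :=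
  ∀ (D : ℕ) (fa fb : Space D → Space D), ContDiff ℝ ∞ fa → ContDiff ℝ ∞ fb → ∀ x : Space D,
    ∃ e : Fin m → ℝ → Space D,
      (∀ k : Fin m, e k =O[𝓝 0] fun τ : ℝ => τ ^ (r k + 1)) ∧
      (fun p : ℝ × ℝ =>
          localError a b fa fb x p.1 p.2 - ∑ k : Fin m, p.2 ^ (k.val + 1) • e k p.1)
        =O[𝓝 (0, 0)] fun p : ℝ × ℝ => p.2 ^ (m + 1)

/-- Symmetric methods: `ψ_{-τ} = ψ_τ⁻¹`.  As flows are in general only local, this is required at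
each point `x` for all small enough `τ` (of either sign). -/
def IsSymmetric {s : ℕ} (a : Fin (s + 1) → ℝ) (b : Fin s → ℝ) : Prop :=
  ∀ (D : ℕ) (fa fb : Space D → Space D), ContDiff ℝ ∞ fa → ContDiff ℝ ∞ fb →
    ∀ (ε : ℝ) (x : Space D), ∀ᶠ τ in 𝓝 (0 : ℝ),
      step a b fa fb (-τ) ε (step a b fa fb τ ε x) = x

/-- `c_i = a_1 + ⋯ + a_i`. -/
def node {s : ℕ} (a : Fin (s + 1) → ℝ) (i : Fin (s + 1)) : ℝ := ∑ j ∈ Finset.Iic i, a j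

/-- `σ_{i_1 … i_k}` for `i_1 ≤ ⋯ ≤ i_k`: the product of the factorials of the lengths of the
maximal blocks of equal indices. -/
def sigma {s k : ℕ} (i : Fin k → Fin s) : ℕ :=
  ∏ p : Fin s, (Finset.univ.filter fun l => i l = p).card.factorial

open scoped Classical in
/-- The order condition attached to the multi-index `(j_1, …, j_k)`. -/
def OrderCondition {s k : ℕ} (a : Fin (s + 1) → ℝ) (b : Fin s → ℝ) (j : Fin k → ℕ) : Prop :=
  ∑ i ∈ Finset.univ.filter (fun i : Fin k → Fin s => Monotone i),
      (∏ l, b (i l)) / (sigma i : ℝ) * ∏ l, node a (i l).castSucc ^ (j l - 1)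
    = 1 / ∏ l : Fin k, ∑ p ∈ Finset.Iic l, (j p : ℝ)

/-- Lyndon multi-indices: tuples of positive integers `w` such that `u < v` lexicographically for
every splitting of `w` into two nonempty parts `u`, `v`. -/
def IsLyndon (w : List ℕ) : Prop :=
  w ≠ [] ∧ (∀ n ∈ w, 0 < n) ∧ ∀ u v : List ℕ, u ≠ [] → v ≠ [] → w = u ++ v → u < v

end Splitting

end

/-! Put `η = τ ε`, let `A`, `B` be the Lie derivatives along the two vector fields, and `Y_q = ad_A
^ q B / q!`. Since `exp(cτA) B = (∑ c^q τ^q Y_q) exp(cτA)`, all drifts can be moved to the right of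
all kicks. The Lie series of the method becomes a sum over words of positive integers, each word
contributing a product of operators `Y`, times `exp(c_{s+1} τ A)`. The coefficients form
`methodChar`; they are the left-hand sides of the order conditions (`methodChar_ofFn_reverse`). The
exact flow has the same form with `intChar`, the iterated integrals of monomials, which are the
right-hand sides (`isExpArray_fullSeries_intChar`). Words are multi-indices read backwards: the head
is the latest kick. A word of length `k` and weight (sum of letters) `n` first enters at `ε^k τ^n`.

Sufficiency of the conditions for all words (`hasGeneralizedOrder_of_forall_eq`) needs analysis.
Flows are smooth in the initial value, `τ` and `η`, by the implicit function theorem in a space of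
continuous curves. Their Lie series are asymptotic expansions, and these determine the behaviour in
`τ` of the Taylor coefficients in `η`.

Necessity uses, for each word `w`, a polynomial test system whose coordinates are the time and one
value for each suffix of `w`. There one coordinate of the local error is exactly `ε^|w| τ^(weight)`
times the defect of the condition for `w` (`localError_test`).

The reduction to Lyndon words is algebraic. Both coefficient functions are multiplicative on
shuffles (the exact one on words of positive letters). A non-Lyndon word is a concatenation `u ++ v`
that is the lexicographically largest shuffle of `u` and `v`, so its condition follows from those
for `u`, `v` and smaller shuffles (`eq_of_forall_isLyndon`).

For a symmetric method both functions are inverted under convolution by time reversal. On a word of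
even weight this identity contains the value at the word twice and otherwise only words of smaller
weight, so the condition there is automatic (`eq_of_even_sum`). -/

namespace Splitting

/-! ### Shuffles of words and Lyndon words -/

/-- The words obtained by shuffling two words, with multiplicity. -/
def shuffle : List ℕ → List ℕ → List (List ℕ)
  | [], v => [v]
  | a :: u, [] => [a :: u]
  | a :: u, b :: v =>
      (shuffle u (b :: v)).map (List.cons a) ++ (shuffle (a :: u) v).map (List.cons b)

theorem shuffle_nil_left (v : List ℕ) : shuffle [] v = [v] := by
  simp [shuffle]

theorem shuffle_nil_right (u : List ℕ) : shuffle u [] = [u] := by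
  cases u <;> simp [shuffle]

theorem shuffle_cons_cons (a b : ℕ) (u v : List ℕ) :
    shuffle (a :: u) (b :: v) =
      (shuffle u (b :: v)).map (List.cons a) ++ (shuffle (a :: u) v).map (List.cons b) := by
  rw [shuffle]

/-- `IsMerge u v x`: the word `x` is a shuffle of the words `u` and `v`. -/
inductive IsMerge : List ℕ → List ℕ → List ℕ → Prop
  | nil : IsMerge [] [] []
  | left (a : ℕ) {u v x : List ℕ} : IsMerge u v x → IsMerge (a :: u) v (a :: x)
  | right (a : ℕ) {u v x : List ℕ} : IsMerge u v x → IsMerge u (a :: v) (a :: x)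

namespace IsMerge

theorem nil_left (v : List ℕ) : IsMerge [] v v := by
  induction v with
  | nil => exact nil
  | cons a v ih => exact ih.right a

theorem append_left (u v : List ℕ) : IsMerge u v (u ++ v) := by
  induction u with
  | nil => exact nil_left v
  | cons a u ih => exact ih.left a

theorem nil_right (u : List ℕ) : IsMerge u [] u := by
  simpa using append_left u []

theorem comm {u v x : List ℕ} (h : IsMerge u v x) : IsMerge v u x := by
  induction h with
  | nil => exact nil
  | left a _ ih => exact ih.right a
  | right a _ ih => exact ih.left a

theorem append_singleton_left {u v x : List ℕ} (h : IsMerge u v x) (a : ℕ) :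
    IsMerge (u ++ [a]) v (x ++ [a]) := by
  induction h with
  | nil => exact nil.left a
  | left b _ ih => exact ih.left b
  | right b _ ih => exact ih.right b

theorem reverse {u v x : List ℕ} (h : IsMerge u v x) :
    IsMerge u.reverse v.reverse x.reverse := by
  induction h with
  | nil => exact nil
  | left a _ ih => simpa using ih.append_singleton_left a
  | right a _ ih => simpa using (ih.comm.append_singleton_left a).comm

theorem perm {u v x : List ℕ} (h : IsMerge u v x) : x.Perm (u ++ v) := by
  induction h with
  | nil => simp
  | left a _ ih => exact ih.cons a
  | right a _ ih => exact (ih.cons a).trans List.perm_middle.symm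

theorem eq_of_nil_left {v x : List ℕ} (h : IsMerge [] v x) : x = v := by
  induction v generalizing x with
  | nil => cases h; rfl
  | cons a v ih => cases h with | right _ h => rw [ih h]

theorem mem_shuffle {u v x : List ℕ} (h : IsMerge u v x) : x ∈ shuffle u v := by
  induction h with
  | nil => simp [shuffle]
  | @left a u v x h ih =>
    cases v with
    | nil => rw [h.comm.eq_of_nil_left]; simp [shuffle]
    | cons b v => rw [shuffle_cons_cons]; simp [ih]
  | @right a u v x h ih =>
    cases u with
    | nil => rw [h.eq_of_nil_left]; simp [shuffle]
    | cons b v => rw [shuffle_cons_cons]; simp [ih]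

end IsMerge

theorem isMerge_of_mem_shuffle {u v x : List ℕ} (h : x ∈ shuffle u v) : IsMerge u v x := by
  induction u generalizing v x with
  | nil =>
    rw [shuffle_nil_left, List.mem_singleton] at h
    exact h ▸ IsMerge.nil_left v
  | cons a u ihu =>
    induction v generalizing x with
    | nil =>
      rw [shuffle_nil_right, List.mem_singleton] at h
      exact h ▸ IsMerge.nil_right _
    | cons b v ihv =>
      rw [shuffle_cons_cons, List.mem_append, List.mem_map, List.mem_map] at h
      rcases h with ⟨y, hy, rfl⟩ | ⟨y, hy, rfl⟩
      · exact (ihu hy).left a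
      · exact (ihv hy).right b

theorem cons_le_cons_iff_lex {a b : ℕ} {u v : List ℕ} :
    a :: u ≤ b :: v ↔ a < b ∨ a = b ∧ u ≤ v := by
  rw [← not_lt, List.cons_lt_cons_iff, ← not_lt (a := v)]
  constructor
  · intro h
    rcases lt_trichotomy a b with h1 | h1 | h1
    · exact Or.inl h1
    · exact Or.inr ⟨h1, fun h2 => h (Or.inr ⟨h1.symm, h2⟩)⟩
    · exact absurd (Or.inl h1) h
  · rintro (h1 | ⟨h1, h2⟩) (h3 | ⟨h3, h4⟩) <;> first | omega | exact h2 h4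

theorem cons_le_cons_of_le (a : ℕ) {u v : List ℕ} (h : u ≤ v) : a :: u ≤ a :: v :=
  cons_le_cons_iff_lex.2 (Or.inr ⟨rfl, h⟩)

/-- Moving a common prefix from the larger word to the smaller one does not decrease the largest
shuffle. -/
theorem IsMerge.exists_le_of_le {p u v y : List ℕ} (huv : v ≤ u) (h : IsMerge (p ++ u) v y) :
    ∃ y', IsMerge u (p ++ v) y' ∧ y ≤ y' := by
  induction y generalizing p u v with
  | nil =>
    have := h.perm.length_eq
    simp only [List.length_nil, List.length_append] at this
    have hp : p = [] := List.length_eq_zero_iff.1 (by omega)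
    subst hp
    exact ⟨[], h, le_rfl⟩
  | cons c y ih =>
    cases p with
    | nil => exact ⟨c :: y, h, le_rfl⟩
    | cons a p =>
      cases h with
      | left _ h =>
        obtain ⟨y', hy', hle⟩ := ih huv h
        exact ⟨_, hy'.right c, cons_le_cons_of_le _ hle⟩
      | @right _ _ v _ h =>
        cases u with
        | nil => exact absurd huv (not_le.2 (List.nil_lt_cons _ _))
        | cons b u =>
          rcases cons_le_cons_iff_lex.1 huv with hlt | ⟨rfl, hle⟩
          -- Here `c < b`, so any shuffle that starts with `b` is large enough.
          · exact ⟨_, (IsMerge.append_left u _).left b,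
              cons_le_cons_iff_lex.2 (Or.inl hlt)⟩
          -- The two words share their first letter `c`, which joins the common prefix.
          · obtain ⟨y', hy', hle'⟩ := ih (p := (a :: p) ++ [c]) (u := u) (v := v) hle
              (by simpa using h)
            refine ⟨c :: y', IsMerge.left c (by simpa using hy'), cons_le_cons_of_le _ hle'⟩

/-- If all nonempty suffixes of `u` are at least `v`, then `u ++ v` is the largest shuffle of `u`
and `v`. -/
theorem IsMerge.le_append {u v x : List ℕ} (hu : ∀ s, s ≠ [] → s <:+ u → v ≤ s)
    (h : IsMerge u v x) : x ≤ u ++ v := by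
  induction u generalizing x with
  | nil => rw [h.eq_of_nil_left]; simp
  | cons a u ih =>
    have hu' : ∀ s, s ≠ [] → s <:+ u → v ≤ s :=
      fun s hs hsu => hu s hs (hsu.trans (List.suffix_cons a u))
    cases h with
    | left _ h => exact cons_le_cons_of_le a (ih hu' h)
    | @right b _ v y h =>
      have hle := hu (a :: u) (by simp) List.suffix_rfl
      rcases cons_le_cons_iff_lex.1 hle with hlt | ⟨rfl, hvu⟩
      · exact cons_le_cons_iff_lex.2 (Or.inl hlt)
      · obtain ⟨y', hy', hle'⟩ := IsMerge.exists_le_of_le (p := [b]) hvu h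
        exact cons_le_cons_of_le b (hle'.trans (ih hu' hy'))

/-- Take for `v` the smallest nonempty suffix of `w`. A suffix `s < v` of `u` would produce a suffix
of `w` smaller than `v`: either `s ++ v`, or `v'` when `v = s ++ v'`. -/
theorem exists_append_of_not_isLyndon {w : List ℕ} (hw : w ≠ []) (hpos : ∀ n ∈ w, 0 < n)
    (h : ¬ IsLyndon w) :
    ∃ u v, u ≠ [] ∧ v ≠ [] ∧ w = u ++ v ∧ ∀ s, s ≠ [] → s <:+ u → v ≤ s := by
  obtain ⟨v, hv, hmin⟩ : ∃ v ∈ w.tails.filter (· ≠ []), ∀ s ∈ w.tails.filter (· ≠ []), v ≤ s := by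
    have hne : (w.tails.filter (· ≠ [])).toFinset.Nonempty :=
      ⟨w, by simp [hw]⟩
    refine ⟨(w.tails.filter (· ≠ [])).toFinset.min' hne, ?_, ?_⟩
    · exact List.mem_toFinset.1 (Finset.min'_mem _ hne)
    · exact fun s hs => Finset.min'_le _ s (List.mem_toFinset.2 hs)
  simp only [ne_eq, List.mem_filter, List.mem_tails, decide_not, Bool.not_eq_eq_eq_not,
    Bool.not_true, decide_eq_false_iff_not] at hv hmin
  obtain ⟨⟨u, rfl⟩, hv0⟩ := hv
  refine ⟨u, v, ?_, hv0, rfl, ?_⟩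
  -- If the whole word were its smallest suffix, then `u < w ≤ v'` for every splitting `w = u ++
  -- v'`, which makes `w` Lyndon.
  · rintro rfl
    simp only [IsLyndon, not_and, not_forall, List.nil_append] at h hpos hw hmin
    obtain ⟨u, v', hu, hv', hvv, hlt⟩ := h hw hpos
    have h1 := hmin v' ⟨⟨u, hvv.symm⟩, hv'⟩
    have h2 : u < v := by
      rw [hvv]
      simpa using List.append_left_lt (l₁ := u) (List.nil_lt_cons (v'.head hv') v'.tail)
    exact absurd (lt_of_lt_of_le h2 h1) hlt
  · intro s hs hsu
    by_contra hlt
    rw [not_le] at hlt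
    obtain ⟨t, rfl⟩ := hsu
    have h1 : v ≤ s ++ v := hmin _ ⟨⟨t, by simp⟩, by simp [hs]⟩
    by_cases hpre : s <+: v
    · obtain ⟨v', rfl⟩ := hpre
      have hv' : v' ≠ [] := by
        rintro rfl
        simp at hlt
      have h2 := hmin v' ⟨⟨t ++ s ++ s, by simp⟩, hv'⟩
      have h3 : v' < s ++ v' := by
        refine lt_of_le_of_ne ?_ ?_
        · by_contra h4
          rw [not_le] at h4
          exact absurd (List.append_left_lt (l₁ := s) h4) (not_lt.2 h1)
        · intro h
          have := congrArg List.length h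
          simp [hs] at this
      exact absurd h3 (not_lt.2 h2)
    -- The comparison is decided at a letter of `s`, so extending `s` does not affect it.
    · have key : ∀ s v : List ℕ, s < v → ¬ s <+: v → ∀ z, s ++ z < v := by
        intro s
        induction s with
        | nil => intro v _ h; simp at h
        | cons a s ih =>
          intro v hsv hp z
          cases v with
          | nil => simp at hsv
          | cons b v =>
            rcases List.cons_lt_cons_iff.1 hsv with hlt | ⟨rfl, hlt⟩
            · exact List.cons_lt_cons_iff.2 (Or.inl hlt)
            · refine List.cons_lt_cons_iff.2 (Or.inr ⟨rfl, ih v hlt ?_ z⟩)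
              simpa using hp
      exact absurd (key s v hlt hpre v) (not_lt.2 h1)

/-! ### Convolution and characters of the shuffle algebra -/

/-- The convolution `w ↦ ∑ χ u * ξ v` over all splittings `w = v ++ u`. -/
def conv (χ ξ : List ℕ → ℝ) : List ℕ → ℝ
  | [] => χ [] * ξ []
  | q :: w => χ (q :: w) * ξ [] + conv χ (fun v => ξ (q :: v)) w

theorem conv_nil (χ ξ : List ℕ → ℝ) : conv χ ξ [] = χ [] * ξ [] := rfl

theorem conv_cons (χ ξ : List ℕ → ℝ) (q : ℕ) (w : List ℕ) :
    conv χ ξ (q :: w) = χ (q :: w) * ξ [] + conv χ (fun v => ξ (q :: v)) w := rfl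

theorem conv_add (χ ξ ζ : List ℕ → ℝ) (w : List ℕ) :
    conv χ (fun v => ξ v + ζ v) w = conv χ ξ w + conv χ ζ w := by
  induction w generalizing ξ ζ with
  | nil => simp [conv_nil, mul_add]
  | cons q w ih => simp only [conv_cons, ih]; ring

theorem conv_const_mul (χ ξ : List ℕ → ℝ) (r : ℝ) (w : List ℕ) :
    conv χ (fun v => r * ξ v) w = r * conv χ ξ w := by
  induction w generalizing ξ with
  | nil => simp only [conv_nil]; ring
  | cons q w ih => simp only [conv_cons, ih]; ring

theorem conv_eq_sum (χ ξ : List ℕ → ℝ) (w : List ℕ) :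
    conv χ ξ w = ∑ i ∈ Finset.range (w.length + 1), χ (w.drop i) * ξ (w.take i) := by
  induction w generalizing ξ with
  | nil => simp [conv_nil]
  | cons q w ih =>
    rw [conv_cons, ih, List.length_cons, Finset.sum_range_succ' _ (w.length + 1), add_comm]
    simp

theorem conv_assoc (χ ξ ζ : List ℕ → ℝ) (w : List ℕ) :
    conv (conv χ ξ) ζ w = conv χ (conv ξ ζ) w := by
  induction w generalizing ζ with
  | nil => simp only [conv_nil]; ring
  | cons q w ih =>
    rw [conv_cons, conv_cons, conv_cons, ih, conv_nil]
    have h : (fun v => conv ξ ζ (q :: v)) =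
        fun v => ζ [] * ξ (q :: v) + conv ξ (fun u => ζ (q :: u)) v := by
      funext v; rw [conv_cons]; ring
    rw [h, conv_add, conv_const_mul]
    ring

/-- The unit of the convolution. -/
def unitChar : List ℕ → ℝ
  | [] => 1
  | _ :: _ => 0

theorem conv_unitChar (χ : List ℕ → ℝ) (w : List ℕ) : conv χ unitChar w = χ w := by
  have hz : ∀ w : List ℕ, conv χ (fun _ => 0) w = 0 := fun w => by
    simp [conv_eq_sum]
  cases w with
  | nil => simp [conv_nil, unitChar]
  | cons q w => simp [conv_cons, unitChar, hz]

/-- The coefficients of the exponential of `b • ∑ c ^ (j - 1) • Y_j`. -/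
noncomputable def expChar (b c : ℝ) : List ℕ → ℝ
  | [] => 1
  | q :: w => b / (w.length + 1) * c ^ (q - 1) * expChar b c w

/-- The iterated integrals of the monomials `t ^ (j - 1)` over `[0, 1]`; the head of a word belongs
to the outermost integral. -/
noncomputable def intChar : List ℕ → ℝ
  | [] => 1
  | q :: w => intChar w / (q + w.sum : ℕ)

/-- The coefficients of the splitting method with weights `b` and nodes `c`. -/
noncomputable def methodChar {s : ℕ} (b c : Fin s → ℝ) : List ℕ → ℝ :=
  Fin.foldl s (fun χ i => conv χ (expChar (b i) (c i))) unitChar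

theorem methodChar_zero (b c : Fin 0 → ℝ) : methodChar b c = unitChar := by
  simp [methodChar]

theorem methodChar_succ {s : ℕ} (b c : Fin (s + 1) → ℝ) :
    methodChar b c = conv (methodChar (fun i => b i.castSucc) fun i => c i.castSucc)
      (expChar (b (Fin.last s)) (c (Fin.last s))) := by
  simp [methodChar, Fin.foldl_succ_last]

/-- Characters of the shuffle algebra. -/
def IsShuffleChar (χ : List ℕ → ℝ) : Prop :=
  χ [] = 1 ∧ ∀ u v, ((shuffle u v).map χ).sum = χ u * χ v

theorem sum_map_cons {α : Type*} (l : List (List α)) (a : α) (χ : List α → ℝ) :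
    ((l.map (List.cons a)).map χ).sum = (l.map fun x => χ (a :: x)).sum := by
  rw [List.map_map]; rfl

theorem isShuffleChar_unitChar : IsShuffleChar unitChar := by
  refine ⟨rfl, fun u v => ?_⟩
  cases u with
  | nil => simp [shuffle_nil_left, unitChar]
  | cons a u =>
    cases v with
    | nil => simp [shuffle_nil_right, unitChar]
    | cons b v =>
      rw [shuffle_cons_cons, List.map_append, List.sum_append, sum_map_cons, sum_map_cons]
      simp [unitChar]

theorem length_of_mem_shuffle {u v x : List ℕ} (h : x ∈ shuffle u v) :
    x.length = u.length + v.length := by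
  simpa using (isMerge_of_mem_shuffle h).perm.length_eq

theorem sum_of_mem_shuffle {u v x : List ℕ} (h : x ∈ shuffle u v) :
    x.sum = u.sum + v.sum := by
  simpa using (isMerge_of_mem_shuffle h).perm.sum_eq

/-- Sorting the shuffles by their first letter reduces the claim to `p/(p+q) + q/(p+q) = 1` for the
lengths `p`, `q` of the two words. -/
theorem isShuffleChar_expChar (b c : ℝ) : IsShuffleChar (expChar b c) := by
  refine ⟨rfl, fun u => ?_⟩
  induction u with
  | nil => intro v; simp [shuffle_nil_left, expChar]
  | cons a u ihu =>
    intro v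
    induction v with
    | nil => simp [shuffle_nil_right, expChar]
    | cons d v ihv =>
      have key : ∀ (a : ℕ) (u v : List ℕ) (X : ℝ),
          ((shuffle u v).map (expChar b c)).sum = X →
          ((shuffle u v).map fun x => expChar b c (a :: x)).sum =
            b / (u.length + v.length + 1) * c ^ (a - 1) * X := by
        rintro a u v X rfl
        rw [← List.sum_map_mul_left]
        refine congrArg List.sum (List.map_congr_left fun x hx => ?_)
        simp [expChar, length_of_mem_shuffle hx]
      rw [shuffle_cons_cons, List.map_append, List.sum_append, sum_map_cons, sum_map_cons,
        key _ _ _ _ (ihu _), key _ _ _ _ ihv]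
      simp only [expChar, List.length_cons, Nat.cast_add, Nat.cast_one]
      have h1 : (u.length + 1 : ℝ) ≠ 0 := by positivity
      have h2 : (v.length + 1 : ℝ) ≠ 0 := by positivity
      have h3 : (u.length + (v.length + 1) + 1 : ℝ) ≠ 0 := by positivity
      have h4 : (u.length + 1 + v.length + 1 : ℝ) ≠ 0 := by positivity
      field_simp
      ring

/-- Cutting a shuffle of two words cuts both of them, and the parts are shuffles again;
multiplicativity of `χ` sums up the tails. Keeping `ξ` arbitrary lets the induction replace it by `ξ
(a :: ·)`. -/
theorem shuffle_conv {χ : List ℕ → ℝ} (hχ : IsShuffleChar χ) (ξ : List ℕ → ℝ) (u v : List ℕ) :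
    ((shuffle u v).map (conv χ ξ)).sum =
      conv χ (fun u₂ => conv χ (fun v₂ => ((shuffle u₂ v₂).map ξ).sum) v) u := by
  induction u generalizing v ξ with
  | nil => simp [shuffle_nil_left, conv_nil, hχ.1]
  | cons a u ihu =>
    induction v generalizing ξ with
    | nil =>
      simp only [shuffle_nil_right, conv_nil, hχ.1]
      simp
    | cons d v ihv =>
      have key : ∀ (a : ℕ) (u v : List ℕ),
          ((shuffle u v).map fun x => conv χ ξ (a :: x)).sum =
            ((shuffle u v).map fun x => χ (a :: x)).sum * ξ [] +
              ((shuffle u v).map (conv χ fun w => ξ (a :: w))).sum := by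
        intro a u v
        rw [← List.sum_map_mul_right, ← List.sum_map_add]
        rfl
      have hs := hχ.2 (a :: u) (d :: v)
      rw [shuffle_cons_cons, List.map_append, List.sum_append, sum_map_cons, sum_map_cons] at hs
      rw [shuffle_cons_cons, List.map_append, List.sum_append, sum_map_cons, sum_map_cons,
        key, key, ihu, ihv]
      rw [conv_cons χ _ a u, conv_cons χ _ a u]
      simp only [shuffle_nil_left, List.map_cons, List.map_nil, List.sum_cons, List.sum_nil,
        add_zero]
      have h1 : ∀ u₂, conv χ (fun v₂ => ((shuffle (a :: u₂) v₂).map ξ).sum) (d :: v) =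
          conv χ (fun v₂ => ((shuffle u₂ v₂).map fun x => ξ (a :: x)).sum) (d :: v) +
          conv χ (fun v₂ => ((shuffle (a :: u₂) v₂).map fun x => ξ (d :: x)).sum) v := by
        intro u₂
        rw [conv_cons, conv_cons]
        simp only [shuffle_nil_right, shuffle_cons_cons, List.map_append, List.sum_append,
          sum_map_cons, conv_add, List.map_cons, List.map_nil, List.sum_cons, List.sum_nil]
        ring
      simp only [h1, conv_add, conv_cons χ ξ d v]
      linear_combination hs * ξ []

theorem IsShuffleChar.conv {χ ξ : List ℕ → ℝ} (hχ : IsShuffleChar χ) (hξ : IsShuffleChar ξ) :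
    IsShuffleChar (conv χ ξ) := by
  refine ⟨by simp [conv_nil, hχ.1, hξ.1], fun u v => ?_⟩
  simp only [shuffle_conv hχ, hξ.2, conv_const_mul]
  simp only [mul_comm _ (Splitting.conv χ ξ v), conv_const_mul]

theorem isShuffleChar_methodChar {s : ℕ} (b c : Fin s → ℝ) :
    IsShuffleChar (methodChar b c) := by
  induction s with
  | zero => rw [methodChar_zero]; exact isShuffleChar_unitChar
  | succ s ih => rw [methodChar_succ]; exact (ih _ _).conv (isShuffleChar_expChar _ _)

/-- Integration by parts for iterated integrals. For monomials it is the identity `p/(p+q) + q/(p+q)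
= 1` for the weights of the two words; positive letters keep the denominators nonzero. -/
theorem intChar_shuffle (u v : List ℕ) (hu : ∀ n ∈ u, 0 < n) (hv : ∀ n ∈ v, 0 < n) :
    ((shuffle u v).map intChar).sum = intChar u * intChar v := by
  induction u generalizing v with
  | nil => simp [shuffle_nil_left, intChar]
  | cons a u ihu =>
    induction v with
    | nil => simp [shuffle_nil_right, intChar]
    | cons d v ihv =>
      have key : ∀ (a : ℕ) (u v : List ℕ) (X : ℝ),
          ((shuffle u v).map intChar).sum = X →
          ((shuffle u v).map fun x => intChar (a :: x)).sum =
            X / (a + (u.sum + v.sum) : ℕ) := by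
        rintro a u v X rfl
        rw [div_eq_mul_inv, ← List.sum_map_mul_right]
        refine congrArg List.sum (List.map_congr_left fun x hx => ?_)
        simp [intChar, sum_of_mem_shuffle hx, div_eq_mul_inv]
      rw [shuffle_cons_cons, List.map_append, List.sum_append, sum_map_cons, sum_map_cons,
        key _ _ _ _ (ihu _ (fun n hn => hu n (List.mem_cons_of_mem _ hn)) hv),
        key _ _ _ _ (ihv fun n hn => hv n (List.mem_cons_of_mem _ hn))]
      have ha : (0 : ℝ) < a := by exact_mod_cast hu a (by simp)
      have hd : (0 : ℝ) < d := by exact_mod_cast hv d (by simp)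
      simp only [intChar, List.sum_cons, Nat.cast_add]
      have h1 : (a + u.sum : ℝ) ≠ 0 := by positivity
      have h2 : (d + v.sum : ℝ) ≠ 0 := by positivity
      have h3 : (a + (u.sum + (d + v.sum)) : ℝ) ≠ 0 := by positivity
      have h4 : (d + (a + u.sum + v.sum) : ℝ) ≠ 0 := by positivity
      field_simp
      ring

/-! ### Reduction to Lyndon words -/

/-- Two characters that are multiplicative on shuffles of words of positive integers agree on a
downward closed set of words as soon as they agree on the Lyndon words of that set. The word on
which agreement is asked is read backwards. -/
theorem eq_of_forall_isLyndon {χ ξ : List ℕ → ℝ} {P : List ℕ → Prop}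
    (hχ : ∀ u v, (∀ n ∈ u, 0 < n) → (∀ n ∈ v, 0 < n) →
      ((shuffle u v).map χ).sum = χ u * χ v)
    (hξ : ∀ u v, (∀ n ∈ u, 0 < n) → (∀ n ∈ v, 0 < n) →
      ((shuffle u v).map ξ).sum = ξ u * ξ v)
    (hP : ∀ w w', P w → w' ≠ [] → w'.sum ≤ w.sum → w'.length ≤ w.length → P w')
    (hL : ∀ w, IsLyndon w → P w →
      (∀ w', (∀ n ∈ w', 0 < n) → w' ≠ [] → P w' → w'.sum < w.sum → χ w'.reverse = ξ w'.reverse) →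
      χ w.reverse = ξ w.reverse) :
    ∀ w, (∀ n ∈ w, 0 < n) → w ≠ [] → P w → χ w.reverse = ξ w.reverse := by
  -- Weight comes first, so that the factors `u`, `v` are smaller than `u ++ v`. The other shuffles
  -- of `u` and `v` have the same weight and length and are lexicographically smaller.
  have hwf : WellFounded (InvImage (Prod.Lex (· < ·) (List.Shortlex (· < ·)))
      fun w : List ℕ => (w.sum, w)) :=
    InvImage.wf _ (WellFounded.prod_lex wellFounded_lt (List.Shortlex.wf wellFounded_lt))
  intro w
  induction w using hwf.induction with
  | h w ih =>
    intro hpos hw hPw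
    have hlow : ∀ w', (∀ n ∈ w', 0 < n) → w' ≠ [] → P w' → w'.sum < w.sum →
        χ w'.reverse = ξ w'.reverse :=
      fun w' h1 h2 h3 h4 => ih w' (Prod.Lex.left _ _ h4) h1 h2 h3
    by_cases hLw : IsLyndon w
    · exact hL w hLw hPw hlow
    obtain ⟨u, v, hu, hv, rfl, hmin⟩ := exists_append_of_not_isLyndon hw hpos hLw
    have hup : ∀ n ∈ u, 0 < n := fun n hn => hpos n (List.mem_append_left _ hn)
    have hvp : ∀ n ∈ v, 0 < n := fun n hn => hpos n (List.mem_append_right _ hn)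
    have hsum : ∀ w : List ℕ, w ≠ [] → (∀ n ∈ w, 0 < n) → 0 < w.sum := by
      intro w hw h
      cases w with
      | nil => exact absurd rfl hw
      | cons a w => have := h a (by simp); simp only [List.sum_cons]; omega
    have hus := hsum u hu hup
    have hvs := hsum v hv hvp
    have eu : χ u.reverse = ξ u.reverse :=
      hlow u hup hu (hP _ _ hPw hu (by simp) (by simp)) (by simp; omega)
    have ev : χ v.reverse = ξ v.reverse :=
      hlow v hvp hv (hP _ _ hPw hv (by simp) (by simp)) (by simp; omega)
    have hru : ∀ n ∈ u.reverse, 0 < n := by simpa using hup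
    have hrv : ∀ n ∈ v.reverse, 0 < n := by simpa using hvp
    have e1 := hχ _ _ hru hrv
    rw [eu, ev, ← hξ _ _ hru hrv] at e1
    have e2 : (((shuffle u.reverse v.reverse).map fun x => χ x - ξ x)).sum = 0 := by
      have hsub : ∀ l : List (List ℕ),
          (l.map fun x => χ x - ξ x).sum = (l.map χ).sum - (l.map ξ).sum := by
        intro l
        induction l with
        | nil => simp
        | cons a l ih => simp only [List.map_cons, List.sum_cons, ih]; ring
      rw [hsub, e1, sub_self]
    have e3 : ∀ x ∈ shuffle u.reverse v.reverse, x ≠ (u ++ v).reverse → χ x - ξ x = 0 := by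
      intro x hx hne
      have hm := (isMerge_of_mem_shuffle hx).reverse
      rw [List.reverse_reverse, List.reverse_reverse] at hm
      have hle := hm.le_append hmin
      have hlt : x.reverse < u ++ v := lt_of_le_of_ne hle fun h => hne (by rw [← h]; simp)
      have hperm := hm.perm
      have := ih x.reverse (by
          have : x.reverse.sum = (u ++ v).sum := hperm.sum_eq
          simp only [InvImage, this]
          exact Prod.Lex.right _ (List.Shortlex.of_lex hperm.length_eq (List.lex_lt.2 hlt)))
        (fun n hn => hpos n (hperm.mem_iff.1 hn))
        (by rintro h; rw [h] at hperm; simp [hu] at hperm)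
        (hP _ _ hPw (by rintro h; rw [h] at hperm; simp [hu] at hperm) hperm.sum_eq.le
          hperm.length_eq.le)
      rw [List.reverse_reverse] at this
      rw [this, sub_self]
    -- Only the largest shuffle survives in the sum, with its multiplicity, which is nonzero and can
    -- be cancelled.
    rw [Finset.sum_list_map_count] at e2
    have hmem : (u ++ v).reverse ∈ shuffle u.reverse v.reverse := by
      rw [List.reverse_append]
      exact (IsMerge.append_left _ _).comm.mem_shuffle
    rw [Finset.sum_eq_single_of_mem _ (List.mem_toFinset.2 hmem)] at e2
    · rw [nsmul_eq_mul] at e2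
      rcases mul_eq_zero.1 e2 with h | h
      · exact absurd hmem ((@List.count_eq_zero _ instBEqOfDecidableEq _ _ _).1 (Nat.cast_eq_zero.1 h))
      · exact sub_eq_zero.1 h
    · intro x hx hne
      rw [e3 x (List.mem_toFinset.1 hx) hne, smul_zero]

/-! ### Time reversal and words of even weight -/

/-- The effect on iterated integrals and sums of replacing `t ^ (j - 1)` by `(1 + t) ^ (j - 1)`. -/
def shift (χ : List ℕ → ℝ) : List ℕ → ℝ
  | [] => χ []
  | j :: w => ∑ i ∈ Finset.range j, ((j - 1).choose i : ℝ) * shift (fun v => χ ((i + 1) :: v)) w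

theorem shift_cons (χ : List ℕ → ℝ) (j : ℕ) (w : List ℕ) :
    shift χ (j :: w) =
      ∑ i ∈ Finset.range j, ((j - 1).choose i : ℝ) * shift (fun v => χ ((i + 1) :: v)) w := rfl

theorem shift_congr {χ ξ : List ℕ → ℝ} {w : List ℕ}
    (h : ∀ v : List ℕ, (∀ n ∈ v, 0 < n) → v.length = w.length → v.sum ≤ w.sum → χ v = ξ v) :
    shift χ w = shift ξ w := by
  induction w generalizing χ ξ with
  | nil => exact h [] (by simp) rfl (by simp)
  | cons j w ih =>
    rw [shift_cons, shift_cons]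
    refine Finset.sum_congr rfl fun i hi => ?_
    rw [ih]
    intro v hv hlen hsum
    have := Finset.mem_range.1 hi
    exact h _ (by simpa using hv) (by simp [hlen]) (by simp; omega)

theorem shift_add (χ ξ : List ℕ → ℝ) (w : List ℕ) :
    shift (fun v => χ v + ξ v) w = shift χ w + shift ξ w := by
  induction w generalizing χ ξ with
  | nil => rfl
  | cons j w ih =>
    simp only [shift_cons, ih, mul_add, Finset.sum_add_distrib]

theorem shift_const_mul (χ : List ℕ → ℝ) (r : ℝ) (w : List ℕ) :
    shift (fun v => r * χ v) w = r * shift χ w := by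
  induction w generalizing χ with
  | nil => rfl
  | cons j w ih =>
    simp only [shift_cons, ih, Finset.mul_sum]
    exact Finset.sum_congr rfl fun i _ => by ring

theorem shift_conv (χ ξ : List ℕ → ℝ) (w : List ℕ) :
    shift (conv χ ξ) w = conv (shift χ) (shift ξ) w := by
  have hsum : ∀ (n : ℕ) (f : ℕ → List ℕ → ℝ) (η : List ℕ → ℝ) (w : List ℕ),
      conv η (fun v => ∑ i ∈ Finset.range n, f i v) w =
        ∑ i ∈ Finset.range n, conv η (f i) w := by
    intro n f η w
    simp only [conv_eq_sum, Finset.mul_sum]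
    exact Finset.sum_comm
  induction w generalizing ξ with
  | nil => rfl
  | cons j w ih =>
    rw [shift_cons, conv_cons, shift_cons, Finset.sum_mul]
    simp only [conv_cons, shift_cons, hsum, conv_const_mul]
    rw [← Finset.sum_add_distrib]
    refine Finset.sum_congr rfl fun i _ => ?_
    rw [shift_add]
    have : (fun v => χ ((i + 1) :: v) * ξ []) = fun v => ξ [] * χ ((i + 1) :: v) := by
      funext v; ring
    rw [this, shift_const_mul, ih]
    simp only [shift]
    ring

/-- The binomial theorem for `(1 + c) ^ (j - 1)`, applied letter by letter. -/
theorem shift_expChar (b c : ℝ) {w : List ℕ} (hw : ∀ n ∈ w, 0 < n) :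
    shift (expChar b c) w = expChar b (1 + c) w := by
  have hlen : ∀ (w : List ℕ) (χ : List ℕ → ℝ), shift (fun v => b / (v.length + 1) * χ v) w =
      b / (w.length + 1) * shift χ w := by
    intro w χ
    rw [← shift_const_mul]
    exact shift_congr fun v _ h _ => by rw [h]
  induction w with
  | nil => rfl
  | cons j w ih =>
    rw [shift_cons]
    have h1 : ∀ i, shift (fun v => expChar b c ((i + 1) :: v)) w =
        b / (w.length + 1) * c ^ i * expChar b (1 + c) w := by
      intro i
      have : (fun v => expChar b c ((i + 1) :: v)) =
          fun v : List ℕ => b / (v.length + 1) * (c ^ i * expChar b c v) := by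
        funext v; simp [expChar]; ring
      rw [this, hlen, shift_const_mul, ih fun n hn => hw n (List.mem_cons_of_mem _ hn)]
      ring
    obtain ⟨j, rfl⟩ : ∃ k, j = k + 1 := Nat.exists_eq_succ_of_ne_zero (hw j (by simp)).ne'
    simp only [h1]
    simp only [expChar, Nat.add_sub_cancel]
    rw [add_comm (1 : ℝ) c, add_pow, Finset.mul_sum, Finset.sum_mul]
    refine Finset.sum_congr rfl fun i _ => ?_
    rw [one_pow]
    ring

/-- Rescaling of time. -/
def scale (τ : ℝ) (χ : List ℕ → ℝ) (w : List ℕ) : ℝ := τ ^ w.sum * χ w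

theorem scale_conv (τ : ℝ) (χ ξ : List ℕ → ℝ) (w : List ℕ) :
    scale τ (conv χ ξ) w = conv (scale τ χ) (scale τ ξ) w := by
  rw [scale, conv_eq_sum, conv_eq_sum, Finset.mul_sum]
  refine Finset.sum_congr rfl fun i _ => ?_
  have : w.sum = (w.drop i).sum + (w.take i).sum := by
    conv_lhs => rw [← List.take_append_drop i w, List.sum_append, add_comm]
  rw [scale, scale, this, pow_add]
  ring

theorem scale_expChar (τ b c : ℝ) {w : List ℕ} (hw : ∀ n ∈ w, 0 < n) :
    scale τ (expChar b c) w = expChar (τ * b) (τ * c) w := by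
  induction w with
  | nil => simp [scale, expChar]
  | cons j w ih =>
    rw [expChar, ← ih fun n hn => hw n (List.mem_cons_of_mem _ hn)]
    obtain ⟨j, rfl⟩ : ∃ k, j = k + 1 := Nat.exists_eq_succ_of_ne_zero (hw j (by simp)).ne'
    simp only [scale, expChar, List.sum_cons, Nat.add_sub_cancel]
    ring

theorem conv_congr {χ χ' ξ ξ' : List ℕ → ℝ} {w : List ℕ} 
    (h : ∀ v : List ℕ, (∀ n ∈ v, n ∈ w) → χ v = χ' v)
    (h' : ∀ v : List ℕ, (∀ n ∈ v, n ∈ w) → ξ v = ξ' v) : conv χ ξ w = conv χ' ξ' w := by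
  rw [conv_eq_sum, conv_eq_sum]
  exact Finset.sum_congr rfl fun i _ => by
    rw [h _ fun n hn => List.mem_of_mem_drop hn, h' _ fun n hn => List.mem_of_mem_take hn]

theorem scale_methodChar {s : ℕ} (τ : ℝ) (b c : Fin s → ℝ) {w : List ℕ} (hw : ∀ n ∈ w, 0 < n) :
    scale τ (methodChar b c) w = methodChar (fun i => τ * b i) (fun i => τ * c i) w := by
  induction s generalizing w with
  | zero => cases w <;> simp [methodChar_zero, scale, unitChar]
  | succ s ih =>
    rw [methodChar_succ, methodChar_succ, scale_conv]
    exact conv_congr (fun v hv => ih _ _ fun n hn => hw n (hv n hn))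
      fun v hv => scale_expChar _ _ _ fun n hn => hw n (hv n hn)

theorem shift_methodChar {s : ℕ} (b c : Fin s → ℝ) {w : List ℕ} (hw : ∀ n ∈ w, 0 < n) :
    shift (methodChar b c) w = methodChar b (fun i => 1 + c i) w := by
  induction s generalizing w with
  | zero =>
    rw [methodChar_zero, methodChar_zero]
    cases w with
    | nil => rfl
    | cons j w =>
      rw [shift_cons]
      have hz : ∀ w : List ℕ, shift (fun _ => 0) w = 0 := fun w => by
        simpa using shift_const_mul (fun _ => 0) 0 w
      simp [unitChar, hz]
  | succ s ih =>
    rw [methodChar_succ, methodChar_succ, shift_conv]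
    exact conv_congr (fun v hv => ih _ _ fun n hn => hw n (hv n hn))
      fun v hv => shift_expChar _ _ fun n hn => hw n (hv n hn)

theorem hasDerivAt_conv {χ : List ℕ → ℝ} {ξ : ℝ → List ℕ → ℝ} {ξ' : List ℕ → ℝ} {t : ℝ}
    {w : List ℕ} (h : ∀ v : List ℕ, v <+: w → HasDerivAt (fun s => ξ s v) (ξ' v) t) :
    HasDerivAt (fun s => conv χ (ξ s) w) (conv χ ξ' w) t := by
  simp only [conv_eq_sum]
  exact HasDerivAt.fun_sum fun i _ => (h _ (List.take_prefix i w)).const_mul _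

theorem hasDerivAt_shift {χ : ℝ → List ℕ → ℝ} {χ' : List ℕ → ℝ} {t : ℝ} {w : List ℕ}
    (h : ∀ v, (∀ n ∈ v, 0 < n) → HasDerivAt (fun s => χ s v) (χ' v) t) :
    HasDerivAt (fun s => shift (χ s) w) (shift χ' w) t := by
  induction w generalizing χ χ' with
  | nil => exact h [] (by simp)
  | cons j w ih =>
    simp only [shift_cons]
    refine HasDerivAt.fun_sum fun i _ => (ih ?_).const_mul _
    exact fun v hv => h _ (by simpa using hv)

/-- `scale τ intChar` is the iterated integral over `[0, τ]`, and differentiating in the upper limit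
strips the outermost integral. -/
theorem hasDerivAt_scale_intChar (τ : ℝ) {j : ℕ} {w : List ℕ} (hj : 0 < j) :
    HasDerivAt (fun s => scale s intChar (j :: w)) (τ ^ (j - 1) * scale τ intChar w) τ := by
  obtain ⟨j, rfl⟩ : ∃ k, j = k + 1 := Nat.exists_eq_succ_of_ne_zero hj.ne'
  simp only [scale, intChar, List.sum_cons]
  refine ((hasDerivAt_pow _ τ).mul_const _).congr_deriv ?_
  have h : ((j + 1 + w.sum : ℕ) : ℝ) ≠ 0 := by positivity
  rw [show j + 1 + w.sum - 1 = j + w.sum by omega, pow_add]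
  field_simp
  simp only [Nat.add_sub_cancel]
  ring

theorem hasDerivAt_shift_scale_intChar (τ : ℝ) {j : ℕ} {w : List ℕ} (hj : 0 < j) :
    HasDerivAt (fun s => shift (scale s intChar) (j :: w))
      ((1 + τ) ^ (j - 1) * shift (scale τ intChar) w) τ := by
  simp only [shift_cons]
  have h : ∀ i ∈ Finset.range j, HasDerivAt
      (fun s => ((j - 1).choose i : ℝ) * shift (fun v => scale s intChar ((i + 1) :: v)) w)
      (((j - 1).choose i : ℝ) * (τ ^ i * shift (scale τ intChar) w)) τ := by
    intro i _
    refine HasDerivAt.const_mul _ ?_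
    rw [← shift_const_mul]
    exact hasDerivAt_shift fun v _ => hasDerivAt_scale_intChar τ (Nat.succ_pos i)
  refine (HasDerivAt.fun_sum h).congr_deriv ?_
  obtain ⟨j, rfl⟩ : ∃ k, j = k + 1 := Nat.exists_eq_succ_of_ne_zero hj.ne'
  rw [add_comm (1 : ℝ) τ, Nat.add_sub_cancel, add_pow, Finset.sum_mul]
  refine Finset.sum_congr rfl fun i _ => ?_
  rw [one_pow]
  ring

theorem scale_zero (χ : List ℕ → ℝ) {j : ℕ} {w : List ℕ} (hj : 0 < j) : scale 0 χ (j :: w) = 0 := by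
  rw [scale, List.sum_cons, zero_pow (by omega), zero_mul]

theorem shift_scale_zero {χ : List ℕ → ℝ} (hχ : χ [] = 1) (w : List ℕ) :
    shift (scale 0 χ) w = unitChar w := by
  cases w with
  | nil => simp [shift, scale, unitChar, hχ]
  | cons j w =>
    rw [shift_cons, unitChar]
    refine Finset.sum_eq_zero fun i _ => ?_
    have : (fun v => scale 0 χ ((i + 1) :: v)) = fun v => 0 * scale 0 χ ((i + 1) :: v) := by
      funext v; rw [scale_zero _ (Nat.succ_pos i), mul_zero]
    rw [this, shift_const_mul]
    ring

/-- Concatenation of integration intervals. -/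
theorem conv_intChar_shift_scale (τ : ℝ) {w : List ℕ} (hw : ∀ n ∈ w, 0 < n) :
    conv intChar (shift (scale τ intChar)) w = scale (1 + τ) intChar w := by
  induction w generalizing τ with
  | nil => simp [conv_nil, intChar, shift, scale]
  | cons j w ih =>
    have hj := hw j (by simp)
    have hw' : ∀ n ∈ w, 0 < n := fun n hn => hw n (List.mem_cons_of_mem _ hn)
    -- Both sides have the same derivative in `τ`, by the induction hypothesis for `w`, and agree at
    -- `τ = 0`.
    have h1 : ∀ t, HasDerivAt (fun s => conv intChar (shift (scale s intChar)) (j :: w))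
        ((1 + t) ^ (j - 1) * scale (1 + t) intChar w) t := by
      intro t
      simp only [conv_cons]
      rw [← ih t hw', ← conv_const_mul]
      have h2 : HasDerivAt (fun s => conv intChar (fun v => shift (scale s intChar) (j :: v)) w)
          (conv intChar (fun v => (1 + t) ^ (j - 1) * shift (scale t intChar) v) w) t :=
        hasDerivAt_conv fun v _ => hasDerivAt_shift_scale_intChar t hj
      simpa [shift, scale, intChar] using h2.const_add (intChar (j :: w))
    have h3 : ∀ t, HasDerivAt (fun s => scale (1 + s) intChar (j :: w))
        ((1 + t) ^ (j - 1) * scale (1 + t) intChar w) t := fun t =>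
      HasDerivAt.comp_const_add 1 t (hasDerivAt_scale_intChar (1 + t) hj)
    have h4 : ∀ t, HasDerivAt (fun s => conv intChar (shift (scale s intChar)) (j :: w) -
        scale (1 + s) intChar (j :: w)) 0 t := fun t =>
      ((h1 t).fun_sub (h3 t)).congr_deriv (sub_self _)
    have h5 := is_const_of_deriv_eq_zero (fun t => (h4 t).differentiableAt)
      (fun t => (h4 t).deriv) τ 0
    have h6 : conv intChar (shift (scale 0 intChar)) (j :: w) = intChar (j :: w) := by
      rw [show shift (scale 0 intChar) = unitChar from funext (shift_scale_zero rfl),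
        conv_unitChar]
    simp only [h6, add_zero] at h5
    rw [show scale 1 intChar (j :: w) = intChar (j :: w) by simp [scale], sub_self] at h5
    exact sub_eq_zero.1 h5

/-- Integrating from `0` to `1` and back from `1` to `0` gives nothing: the exact flow is inverted
by time reversal. -/
theorem conv_intChar_shift_scale_neg_one {w : List ℕ} (hw : ∀ n ∈ w, 0 < n) (h0 : w ≠ []) :
    conv intChar (shift (scale (-1) intChar)) w = 0 := by
  rw [conv_intChar_shift_scale _ hw, add_neg_cancel]
  cases w with
  | nil => exact absurd rfl h0
  | cons j w => exact scale_zero _ (hw j (by simp))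

/-- The expansion of the shift contains `w` itself with coefficient one; every other word in it has
the same length and smaller weight. -/
theorem shift_eq_of_forall_sum_lt {δ : List ℕ → ℝ} {w : List ℕ} (hw : ∀ n ∈ w, 0 < n)
    (h : ∀ v, (∀ n ∈ v, 0 < n) → v.length = w.length → v.sum < w.sum → δ v = 0) :
    shift δ w = δ w := by
  induction w generalizing δ with
  | nil => rfl
  | cons j w ih =>
    obtain ⟨j, rfl⟩ : ∃ k, j = k + 1 := Nat.exists_eq_succ_of_ne_zero (hw j (by simp)).ne'
    have hw' : ∀ n ∈ w, 0 < n := fun n hn => hw n (List.mem_cons_of_mem _ hn)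
    rw [shift_cons, Finset.sum_range_succ, Finset.sum_eq_zero, zero_add, Nat.add_sub_cancel,
      Nat.choose_self, Nat.cast_one, one_mul]
    · refine ih hw' fun v hv hlen hsum => h _ (by simpa using hv) (by simp [hlen]) (by simp; omega)
    · intro i hi
      have hi := Finset.mem_range.1 hi
      have : shift (fun v => δ ((i + 1) :: v)) w = shift (fun v => 0 * δ v) w :=
        shift_congr fun v hv hlen hsum => by
          rw [zero_mul]
          exact h _ (by simpa using hv) (by simp [hlen]) (by simp; omega)
      rw [this, shift_const_mul]
      ring

/-- Two functions on words inverted by time reversal agree on words of even weight if they agree on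
all words of smaller weight. -/
theorem eq_of_even_sum {χ ξ : List ℕ → ℝ} (hχ0 : χ [] = 1) (hξ0 : ξ [] = 1) {w : List ℕ}
    (hw : ∀ n ∈ w, 0 < n) (hw0 : w ≠ [])
    (hχ : conv χ (shift (scale (-1) χ)) w = 0) (hξ : conv ξ (shift (scale (-1) ξ)) w = 0)
    (heven : Even w.sum)
    (h : ∀ v, (∀ n ∈ v, 0 < n) → v ≠ [] → v.length ≤ w.length → v.sum < w.sum → χ v = ξ v) :
    χ w = ξ w := by
  have h' : ∀ v : List ℕ, (∀ n ∈ v, 0 < n) → v.length ≤ w.length → v.sum < w.sum → χ v = ξ v := by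
    intro v hv hlen hsum
    by_cases hv0 : v = []
    · rw [hv0, hχ0, hξ0]
    · exact h v hv hv0 hlen hsum
  have hs : ∀ v : List ℕ, (∀ n ∈ v, 0 < n) → v ≠ [] → 0 < v.sum := by
    intro v hv h0
    cases v with
    | nil => exact absurd rfl h0
    | cons a v => have := hv a (by simp); simp only [List.sum_cons]; omega
  have hpart : ∀ v : List ℕ, (∀ n ∈ v, 0 < n) → v.length ≤ w.length → v.sum < w.sum →
      shift (scale (-1) χ) v = shift (scale (-1) ξ) v := fun v hv hlen hsum =>
    shift_congr fun u hu hul hus => by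
      rw [scale, scale, h' u hu (hul.trans_le hlen) (hus.trans_lt hsum)]
  -- Time reversal gives the sign `(-1) ^ w.sum = 1`, so this term adds to `χ w - ξ w` instead of
  -- cancelling it.
  have htop : shift (scale (-1) χ) w - shift (scale (-1) ξ) w = χ w - ξ w := by
    have h1 : shift (scale (-1) χ) w - shift (scale (-1) ξ) w =
        shift (fun v => scale (-1) χ v + (-1) * scale (-1) ξ v) w := by
      rw [shift_add, shift_const_mul]; ring
    rw [h1, shift_eq_of_forall_sum_lt hw]
    · rw [scale, scale, heven.neg_one_pow]; ring
    · intro v hv hlen hsum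
      rw [scale, scale, h' v hv hlen.le hsum]; ring
  have hlen : w.length ≠ 0 := by simpa using hw0
  obtain ⟨n, hn⟩ := Nat.exists_eq_succ_of_ne_zero hlen
  -- The two cuts with an empty part are separated; in all other cuts both parts have smaller weight
  -- than `w`.
  have hsplit : ∀ η : List ℕ → ℝ, η [] = 1 → conv η (shift (scale (-1) η)) w =
      ∑ i ∈ Finset.range n, η (w.drop (i + 1)) * shift (scale (-1) η) (w.take (i + 1)) + η w +
        shift (scale (-1) η) w := by
    intro η hη
    rw [conv_eq_sum, Finset.sum_range_succ, hn, Nat.succ_eq_add_one, Finset.sum_range_succ',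
      ← Nat.succ_eq_add_one, ← hn]
    simp [hη, shift, scale]
  rw [hsplit χ hχ0] at hχ
  rw [hsplit ξ hξ0] at hξ
  have hmid : ∑ i ∈ Finset.range n, χ (w.drop (i + 1)) * shift (scale (-1) χ) (w.take (i + 1)) =
      ∑ i ∈ Finset.range n, ξ (w.drop (i + 1)) * shift (scale (-1) ξ) (w.take (i + 1)) := by
    refine Finset.sum_congr rfl fun i hi => ?_
    have hi := Finset.mem_range.1 hi
    have hd : ∀ n ∈ w.drop (i + 1), 0 < n := fun n hn => hw n (List.mem_of_mem_drop hn)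
    have ht : ∀ n ∈ w.take (i + 1), 0 < n := fun n hn => hw n (List.mem_of_mem_take hn)
    have hsum : w.sum = (w.take (i + 1)).sum + (w.drop (i + 1)).sum := by
      rw [← List.sum_append, List.take_append_drop]
    have hd0 := hs _ hd (by rw [ne_eq, List.drop_eq_nil_iff]; omega)
    have ht0 := hs _ ht (by simp [hw0])
    rw [h' _ hd (by simp) (by omega), hpart _ ht (by simp) (by omega)]
  linarith

/-! ### The order conditions as identities between characters -/

/-- Extend a map into `Fin s` by the last element of `Fin (s + 1)`. -/
def appendLast {p s : ℕ} (q : ℕ) (i : Fin p → Fin s) : Fin (p + q) → Fin (s + 1) :=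
  Fin.append (fun l => (i l).castSucc) fun _ => Fin.last s

theorem appendLast_castAdd {p s : ℕ} (q : ℕ) (i : Fin p → Fin s) (l : Fin p) :
    appendLast q i (Fin.castAdd q l) = (i l).castSucc := by
  simp [appendLast]

theorem appendLast_natAdd {p s : ℕ} (q : ℕ) (i : Fin p → Fin s) (l : Fin q) :
    appendLast q i (Fin.natAdd p l) = Fin.last s := by
  simp [appendLast]

theorem monotone_appendLast {p s : ℕ} (q : ℕ) {i : Fin p → Fin s} (hi : Monotone i) :
    Monotone (appendLast q i) := by
  intro l l' hl
  induction l' using Fin.addCases with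
  | left l' =>
    induction l using Fin.addCases with
    | left l =>
      rw [appendLast_castAdd, appendLast_castAdd]
      exact Fin.castSucc_le_castSucc_iff.2 (hi (show l ≤ l' from hl))
    | right l =>
      exfalso
      simp only [Fin.le_def, Fin.val_natAdd, Fin.val_castAdd] at hl
      omega
  | right l' =>
    rw [appendLast_natAdd]
    exact Fin.le_last _

theorem card_filter_appendLast {p s : ℕ} (q : ℕ) (i : Fin p → Fin s) :
    (Finset.univ.filter fun l => appendLast q i l ≠ Fin.last s).card = p := by
  rw [Finset.card_filter, Fin.sum_univ_add]
  simp [appendLast_castAdd, appendLast_natAdd]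

theorem sigma_appendLast {p s : ℕ} (q : ℕ) (i : Fin p → Fin s) :
    sigma (appendLast q i) = sigma i * q.factorial := by
  rw [sigma, Fin.prod_univ_castSucc, sigma]
  congr 1
  · refine Finset.prod_congr rfl fun r _ => ?_
    rw [Finset.card_filter, Finset.card_filter, Fin.sum_univ_add]
    simp [appendLast_castAdd, appendLast_natAdd, (Fin.castSucc_ne_last r).symm]
  · rw [Finset.card_filter, Fin.sum_univ_add]
    simp [appendLast_castAdd, appendLast_natAdd]

theorem ne_last_iff_of_card {k s p : ℕ} {i : Fin k → Fin (s + 1)} (hi : Monotone i)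
    (hc : (Finset.univ.filter fun l => i l ≠ Fin.last s).card = p) (l : Fin k) :
    i l ≠ Fin.last s ↔ l.val < p := by
  constructor
  · intro h
    have hsub : Finset.Iic l ⊆ Finset.univ.filter fun l => i l ≠ Fin.last s := by
      intro l' hl'
      rw [Finset.mem_filter]
      refine ⟨Finset.mem_univ _, fun h' => h ?_⟩
      exact le_antisymm (Fin.le_last _) (h' ▸ hi (Finset.mem_Iic.1 hl'))
    have := Finset.card_le_card hsub
    rw [hc, Fin.card_Iic] at this
    omega
  · intro h h'
    have hsub : (Finset.univ.filter fun l => i l ≠ Fin.last s) ⊆ Finset.Iio l := by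
      intro l' hl'
      rw [Finset.mem_filter] at hl'
      rw [Finset.mem_Iio]
      by_contra hle
      rw [not_lt] at hle
      exact hl'.2 (le_antisymm (Fin.le_last _) (h' ▸ hi hle))
    have := Finset.card_le_card hsub
    rw [hc, Fin.card_Iio] at this
    omega

-- A monotone tuple is a monotone tuple of smaller indices followed by a block of copies of the last
-- index, and `p` is the position where that block starts.
open scoped Classical in
theorem sum_monotone_eq_sum_appendLast {p q s : ℕ} (F : (Fin (p + q) → Fin (s + 1)) → ℝ) :
    ∑ i ∈ (Finset.univ.filter fun i : Fin (p + q) → Fin (s + 1) => Monotone i).filter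
        (fun i => (Finset.univ.filter fun l => i l ≠ Fin.last s).card = p), F i =
      ∑ i ∈ Finset.univ.filter (fun i : Fin p → Fin s => Monotone i), F (appendLast q i) := by
  symm
  refine Finset.sum_bij (fun i _ => appendLast q i) ?_ ?_ ?_ fun _ _ => rfl
  · intro i hi
    simp only [Finset.mem_filter, Finset.mem_univ, true_and] at hi ⊢
    exact ⟨monotone_appendLast q hi, card_filter_appendLast q i⟩
  · intro i _ i' _ h
    funext l
    have := congrFun h (Fin.castAdd q l)
    rw [appendLast_castAdd, appendLast_castAdd] at this
    exact Fin.castSucc_injective _ this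
  · intro i hi
    simp only [Finset.mem_filter, Finset.mem_univ, true_and] at hi
    have hlt : ∀ l : Fin p, i (Fin.castAdd q l) ≠ Fin.last s := fun l =>
      (ne_last_iff_of_card hi.1 hi.2 _).2 (by simp)
    refine ⟨fun l => (i (Fin.castAdd q l)).castPred (hlt l), ?_, ?_⟩
    · simp only [Finset.mem_filter, Finset.mem_univ, true_and]
      intro l l' hl
      exact Fin.castPred_le_castPred_iff.2 (hi.1 (show Fin.castAdd q l ≤ Fin.castAdd q l' from hl))
    · funext l
      induction l using Fin.addCases with
      | left l => rw [appendLast_castAdd, Fin.castSucc_castPred]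
      | right l =>
        rw [appendLast_natAdd]
        by_contra h
        have := (ne_last_iff_of_card hi.1 hi.2 _).1 (Ne.symm h)
        simp at this

theorem expChar_eq (b c : ℝ) (w : List ℕ) :
    expChar b c w = b ^ w.length / w.length.factorial * (w.map fun j => c ^ (j - 1)).prod := by
  induction w with
  | nil => simp [expChar]
  | cons j w ih =>
    rw [expChar, ih, List.length_cons, Nat.factorial_succ, List.map_cons, List.prod_cons]
    push_cast
    have : (w.length.factorial : ℝ) ≠ 0 := by positivity
    field_simp
    ring

-- Induction on the number of stages: the final block of `q` indices equal to the last stage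
-- contributes `b ^ q / q!` and its powers of `c`, which is `expChar` on the first `q` letters of
-- the reversed word. The cuts in `conv` run over the possible `q`.
open scoped Classical in
theorem methodChar_ofFn_reverse {s k : ℕ} (b c : Fin s → ℝ) (j : Fin k → ℕ) :
    methodChar b c (List.ofFn j).reverse =
      ∑ i ∈ Finset.univ.filter (fun i : Fin k → Fin s => Monotone i),
        (∏ l, b (i l)) / (sigma i : ℝ) * ∏ l, c (i l) ^ (j l - 1) := by
  induction s generalizing k with
  | zero =>
    rw [methodChar_zero]
    cases k with
    | zero => simp [unitChar, sigma, Finset.filter_true_of_mem, Subsingleton.monotone]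
    | succ k =>
      rw [Finset.univ_eq_empty, Finset.filter_empty, Finset.sum_empty, List.ofFn_succ',
        List.concat_eq_append, List.reverse_append]
      rfl
  | succ s ih =>
    rw [methodChar_succ, conv_eq_sum]
    have hmaps : ∀ i ∈ Finset.univ.filter (fun i : Fin k → Fin (s + 1) => Monotone i),
        (Finset.univ.filter fun l => i l ≠ Fin.last s).card ∈ Finset.range (k + 1) := by
      intro i _
      rw [Finset.mem_range, Nat.lt_succ_iff]
      simpa using Finset.card_filter_le (Finset.univ : Finset (Fin k)) fun l => i l ≠ Fin.last s
    rw [← Finset.sum_fiberwise_of_maps_to hmaps, ← Finset.sum_range_reflect]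
    simp only [List.length_reverse, List.length_ofFn]
    refine Finset.sum_congr rfl fun p hp => ?_
    obtain ⟨q, rfl⟩ := Nat.exists_eq_add_of_le (Nat.lt_succ_iff.1 (Finset.mem_range.1 hp))
    rw [sum_monotone_eq_sum_appendLast, List.ofFn_add, List.reverse_append,
      show p + q + 1 - 1 - p = q by omega]
    rw [List.drop_left' (by simp), List.take_left' (by simp), expChar_eq]
    have h1 : ∀ l : Fin p, Fin.castLE (Nat.le_add_right p q) l = Fin.castAdd q l := fun _ => rfl
    rw [ih, Finset.sum_mul]
    refine Finset.sum_congr rfl fun i _ => ?_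
    rw [sigma_appendLast, Fin.prod_univ_add, Fin.prod_univ_add]
    simp only [appendLast_castAdd, appendLast_natAdd, List.map_reverse, List.prod_reverse,
      List.map_ofFn, List.prod_ofFn, Finset.prod_const, Finset.card_univ, Fintype.card_fin, h1,
      List.length_reverse, List.length_ofFn, Function.comp_def]
    push_cast
    have h2 : (q.factorial : ℝ) ≠ 0 := by positivity
    field_simp

theorem intChar_ofFn_reverse {k : ℕ} (j : Fin k → ℕ) :
    intChar (List.ofFn j).reverse = 1 / ∏ l : Fin k, ∑ p ∈ Finset.Iic l, (j p : ℝ) := by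
  induction k with
  | zero => simp [intChar]
  | succ k ih =>
    rw [List.ofFn_succ', List.concat_eq_append, List.reverse_append, List.reverse_singleton,
      List.singleton_append, intChar, ih, Fin.prod_univ_castSucc]
    have h1 : ∀ l : Fin k, ∑ p ∈ Finset.Iic l.castSucc, (j p : ℝ) =
        ∑ p ∈ Finset.Iic l, (j p.castSucc : ℝ) := by
      intro l
      rw [← Fin.map_castSuccEmb_Iic, Finset.sum_map]
      rfl
    have h2 : ∑ p ∈ Finset.Iic (Fin.last k), (j p : ℝ) =
        (j (Fin.last k) + (List.ofFn fun i : Fin k => j i.castSucc).reverse.sum : ℕ) := by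
      rw [show Finset.Iic (Fin.last k) = Finset.univ from Finset.Iic_top, Fin.sum_univ_castSucc,
        List.sum_reverse, List.sum_ofFn]
      push_cast
      ring
    simp only [h1, h2]
    rw [div_div]

theorem orderCondition_iff {s k : ℕ} (a : Fin (s + 1) → ℝ) (b : Fin s → ℝ) (j : Fin k → ℕ) :
    OrderCondition a b j ↔
      methodChar b (fun i => node a i.castSucc) (List.ofFn j).reverse =
        intChar (List.ofFn j).reverse := by
  rw [OrderCondition, methodChar_ofFn_reverse, intChar_ofFn_reverse]

/-! ### Explicit flows and the test systems -/

/-- The vector field need not be globally Lipschitz, but both curves have compact image and lie in a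
ball on which it is Lipschitz. -/
theorem eqOn_of_isIntegralCurveOn {E : Type*} [NormedAddCommGroup E] [NormedSpace ℝ E]
    [FiniteDimensional ℝ E] {f : E → E} (hf : ContDiff ℝ 1 f) {t : ℝ} {γ γ' : ℝ → E}
    (hγ : IsIntegralCurveOn γ (fun _ => f) (Set.uIcc 0 t))
    (hγ' : IsIntegralCurveOn γ' (fun _ => f) (Set.uIcc 0 t)) (h0 : γ 0 = γ' 0) :
    Set.EqOn γ γ' (Set.uIcc 0 t) := by
  have hc := hγ.continuousOn
  have hc' := hγ'.continuousOn
  have hbdd := ((isCompact_uIcc.image_of_continuousOn hc).union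
    (isCompact_uIcc.image_of_continuousOn hc')).isBounded
  obtain ⟨R, hR⟩ := hbdd.subset_closedBall 0
  have : ProperSpace E := FiniteDimensional.proper ℝ E
  obtain ⟨K, hK⟩ := (hf.contDiffOn (s := Metric.closedBall (0 : E) R)).exists_lipschitzOnWith
    one_ne_zero (convex_closedBall _ _) (isCompact_closedBall _ _)
  have hin : ∀ s ∈ Set.uIcc 0 t, γ s ∈ Metric.closedBall (0 : E) R := fun s hs =>
    hR (Or.inl (Set.mem_image_of_mem _ hs))
  have hin' : ∀ s ∈ Set.uIcc 0 t, γ' s ∈ Metric.closedBall (0 : E) R := fun s hs =>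
    hR (Or.inr (Set.mem_image_of_mem _ hs))
  rcases le_total 0 t with ht | ht
  · rw [Set.uIcc_of_le ht] at *
    have hsub : ∀ s ∈ Set.Ico 0 t, s ∈ Set.Icc 0 t := fun s hs => Set.Ico_subset_Icc_self hs
    exact ODE_solution_unique_of_mem_Icc_right (fun _ _ => hK) hc
      (fun s hs => (hγ s (hsub s hs)).mono_of_mem_nhdsWithin (Icc_mem_nhdsGE_of_mem hs))
      (fun s hs => hin s (hsub s hs)) hc'
      (fun s hs => (hγ' s (hsub s hs)).mono_of_mem_nhdsWithin (Icc_mem_nhdsGE_of_mem hs))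
      (fun s hs => hin' s (hsub s hs)) h0
  · rw [Set.uIcc_of_ge ht] at *
    have hsub : ∀ s ∈ Set.Ioc t 0, s ∈ Set.Icc t 0 := fun s hs => Set.Ioc_subset_Icc_self hs
    exact ODE_solution_unique_of_mem_Icc_left (fun _ _ => hK) hc
      (fun s hs => (hγ s (hsub s hs)).mono_of_mem_nhdsWithin (Icc_mem_nhdsLE_of_mem hs))
      (fun s hs => hin s (hsub s hs)) hc'
      (fun s hs => (hγ' s (hsub s hs)).mono_of_mem_nhdsWithin (Icc_mem_nhdsLE_of_mem hs))
      (fun s hs => hin' s (hsub s hs)) h0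

/-- By uniqueness the chosen value in `flow` can be computed from any integral curve at hand. -/
theorem flow_eq {D : ℕ} {f : Space D → Space D} (hf : ContDiff ℝ 1 f) {t : ℝ} {x : Space D}
    {γ : ℝ → Space D} (hγ : IsIntegralCurveOn γ (fun _ => f) (Set.uIcc 0 t)) (h0 : γ 0 = x) :
    flow f t x = γ t := by
  have h : ∃ y, Reaches f t x y := ⟨γ t, γ, h0, rfl, hγ⟩
  rw [flow, dif_pos h]
  obtain ⟨γ', h0', ht', hγ'⟩ := h.choose_spec
  rw [← ht']
  exact eqOn_of_isIntegralCurveOn hf hγ' hγ (h0'.trans h0.symm) Set.right_mem_uIcc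

theorem hasDerivAt_space {D : ℕ} {γ : ℝ → Space D} {γ' : Space D} {t : ℝ}
    (h : ∀ i, HasDerivAt (fun s => γ s i) (γ' i) t) : HasDerivAt γ γ' t := by
  rw [hasDerivAt_iff_hasFDerivAt, ← hasFDerivWithinAt_univ, hasFDerivWithinAt_euclidean]
  intro i
  rw [hasFDerivWithinAt_univ]
  refine (h i).hasFDerivAt.congr_fderiv ?_
  ext
  simp

/-- The state of the test system: the time, followed by the values of `χ` at the suffixes
of `w`. -/
def testState (w : List ℕ) (t : ℝ) (χ : List ℕ → ℝ) : Space (w.length + 2) :=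
  WithLp.toLp 2 (Fin.cons t fun i : Fin (w.length + 1) => χ (w.drop i))

/-- The unperturbed part of the test system: time runs at unit speed. -/
def testDrift (w : List ℕ) (_ : Space (w.length + 2)) : Space (w.length + 2) :=
  WithLp.toLp 2 (Fin.cons 1 fun _ => 0)

/-- The perturbation of the test system, which makes the value at `q :: v` grow with rate
`t ^ (q - 1)` times the value at `v`. -/
def testKick (w : List ℕ) (z : Space (w.length + 2)) : Space (w.length + 2) :=
  WithLp.toLp 2 (Fin.cons 0 fun i : Fin (w.length + 1) =>
    if h : i.val < w.length then z 0 ^ (w[i.val] - 1) * z ⟨i.val + 2, by omega⟩ else 0)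

theorem contDiff_testDrift (w : List ℕ) {n : WithTop ℕ∞} : ContDiff ℝ n (testDrift w) :=
  contDiff_const

theorem contDiff_coord {D : ℕ} {n : WithTop ℕ∞} (i : Fin D) :
    ContDiff ℝ n fun z : Space D => z i :=
  contDiff_euclidean.1 contDiff_id i

theorem contDiff_testKick (w : List ℕ) {n : WithTop ℕ∞} : ContDiff ℝ n (testKick w) := by
  rw [contDiff_euclidean]
  intro i
  induction i using Fin.cases with
  | zero => simpa [testKick] using contDiff_const
  | succ i =>
    by_cases h : i.val < w.length
    · simpa [testKick, h] using ((contDiff_coord 0).pow _).mul (contDiff_coord _)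
    · simpa [testKick, h] using contDiff_const

theorem testState_zero (w : List ℕ) (t : ℝ) (χ : List ℕ → ℝ) : testState w t χ 0 = t := rfl

theorem testState_succ (w : List ℕ) (t : ℝ) (χ : List ℕ → ℝ) (i : Fin (w.length + 1)) :
    testState w t χ i.succ = χ (w.drop i) := rfl

theorem testKick_testState (w : List ℕ) (t : ℝ) (χ : List ℕ → ℝ) (i : Fin (w.length + 1)) :
    testKick w (testState w t χ) i.succ =
      if h : i.val < w.length then t ^ (w[i.val] - 1) * χ (w.drop (i + 1)) else 0 := by
  by_cases h : i.val < w.length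
  · simp only [testKick, h, dite_true]
    simp only [Fin.cons_succ, h, dite_true]
    congr 1
  · simp [testKick, h]

theorem flow_testDrift (w : List ℕ) (t t₀ : ℝ) (χ : List ℕ → ℝ) :
    flow (testDrift w) t (testState w t₀ χ) = testState w (t₀ + t) χ := by
  refine flow_eq (γ := fun s => testState w (t₀ + s) χ) (contDiff_testDrift w) ?_ (by simp)
  intro s _
  refine (hasDerivAt_space fun i => ?_).hasDerivWithinAt
  induction i using Fin.cases with
  | zero => simpa [testState, testDrift] using (hasDerivAt_id s).const_add t₀
  | succ i => simpa [testState, testDrift] using hasDerivAt_const s (χ (w.drop i))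

theorem hasDerivAt_expChar (b c : ℝ) (q : ℕ) (v : List ℕ) :
    HasDerivAt (fun b => expChar b c (q :: v)) (c ^ (q - 1) * expChar b c v) b := by
  simp only [expChar_eq]
  refine (((hasDerivAt_pow _ b).div_const _).mul_const _).congr_deriv ?_
  simp only [List.length_cons, Nat.factorial_succ, List.map_cons, List.prod_cons]
  have : (v.length.factorial : ℝ) ≠ 0 := by positivity
  push_cast
  field_simp

/-- Time stands still at `t₀` during a kick, so the system is linear with constant weights `t₀ ^ (q
- 1)`, and its exponential is given by `expChar`. -/
theorem flow_testKick (w : List ℕ) (ε t t₀ : ℝ) (χ : List ℕ → ℝ) :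
    flow (fun z => ε • testKick w z) t (testState w t₀ χ) =
      testState w t₀ (conv χ (expChar (ε * t) t₀)) := by
  refine flow_eq (γ := fun s => testState w t₀ (conv χ (expChar (ε * s) t₀)))
    ((contDiff_testKick w).const_smul ε) ?_ ?_
  · intro s _
    refine (hasDerivAt_space fun i => ?_).hasDerivWithinAt
    induction i using Fin.cases with
    | zero => simpa [testState, testKick] using hasDerivAt_const s t₀
    | succ i =>
      simp only [testState_succ, PiLp.smul_apply, testKick_testState, smul_eq_mul]
      by_cases h : i.val < w.length
      · rw [dif_pos h, List.drop_eq_getElem_cons h]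
        simp only [conv_cons]
        rw [← conv_const_mul, ← conv_const_mul]
        have h1 : HasDerivAt (fun s => χ (w[i.val] :: w.drop (i.val + 1)) *
            expChar (ε * s) t₀ []) 0 s := by
          simp only [expChar, mul_one]
          exact hasDerivAt_const _ _
        refine (h1.add (hasDerivAt_conv fun v _ => ?_)).congr_deriv (zero_add _)
        have h2 := HasDerivAt.scomp s (hasDerivAt_expChar (ε * s) t₀ w[i.val] v)
          ((hasDerivAt_id s).const_mul ε)
        simpa [Function.comp_def] using h2
      · rw [dif_neg h, List.drop_eq_nil_of_le (not_lt.1 h)]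
        simpa [conv_nil, expChar] using hasDerivAt_const s (χ [])
  · have : expChar 0 t₀ = unitChar := by
      funext v
      cases v <;> simp [expChar, unitChar]
    simp only [mul_zero, this]
    congr 1
    funext v
    exact conv_unitChar χ v

theorem flow_test (w : List ℕ) (hw : ∀ n ∈ w, 0 < n) (ε t : ℝ) :
    flow (fun z => testDrift w z + ε • testKick w z) t (testState w 0 unitChar) =
      testState w t (fun v => ε ^ v.length * scale t intChar v) := by
  refine flow_eq (γ := fun s => testState w s (fun v => ε ^ v.length * scale s intChar v))
    ((contDiff_testDrift w).add ((contDiff_testKick w).const_smul ε)) ?_ ?_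
  · intro s _
    refine (hasDerivAt_space fun i => ?_).hasDerivWithinAt
    induction i using Fin.cases with
    | zero => simpa [testState, testKick, testDrift] using hasDerivAt_id' s
    | succ i =>
      simp only [testState_succ, PiLp.add_apply, PiLp.smul_apply, testKick_testState, smul_eq_mul]
      rw [show (testDrift w (testState w s fun v => ε ^ v.length * scale s intChar v)) i.succ = 0
        from rfl, zero_add]
      by_cases h : i.val < w.length
      · rw [dif_pos h, List.drop_eq_getElem_cons h]
        refine ((hasDerivAt_scale_intChar s (hw _ (List.getElem_mem h))).const_mul _).congr_deriv ?_
        rw [List.length_cons]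
        ring
      · rw [dif_neg h, List.drop_eq_nil_of_le (not_lt.1 h)]
        simpa [scale, intChar] using hasDerivAt_const s (1 : ℝ)
  · ext i
    induction i using Fin.cases with
    | zero => rfl
    | succ i =>
      simp only [testState_succ]
      by_cases h : i.val < w.length
      · rw [List.drop_eq_getElem_cons h, scale_zero _ (hw _ (List.getElem_mem h)), mul_zero]
        rfl
      · rw [List.drop_eq_nil_of_le (not_lt.1 h)]
        simp [scale, intChar, unitChar]

theorem node_castSucc {s : ℕ} (a : Fin (s + 2) → ℝ) (i : Fin (s + 1)) :
    node a i.castSucc = node (fun i => a i.castSucc) i := by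
  rw [node, node, ← Fin.map_castSuccEmb_Iic, Finset.sum_map]
  rfl

theorem node_last {s : ℕ} (a : Fin (s + 1) → ℝ) :
    node a (Fin.last s) = ∑ i : Fin s, a i.castSucc + a (Fin.last s) := by
  rw [node, show Finset.Iic (Fin.last s) = Finset.univ from Finset.Iic_top, Fin.sum_univ_castSucc]

/-- On the test system composition of stages is convolution, and each kick takes place at its node.
General `t₀` and `χ` serve the second of two consecutive steps, in the study of symmetry. -/
theorem foldl_test {s : ℕ} (a : Fin (s + 1) → ℝ) (b : Fin s → ℝ) (w : List ℕ) (τ ε t₀ : ℝ)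
    (χ : List ℕ → ℝ) :
    Fin.foldl s (fun y i => flow (fun z => ε • testKick w z) (b i * τ)
      (flow (testDrift w) (a i.castSucc * τ) y)) (testState w t₀ χ) =
    testState w (t₀ + (∑ i : Fin s, a i.castSucc) * τ)
      (conv χ (methodChar (fun i => ε * (b i * τ)) fun i => t₀ + node a i.castSucc * τ)) := by
  induction s with
  | zero =>
    simp only [Fin.foldl_zero, Finset.univ_eq_empty, Finset.sum_empty, methodChar_zero, zero_mul,
      add_zero]
    congr 1
    funext v
    exact (conv_unitChar χ v).symm
  | succ s ih =>
    rw [Fin.foldl_succ_last, ih (fun i => a i.castSucc) (fun i => b i.castSucc), flow_testDrift,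
      flow_testKick, methodChar_succ]
    simp only [node_castSucc a]
    rw [node_last, Fin.sum_univ_castSucc]
    have ht : t₀ + (∑ i : Fin s, a i.castSucc.castSucc) * τ + a (Fin.last s).castSucc * τ =
        t₀ + (∑ i : Fin s, a i.castSucc.castSucc + a (Fin.last s).castSucc) * τ := by ring
    rw [ht]
    congr 1
    funext v
    exact conv_assoc _ _ _ _

theorem step_test {s : ℕ} (a : Fin (s + 1) → ℝ) (b : Fin s → ℝ) (w : List ℕ) (τ ε t₀ : ℝ)
    (χ : List ℕ → ℝ) :
    step a b (testDrift w) (testKick w) τ ε (testState w t₀ χ) =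
    testState w (t₀ + node a (Fin.last s) * τ)
      (conv χ (methodChar (fun i => ε * (b i * τ)) fun i => t₀ + node a i.castSucc * τ)) := by
  rw [step, foldl_test, flow_testDrift, node_last]
  congr 1
  ring

theorem unitChar_conv (ξ : List ℕ → ℝ) (w : List ℕ) : conv unitChar ξ w = ξ w := by
  induction w generalizing ξ with
  | nil => simp [conv_nil, unitChar]
  | cons q w ih => simp [conv_cons, ih, unitChar]

/-- Apply a step `τ` and then a step `-τ` to the test system. The second step starts at time `τ`, so
it has weights `-τ b_i` and nodes `τ (1 - c_i)`: it is the shifted time reversal of the first. -/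
theorem conv_methodChar_shift_of_isSymmetric {s : ℕ} {a : Fin (s + 1) → ℝ} {b : Fin s → ℝ}
    (hsym : IsSymmetric a b) (ha : node a (Fin.last s) = 1) {w : List ℕ}
    (hw : ∀ n ∈ w, 0 < n) (hw0 : w ≠ []) :
    conv (methodChar b fun i => node a i.castSucc)
      (shift (scale (-1) (methodChar b fun i => node a i.castSucc))) w = 0 := by
  have h := hsym (w.length + 2) (testDrift w) (testKick w) (contDiff_testDrift w)
    (contDiff_testKick w) 1 (testState w 0 unitChar)
  -- A single `τ ≠ 0` is enough, because the resulting identity is homogeneous in `τ`.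
  obtain ⟨τ, hτ, hτ0⟩ := ((h.filter_mono nhdsWithin_le_nhds).and
    (self_mem_nhdsWithin : ∀ᶠ τ : ℝ in 𝓝[≠] 0, τ ≠ 0)).exists
  rw [step_test, step_test] at hτ
  have h1 := congrArg (fun z : Space (w.length + 2) => z (Fin.succ 0)) hτ
  simp only [testState_succ, Fin.val_zero, List.drop_zero, ha, zero_add, one_mul] at h1
  rw [conv_assoc, unitChar_conv] at h1
  have h2 : unitChar w = 0 := by
    cases w with
    | nil => exact absurd rfl hw0
    | cons _ _ => rfl
  rw [h2] at h1
  set χ := methodChar b fun i => node a i.castSucc with hχ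
  have h3 : conv (scale τ χ) (scale τ (shift (scale (-1) χ))) w = 0 := by
    rw [← h1]
    refine conv_congr (fun v hv => ?_) fun v hv => ?_
    · rw [scale_methodChar _ _ _ fun n hn => hw n (hv n hn)]
      simp only [mul_comm]
    · have hv' : ∀ n ∈ v, 0 < n := fun n hn => hw n (hv n hn)
      have h4 : shift (scale (-1) χ) v = methodChar (fun i => -1 * b i)
          (fun i => 1 + -1 * node a i.castSucc) v := by
        rw [← shift_methodChar _ _ hv']
        exact shift_congr fun u hu _ _ => scale_methodChar _ _ _ hu
      rw [scale, h4, ← scale, scale_methodChar _ _ _ hv']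
      congr 1 <;> funext i <;> ring
  rw [← scale_conv, scale] at h3
  exact (mul_eq_zero.1 h3).resolve_left (pow_ne_zero _ hτ0)

/-! ### Necessity of the order conditions -/

/-- The coefficients of a polynomial are controlled by its values at equidistant points. -/
theorem exists_forall_pow_mul_norm_le (E : Type*) [NormedAddCommGroup E] [NormedSpace ℝ E]
    (n : ℕ) : ∃ C : ℝ, 0 ≤ C ∧ ∀ (v : Fin n → E) (δ M : ℝ), 0 ≤ δ →
      (∀ i : Fin n, ‖∑ k : Fin n, (i * δ : ℝ) ^ k.val • v k‖ ≤ M) →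
      ∀ k, δ ^ k.val * ‖v k‖ ≤ C * M := by
  set V : Matrix (Fin n) (Fin n) ℝ := Matrix.vandermonde fun i => (i : ℝ) with hV
  have hdet : IsUnit V.det := by
    rw [isUnit_iff_ne_zero, hV, Matrix.det_vandermonde_ne_zero_iff]
    intro i j hij
    have hij : ((i.val : ℕ) : ℝ) = (j.val : ℕ) := hij
    exact Fin.ext (by exact_mod_cast hij)
  refine ⟨∑ k, ∑ i, |V⁻¹ k i|, by positivity, fun v δ M hδ h k => ?_⟩
  have key : ∑ i, V⁻¹ k i • ∑ l : Fin n, (i * δ : ℝ) ^ l.val • v l = δ ^ k.val • v k := by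
    simp only [Finset.smul_sum]
    rw [Finset.sum_comm]
    have h1 : ∀ l : Fin n, ∑ i, V⁻¹ k i • ((i * δ : ℝ) ^ l.val • v l) =
        ((V⁻¹ * V) k l) • (δ ^ l.val • v l) := by
      intro l
      rw [Matrix.mul_apply, Finset.sum_smul]
      refine Finset.sum_congr rfl fun i _ => ?_
      rw [smul_smul, smul_smul, hV, Matrix.vandermonde_apply, mul_pow, mul_assoc]
    simp only [h1, Matrix.nonsing_inv_mul V hdet]
    rw [Finset.sum_eq_single k]
    · simp
    · intro l _ hl
      rw [Matrix.one_apply_ne hl.symm, zero_smul]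
    · simp
  have hM : 0 ≤ M := (norm_nonneg _).trans (h k)
  calc δ ^ k.val * ‖v k‖ = ‖δ ^ k.val • v k‖ := by
        rw [norm_smul, Real.norm_of_nonneg (pow_nonneg hδ _)]
    _ ≤ ∑ i, |V⁻¹ k i| * M := by
        rw [← key]
        refine (norm_sum_le _ _).trans (Finset.sum_le_sum fun i _ => ?_)
        rw [norm_smul, Real.norm_eq_abs]
        exact mul_le_mul_of_nonneg_left (h i) (abs_nonneg _)
    _ = (∑ i, |V⁻¹ k i|) * M := by rw [Finset.sum_mul]
    _ ≤ _ := by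
        refine mul_le_mul_of_nonneg_right ?_ hM
        exact Finset.single_le_sum (f := fun k => ∑ i, |V⁻¹ k i|)
          (fun _ _ => by positivity) (Finset.mem_univ k)

/-- Evaluation at the points `i δ` bounds the `k`-th coefficient by a multiple of `δ ^ (n - k)`,
which tends to zero with `δ`. -/
theorem eq_zero_of_sum_pow_isBigO {E : Type*} [NormedAddCommGroup E] [NormedSpace ℝ E] {n : ℕ}
    {v : Fin n → E}
    (h : (fun ε : ℝ => ∑ k : Fin n, ε ^ k.val • v k) =O[𝓝 0] fun ε : ℝ => ε ^ n) : v = 0 := by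
  obtain ⟨C, hC, hCv⟩ := exists_forall_pow_mul_norm_le E n
  obtain ⟨K, hK⟩ := h.bound
  have hmul : ∀ i : Fin n, ∀ᶠ δ : ℝ in 𝓝 0,
      ‖∑ k : Fin n, (i * δ : ℝ) ^ k.val • v k‖ ≤ K * ‖(i * δ : ℝ) ^ n‖ := by
    intro i
    have : Tendsto (fun δ : ℝ => (i : ℝ) * δ) (𝓝 0) (𝓝 0) := by
      have := (continuous_const_mul (i : ℝ)).tendsto 0
      rwa [mul_zero] at this
    exact this.eventually hK
  have hall := (eventually_all.2 hmul).filter_mono (nhdsWithin_le_nhds (s := Set.Ioi 0))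
  funext k
  rw [Pi.zero_apply, ← norm_eq_zero]
  refine le_antisymm ?_ (norm_nonneg _)
  have hle : ∀ᶠ δ : ℝ in 𝓝[>] 0, ‖v k‖ ≤ C * (|K| * n ^ n) * δ ^ (n - k.val) := by
    filter_upwards [hall, self_mem_nhdsWithin] with δ hδ hpos
    have hpos : 0 < δ := hpos
    have h1 := hCv v δ (|K| * (n ^ n * δ ^ n)) hpos.le (fun i => (hδ i).trans (by
      rw [Real.norm_of_nonneg (by positivity), mul_pow]
      have : (i : ℝ) ^ n ≤ (n : ℝ) ^ n :=
        pow_le_pow_left₀ (by positivity) (by exact_mod_cast i.2.le) n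
      gcongr
      exact le_abs_self K)) k
    have h2 : δ ^ n = δ ^ k.val * δ ^ (n - k.val) := by
      rw [← pow_add, Nat.add_sub_cancel' k.2.le]
    refine le_of_mul_le_mul_left (h1.trans (le_of_eq ?_)) (pow_pos hpos k.val)
    rw [h2]; ring
  have hlim : Tendsto (fun δ : ℝ => C * (|K| * n ^ n) * δ ^ (n - k.val)) (𝓝[>] 0) (𝓝 0) := by
    have h3 : Continuous fun δ : ℝ => C * (|K| * n ^ n) * δ ^ (n - k.val) := by fun_prop
    have h4 := h3.tendsto 0
    rw [zero_pow (by omega), mul_zero] at h4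
    exact h4.mono_left nhdsWithin_le_nhds
  exact ge_of_tendsto hlim hle

theorem methodChar_const_mul {s : ℕ} (ε : ℝ) (b c : Fin s → ℝ) (w : List ℕ) :
    methodChar (fun i => ε * b i) c w = ε ^ w.length * methodChar b c w := by
  induction s generalizing w with
  | zero => cases w <;> simp [methodChar_zero, unitChar]
  | succ s ih =>
    rw [methodChar_succ, methodChar_succ, conv_eq_sum, conv_eq_sum, Finset.mul_sum]
    refine Finset.sum_congr rfl fun i hi => ?_
    have hi : i ≤ w.length := Nat.lt_succ_iff.1 (Finset.mem_range.1 hi)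
    rw [ih, expChar_eq, expChar_eq, mul_pow, List.length_drop, List.length_take,
      min_eq_left hi]
    have : ε ^ w.length = ε ^ (w.length - i) * ε ^ i := by rw [← pow_add, Nat.sub_add_cancel hi]
    rw [this]
    ring

theorem localError_test {s : ℕ} (a : Fin (s + 1) → ℝ) (b : Fin s → ℝ) {w : List ℕ}
    (hw : ∀ n ∈ w, 0 < n) (τ ε : ℝ) :
    localError a b (testDrift w) (testKick w) (testState w 0 unitChar) τ ε (Fin.succ 0) =
      ε ^ w.length * (τ ^ w.sum *
        (methodChar b (fun i => node a i.castSucc) w - intChar w)) := by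
  have h : methodChar (fun i => ε * (b i * τ)) (fun i => 0 + node a i.castSucc * τ) w =
      ε ^ w.length * scale τ (methodChar b fun i => node a i.castSucc) w := by
    rw [methodChar_const_mul, scale_methodChar _ _ _ hw]
    congr 2
    · funext i; ring
    · funext i; ring
  rw [localError, step_test, flow_test w hw, PiLp.sub_apply, testState_succ, testState_succ,
    Fin.val_zero, List.drop_zero, unitChar_conv, h, scale, scale]
  ring

/-- At `ε = 0` the expansion and its remainder vanish, so the local error is zero for small `τ`; in
the time coordinate it equals `(c_{s+1} - 1) τ`. -/
theorem node_last_eq_one_of_hasGeneralizedOrder {s m : ℕ} {a : Fin (s + 1) → ℝ} {b : Fin s → ℝ}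
    {r : Fin m → ℕ} (h : HasGeneralizedOrder a b r) : node a (Fin.last s) = 1 := by
  obtain ⟨e, -, he⟩ := h _ (testDrift []) (testKick []) (contDiff_testDrift _)
    (contDiff_testKick _) (testState [] 0 unitChar)
  obtain ⟨C, hC⟩ := he.bound
  have htend : Tendsto (fun τ : ℝ => (τ, (0 : ℝ))) (𝓝 0) (𝓝 (0, 0)) :=
    (Continuous.prodMk_left (0 : ℝ)).tendsto 0
  obtain ⟨τ, hτ, hτ0⟩ := (((htend.eventually hC).filter_mono nhdsWithin_le_nhds).and
    (self_mem_nhdsWithin : ∀ᶠ τ : ℝ in 𝓝[≠] 0, τ ≠ 0)).exists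
  simp only [ne_eq, Nat.add_eq_zero_iff, one_ne_zero, and_false, not_false_eq_true, zero_pow,
    zero_smul, Finset.sum_const_zero, sub_zero, norm_zero, mul_zero, norm_le_zero_iff] at hτ
  rw [localError, step_test, flow_test [] (by simp)] at hτ
  have h0 := congrArg (fun z : Space (([] : List ℕ).length + 2) => z 0) hτ
  simp only [PiLp.sub_apply, PiLp.zero_apply] at h0
  rw [testState_zero, testState_zero] at h0
  have h1 : (node a (Fin.last s) - 1) * τ = 0 := by linarith
  exact sub_eq_zero.1 ((mul_eq_zero.1 h1).resolve_right hτ0)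

/-- On the test system of the reversed multi-index the local error is a single monomial times the
defect `d`. Uniqueness of the expansion in `ε` puts it into `e k`, and its `τ`-degree is at most `r
k`, so `d = 0`. -/
theorem orderCondition_of_hasGeneralizedOrder {s m : ℕ} {a : Fin (s + 1) → ℝ} {b : Fin s → ℝ}
    {r : Fin m → ℕ} (h : HasGeneralizedOrder a b r) (k : Fin m) (j : Fin (k.val + 1) → ℕ)
    (hj : ∀ l, 0 < j l) (hsum : ∑ l, j l ≤ r k) : OrderCondition a b j := by
  rw [orderCondition_iff]
  set w := (List.ofFn j).reverse with hwdef
  have hw : ∀ n ∈ w, 0 < n := by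
    intro n hn
    rw [hwdef, List.mem_reverse, List.mem_ofFn] at hn
    obtain ⟨l, rfl⟩ := hn
    exact hj l
  have hlen : w.length = k.val + 1 := by simp [hwdef]
  have hwsum : w.sum ≤ r k := by rwa [hwdef, List.sum_reverse, List.sum_ofFn]
  set d := methodChar b (fun i => node a i.castSucc) w - intChar w with hd
  obtain ⟨e, hek, he⟩ := h _ (testDrift w) (testKick w) (contDiff_testDrift _)
    (contDiff_testKick _) (testState w 0 unitChar)
  set f : Fin m → ℝ → ℝ := fun l τ => e l τ (Fin.succ 0) with hf
  have hnear : ∀ᶠ τ in 𝓝 (0 : ℝ), f k τ = τ ^ w.sum * d := by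
    obtain ⟨C, hC⟩ := he.bound
    rw [nhds_prod_eq] at hC
    filter_upwards [hC.curry] with τ hτ
    -- The sums over `Fin m` start at `ε ^ 1`; the prepended `0` is the coefficient of `ε ^ 0`.
    have hz : (Fin.cons (0 : ℝ)
        (fun l : Fin m => (if l = k then τ ^ w.sum * d else 0) - f l τ) : Fin (m + 1) → ℝ) = 0 := by
      refine eq_zero_of_sum_pow_isBigO (IsBigO.of_bound C ?_)
      filter_upwards [hτ] with ε hε
      refine le_trans ?_ hε
      refine le_trans (le_of_eq ?_) (PiLp.norm_apply_le _ (Fin.succ 0))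
      rw [PiLp.sub_apply, localError_test a b hw, Fin.sum_univ_succ]
      congr 1
      simp only [Fin.cons_zero, Fin.cons_succ, smul_eq_mul, mul_zero, zero_add, Fin.val_succ,
        mul_sub, Finset.sum_sub_distrib, mul_ite]
      have hpow : ε ^ w.length = ε ^ (k.val + 1) := by rw [hlen]
      rw [Finset.sum_ite_eq' Finset.univ k, if_pos (Finset.mem_univ _), hpow]
      simp [hf, hd, mul_sub]
    have := congrFun hz k.succ
    simp only [Fin.cons_succ, if_pos, Pi.zero_apply] at this
    linarith
  have hO : (fun τ : ℝ => τ ^ w.sum * d) =O[𝓝 0] fun τ : ℝ => τ ^ (r k + 1) := by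
    have h1 : f k =O[𝓝 0] fun τ : ℝ => τ ^ (r k + 1) := by
      refine IsBigO.trans (IsBigO.of_bound 1 (Eventually.of_forall fun τ => ?_)) (hek k)
      rw [one_mul]
      exact PiLp.norm_apply_le _ _
    exact h1.congr' hnear EventuallyEq.rfl
  have hO' : (fun τ : ℝ => ∑ l : Fin (r k + 1), τ ^ l.val •
      (if l.val = w.sum then d else 0)) =O[𝓝 0] fun τ : ℝ => τ ^ (r k + 1) := by
    refine hO.congr_left fun τ => ?_
    rw [Finset.sum_eq_single (⟨w.sum, by omega⟩ : Fin (r k + 1))]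
    · simp
    · intro l _ hl
      rw [if_neg fun h => hl (Fin.ext h), smul_zero]
    · simp
  have := congrFun (eq_zero_of_sum_pow_isBigO hO') ⟨w.sum, by omega⟩
  simp only [if_pos, Pi.zero_apply] at this
  exact sub_eq_zero.1 this

/-! ### Smooth dependence of flows on initial values and parameters -/

section Superposition

universe u
variable {K : Type*} [TopologicalSpace K] [CompactSpace K]

/-- Pointwise application of operators to vectors, for continuous functions on a compact space. -/
noncomputable def pointwiseApply (K : Type*) [TopologicalSpace K] [CompactSpace K]
    (E F : Type*) [NormedAddCommGroup E] [NormedSpace ℝ E] [NormedAddCommGroup F]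
    [NormedSpace ℝ F] : C(K, E →L[ℝ] F) →L[ℝ] C(K, E) →L[ℝ] C(K, F) :=
  LinearMap.mkContinuous₂
    (LinearMap.mk₂ ℝ (fun (A : C(K, E →L[ℝ] F)) (h : C(K, E)) =>
        (⟨fun t => A t (h t), by fun_prop⟩ : C(K, F)))
      (fun _ _ _ => by ext; simp) (fun _ _ _ => by ext; simp)
      (fun _ _ _ => by ext; simp) (fun _ _ _ => by ext; simp)) 1
    (fun A h => by
      rw [one_mul, ContinuousMap.norm_le _ (by positivity)]
      exact fun t => ((A t).le_opNorm (h t)).trans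
        (mul_le_mul (A.norm_coe_le_norm t) (h.norm_coe_le_norm t) (norm_nonneg _) (norm_nonneg A)))

theorem pointwiseApply_apply {E F : Type*} [NormedAddCommGroup E] [NormedSpace ℝ E]
    [NormedAddCommGroup F] [NormedSpace ℝ F] (A : C(K, E →L[ℝ] F)) (h : C(K, E)) (t : K) :
    pointwiseApply K E F A h t = A t (h t) := rfl

/-- The mean value inequality on the segment from `γ t` to `γ t + h t` gives an estimate uniform in
`t`, because `γ ↦ f' ∘ γ` is continuous for the sup norm. -/
theorem hasFDerivAt_comp_continuousMap {E F : Type*} [NormedAddCommGroup E] [NormedSpace ℝ E]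
    [NormedAddCommGroup F] [NormedSpace ℝ F] {f : C(E, F)} {f' : C(E, E →L[ℝ] F)}
    (hf : ∀ x, HasFDerivAt f (f' x) x) (γ : C(K, E)) :
    HasFDerivAt (fun γ : C(K, E) => f.comp γ) (pointwiseApply K E F (f'.comp γ)) γ := by
  rw [hasFDerivAt_iff_isLittleO_nhds_zero, isLittleO_iff]
  intro c hc
  have hcont : Continuous fun γ : C(K, E) => f'.comp γ := ContinuousMap.continuous_postcomp f'
  obtain ⟨δ, hδ, hball⟩ := (Metric.continuous_iff (α := C(K, E)) (β := C(K, E →L[ℝ] F))).1 hcont γ c hc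
  filter_upwards [Metric.ball_mem_nhds (0 : C(K, E)) hδ] with h hh
  rw [mem_ball_zero_iff] at hh
  rw [ContinuousMap.norm_le _ (by positivity)]
  intro t
  have key : ∀ y ∈ segment ℝ (γ t) (γ t + h t), ‖f' y - f' (γ t)‖ ≤ c := by
    intro y hy
    rw [segment_eq_image'] at hy
    obtain ⟨s, hs, rfl⟩ := hy
    have h1 : dist (γ + s • h) γ < δ := by
      rw [dist_eq_norm, add_sub_cancel_left, norm_smul, Real.norm_of_nonneg hs.1]
      exact (mul_le_of_le_one_left (norm_nonneg _) hs.2).trans_lt hh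
    have h2 := (hball _ h1).le
    have h3 := (ContinuousMap.dist_le hc.le).1 h2 t
    simpa [dist_eq_norm] using h3
  have := (convex_segment (γ t) (γ t + h t)).norm_image_sub_le_of_norm_hasFDerivWithin_le'
    (f := f) (φ := f' (γ t)) (fun y _ => (hf y).hasFDerivWithinAt) key
    (left_mem_segment ℝ _ _) (right_mem_segment ℝ _ _)
  rw [add_sub_cancel_left] at this
  refine le_trans ?_ (this.trans (mul_le_mul_of_nonneg_left (h.norm_coe_le_norm t) hc.le))
  simp [pointwiseApply_apply]

/-- The derivative of composition with `f` is composition with `fderiv ℝ f`, followed by a bounded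
linear map. The target `F` changes in this induction and must stay in one universe with `E`. -/
theorem contDiff_comp_continuousMap {E : Type u} [NormedAddCommGroup E] [NormedSpace ℝ E] (n : ℕ) :
    ∀ {F : Type u} [NormedAddCommGroup F] [NormedSpace ℝ F] {f : C(E, F)} (_ : ContDiff ℝ ∞ f),
      ContDiff ℝ n fun γ : C(K, E) => f.comp γ := by
  induction n with
  | zero =>
    intro F _ _ f _
    exact contDiff_zero.2 (ContinuousMap.continuous_postcomp f)
  | succ n ih =>
    intro F _ _ f hf
    have hf' : ContDiff ℝ ∞ (fderiv ℝ f) := hf.fderiv_right (by simp)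
    rw [show ((n + 1 : ℕ) : WithTop ℕ∞) = n + 1 by simp, contDiff_succ_iff_hasFDerivAt]
    refine ⟨fun γ => pointwiseApply K E F
      ((⟨fderiv ℝ f, hf'.continuous⟩ : C(E, E →L[ℝ] F)).comp γ), ?_, ?_⟩
    · exact (pointwiseApply K E F).contDiff.comp (ih (f := ⟨fderiv ℝ f, hf'.continuous⟩) hf')
    · exact hasFDerivAt_comp_continuousMap fun x =>
        (hf.differentiable (by simp) x).hasFDerivAt

end Superposition

section Primitive

variable (E : Type*) [NormedAddCommGroup E] [NormedSpace ℝ E]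

theorem continuous_iccExtend {E : Type*} [TopologicalSpace E] (γ : C(Set.Icc (0 : ℝ) 1, E)) :
    Continuous (Set.IccExtend zero_le_one γ) := γ.continuous.Icc_extend'

/-- The primitive vanishing at `0` of a continuous function on `[0, 1]`. -/
noncomputable def primitive [CompleteSpace E] :
    C(Set.Icc (0 : ℝ) 1, E) →L[ℝ] C(Set.Icc (0 : ℝ) 1, E) :=
  LinearMap.mkContinuous
    { toFun := fun γ => ⟨fun t => ∫ s in (0 : ℝ)..t, Set.IccExtend zero_le_one γ s,
        (intervalIntegral.continuous_primitive
          (fun _ _ => (continuous_iccExtend γ).intervalIntegrable _ _) 0).comp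
          continuous_subtype_val⟩
      map_add' := fun γ γ' => by
        ext t
        simp only [ContinuousMap.coe_mk, ContinuousMap.add_apply]
        rw [← intervalIntegral.integral_add ((continuous_iccExtend γ).intervalIntegrable _ _)
          ((continuous_iccExtend γ').intervalIntegrable _ _)]
        rfl
      map_smul' := fun c γ => by
        ext t
        simp only [ContinuousMap.coe_mk, ContinuousMap.smul_apply, RingHom.id_apply]
        rw [← intervalIntegral.integral_smul]
        rfl } 1
    (fun γ => by
      rw [one_mul, ContinuousMap.norm_le _ (norm_nonneg _)]
      intro t
      refine (intervalIntegral.norm_integral_le_of_norm_le_const (C := ‖γ‖)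
        fun s _ => γ.norm_coe_le_norm _).trans ?_
      rw [sub_zero, abs_of_nonneg t.2.1]
      exact mul_le_of_le_one_right (norm_nonneg _) t.2.2)

end Primitive

/-- The solutions over unit time of `x' = τ • f x + η • g x` depend smoothly on the initial value
and on the parameters `τ` and `η` near `τ = η = 0`. -/
theorem exists_contDiffAt_integralCurve {E : Type} [NormedAddCommGroup E] [NormedSpace ℝ E]
    [CompleteSpace E] {f g : E → E} (hf : ContDiff ℝ ∞ f) (hg : ContDiff ℝ ∞ g) (x₀ : E) :
    ∃ Γ : E × ℝ × ℝ → C(Set.Icc (0 : ℝ) 1, E), ContDiffAt ℝ ∞ Γ (x₀, 0, 0) ∧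
      ∀ᶠ p in 𝓝 ((x₀, 0, 0) : E × ℝ × ℝ), Γ p 0 = p.1 ∧
        IsIntegralCurveOn (Set.IccExtend zero_le_one (Γ p))
          (fun _ z => p.2.1 • f z + p.2.2 • g z) (Set.uIcc 0 1) := by
  let F : C(E, E) := ⟨f, hf.continuous⟩
  let G : C(E, E) := ⟨g, hg.continuous⟩
  let I := Set.Icc (0 : ℝ) 1
  let cst : E →L[ℝ] C(I, E) := ContinuousLinearMap.const ℝ I
  -- The zeros of `Φ` are the solutions of the integral equation. At `τ = η = 0` it is `γ - x`,
  -- whose derivative in `γ` is the identity, so the implicit function theorem applies.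
  let Φ : (E × ℝ × ℝ) × C(I, E) → C(I, E) := fun q =>
    q.2 - cst q.1.1 - (q.1.2.1 • primitive E (F.comp q.2) + q.1.2.2 • primitive E (G.comp q.2))
  have hFc : ContDiff ℝ ∞ fun γ : C(I, E) => F.comp γ :=
    contDiff_infty.2 fun n => contDiff_comp_continuousMap n hf
  have hGc : ContDiff ℝ ∞ fun γ : C(I, E) => G.comp γ :=
    contDiff_infty.2 fun n => contDiff_comp_continuousMap n hg
  have hΦ : ContDiff ℝ ∞ Φ := by
    have h1 : ContDiff ℝ ∞ fun q : (E × ℝ × ℝ) × C(I, E) => F.comp q.2 := hFc.comp contDiff_snd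
    have h2 : ContDiff ℝ ∞ fun q : (E × ℝ × ℝ) × C(I, E) => G.comp q.2 := hGc.comp contDiff_snd
    have h3 : ContDiff ℝ ∞ fun q : (E × ℝ × ℝ) × C(I, E) => cst q.1.1 :=
      cst.contDiff.comp (contDiff_fst.comp contDiff_fst)
    have h4 : ContDiff ℝ ∞ fun q : (E × ℝ × ℝ) × C(I, E) => q.1.2.1 :=
      contDiff_fst.comp (contDiff_snd.comp contDiff_fst)
    have h5 : ContDiff ℝ ∞ fun q : (E × ℝ × ℝ) × C(I, E) => q.1.2.2 :=
      contDiff_snd.comp (contDiff_snd.comp contDiff_fst)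
    exact (contDiff_snd.sub h3).sub ((h4.smul ((primitive E).contDiff.comp h1)).add
      (h5.smul ((primitive E).contDiff.comp h2)))
  let u : (E × ℝ × ℝ) × C(I, E) := ((x₀, 0, 0), cst x₀)
  have hinv : (fderiv ℝ Φ u ∘L .inr ℝ (E × ℝ × ℝ) C(I, E)).IsInvertible := by
    have h1 : HasFDerivAt Φ (fderiv ℝ Φ u) u := (hΦ.differentiable (by simp) u).hasFDerivAt
    have h2 : HasFDerivAt (fun γ : C(I, E) => (((x₀, 0, 0) : E × ℝ × ℝ), γ))
        (.inr ℝ (E × ℝ × ℝ) C(I, E)) (cst x₀) := hasFDerivAt_prodMk_right _ _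
    have h3 := HasFDerivAt.comp (cst x₀) (f := fun γ : C(I, E) => (((x₀, 0, 0) : E × ℝ × ℝ), γ)) h1 h2
    have h4 : (Φ ∘ fun γ : C(I, E) => (((x₀, 0, 0) : E × ℝ × ℝ), γ)) = fun γ => γ - cst x₀ := by
      funext γ
      simp [Φ]
    rw [h4] at h3
    have h5 := h3.unique ((hasFDerivAt_id (cst x₀)).sub_const (cst x₀))
    rw [h5]
    exact ⟨ContinuousLinearEquiv.refl ℝ _, rfl⟩
  have hu : Φ u = 0 := by simp [Φ, u]
  have hΦu : ContDiffAt ℝ ∞ Φ u := hΦ.contDiffAt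
  refine ⟨hΦu.implicitFunction (by simp) hinv,
    hΦu.contDiffAt_implicitFunction (by simp) hinv, ?_⟩
  filter_upwards [hΦu.eventually_apply_implicitFunction (by simp) hinv] with p hp
  set γ := hΦu.implicitFunction (by simp) hinv p
  rw [hu] at hp
  have hγ : ∀ t : I, γ t = p.1 + ∫ s in (0 : ℝ)..t,
      (p.2.1 • f (Set.IccExtend zero_le_one γ s) + p.2.2 • g (Set.IccExtend zero_le_one γ s)) := by
    intro t
    have h1 := congrArg (fun γ : C(I, E) => γ t) hp
    have hci := continuous_iccExtend γ
    have h2 : primitive E (F.comp γ) t = ∫ s in (0 : ℝ)..t, f (Set.IccExtend zero_le_one γ s) := rfl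
    have h3 : primitive E (G.comp γ) t = ∫ s in (0 : ℝ)..t, g (Set.IccExtend zero_le_one γ s) := rfl
    simp only [Φ, ContinuousMap.sub_apply, ContinuousMap.add_apply, ContinuousMap.smul_apply, h2, h3,
      ContinuousMap.zero_apply] at h1
    rw [intervalIntegral.integral_add, intervalIntegral.integral_smul,
      intervalIntegral.integral_smul]
    · have h4 : cst p.1 t = p.1 := rfl
      rw [h4, sub_sub, sub_eq_zero] at h1
      exact h1
    · exact ((hf.continuous.comp hci).const_smul _).intervalIntegrable _ _
    · exact ((hg.continuous.comp hci).const_smul _).intervalIntegrable _ _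
  refine ⟨by simpa using hγ 0, ?_⟩
  rw [Set.uIcc_of_le zero_le_one]
  intro t ht
  have hci := continuous_iccExtend γ
  have hcont : Continuous fun s : ℝ => p.2.1 • f (Set.IccExtend zero_le_one γ s) +
      p.2.2 • g (Set.IccExtend zero_le_one γ s) :=
    ((hf.continuous.comp hci).const_smul _).add ((hg.continuous.comp hci).const_smul _)
  have h1 := ((intervalIntegral.integral_hasDerivAt_right (hcont.intervalIntegrable 0 t)
    (hcont.stronglyMeasurableAtFilter _ _) hcont.continuousAt).const_add p.1).hasDerivWithinAt
    (s := Set.Icc 0 1)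
  refine h1.congr (fun s hs => ?_) ?_
  · rw [Set.IccExtend_of_mem zero_le_one _ hs]
    exact hγ ⟨s, hs⟩
  · rw [Set.IccExtend_of_mem zero_le_one _ ht]
    exact hγ ⟨t, ht⟩

theorem flow_zero_time {D : ℕ} {f : Space D → Space D} (hf : ContDiff ℝ 1 f) (x : Space D) :
    flow f 0 x = x := by
  refine flow_eq (γ := fun _ => x) hf ?_ rfl
  rw [Set.uIcc_self]
  rintro t rfl
  exact hasDerivWithinAt_iff_hasFDerivWithinAt.2 HasFDerivWithinAt.singleton

theorem flow_zero_field {D : ℕ} {f : Space D → Space D} (hf : ∀ z, f z = 0) (t : ℝ)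
    (x : Space D) : flow f t x = x := by
  have : f = fun _ => 0 := funext hf
  subst this
  exact flow_eq (γ := fun _ => x) contDiff_const (fun s _ => hasDerivWithinAt_const s _ x) rfl

/-- Rescaling time preserves the relation `Reaches`, so the two values agree even where the solution
blows up and the default value is taken. -/
theorem flow_eq_flow_smul {D : ℕ} {f : Space D → Space D} (hf : ContDiff ℝ 1 f) (t : ℝ)
    (x : Space D) : flow f t x = flow (fun z => t • f z) 1 x := by
  rcases eq_or_ne t 0 with rfl | ht
  · rw [flow_zero_time hf, flow_zero_field (by simp)]
  have key : ∀ (g : Space D → Space D) (s r : ℝ) (y : Space D), Reaches g s x y → r ≠ 0 →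
      Reaches (fun z => r • g z) (s / r) x y := by
    rintro g s r y ⟨γ, h0, h1, hγ⟩ hr
    refine ⟨γ ∘ (· * r), by simpa using h0, by simpa [div_mul_cancel₀ _ hr] using h1, ?_⟩
    refine (hγ.comp_mul r).mono fun u hu => ?_
    have hu' : u ∈ Set.uIcc (0 / r) (s / r) := by simpa using hu
    have h2 := Set.mem_image_of_mem (fun v => v * r) hu'
    rw [Set.image_mul_const_uIcc, div_mul_cancel₀ _ hr, div_mul_cancel₀ _ hr] at h2
    exact h2
  have hiff : Reaches f t x = Reaches (fun z => t • f z) 1 x := by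
    funext y
    refine propext ⟨fun h => ?_, fun h => ?_⟩
    · simpa [div_self ht] using key f t t y h ht
    · simpa [smul_smul, inv_mul_cancel₀ ht] using key _ 1 t⁻¹ y h (inv_ne_zero ht)
  rw [flow, flow, hiff]

/-- The time-one flow of `τ • f + η • g`, as a function of the initial value and of `τ` and `η`. -/
noncomputable def flowPair {D : ℕ} (f g : Space D → Space D) (q : Space D × ℝ × ℝ) : Space D :=
  flow (fun z => q.2.1 • f z + q.2.2 • g z) 1 q.1

section FlowPair

variable {D : ℕ} {f g : Space D → Space D}

theorem contDiff_pair (hf : ContDiff ℝ ∞ f) (hg : ContDiff ℝ ∞ g) (τ η : ℝ) :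
    ContDiff ℝ ∞ fun z => τ • f z + η • g z :=
  (hf.const_smul τ).add (hg.const_smul η)

theorem flow_add_eq_flowPair (hf : ContDiff ℝ ∞ f) (hg : ContDiff ℝ ∞ g) (t ε : ℝ)
    (x : Space D) : flow (fun z => f z + ε • g z) t x = flowPair f g (x, t, t * ε) := by
  rw [flow_eq_flow_smul ((hf.add (hg.const_smul ε)).of_le (by simp)), flowPair]
  simp [smul_smul, smul_add]

theorem flowPair_zero (f g : Space D → Space D) (x : Space D) : flowPair f g (x, 0, 0) = x :=
  flow_zero_field (by simp) _ _

/-- By time rescaling, `flowPair` at `(x, s τ, s η)` is the value at time `s` of the unit-time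
solution for `(x, τ, η)`. Taking `s = 1` gives smoothness; varying `s` gives the curve. -/
theorem flowPair_spec (hf : ContDiff ℝ ∞ f) (hg : ContDiff ℝ ∞ g) (x₀ : Space D) :
    ContDiffAt ℝ ∞ (flowPair f g) (x₀, 0, 0) ∧
      ∀ᶠ q in 𝓝 ((x₀, 0, 0) : Space D × ℝ × ℝ),
        IsIntegralCurveOn (fun s : ℝ => flowPair f g (q.1, s * q.2.1, s * q.2.2))
          (fun _ z => q.2.1 • f z + q.2.2 • g z) (Set.uIcc 0 1) := by
  obtain ⟨Γ, hΓ, hcurve⟩ := exists_contDiffAt_integralCurve hf hg x₀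
  have hscale : ∀ᶠ q in 𝓝 ((x₀, 0, 0) : Space D × ℝ × ℝ), ∀ s ∈ Set.uIcc (0 : ℝ) 1,
      flowPair f g (q.1, s * q.2.1, s * q.2.2) = Set.IccExtend zero_le_one (Γ q) s := by
    filter_upwards [hcurve] with q ⟨h0, hq⟩ s hs
    have h1 := hq.comp_mul s
    have hs' : s ∈ Set.Icc (0 : ℝ) 1 := by rwa [Set.uIcc_of_le zero_le_one] at hs
    have h2 := h1.mono (s' := Set.uIcc 0 1) fun u hu => by
      rw [Set.uIcc_of_le zero_le_one] at hu ⊢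
      exact ⟨mul_nonneg hu.1 hs'.1, mul_le_one₀ hu.2 hs'.1 hs'.2⟩
    rw [flowPair]
    have h3 := flow_eq (γ := Set.IccExtend zero_le_one (Γ q) ∘ (· * s)) (x := q.1) (t := 1)
      (f := fun z => (s * q.2.1) • f z + (s * q.2.2) • g z)
      ((contDiff_pair hf hg _ _).of_le (by simp)) (by
        convert h2 using 2
        funext z
        simp [smul_smul, smul_add]) (by
        simp only [Function.comp_apply, zero_mul, Set.IccExtend_left]
        exact h0)
    rw [h3]
    simp
  constructor
  · let ev : C(Set.Icc (0 : ℝ) 1, Space D) →L[ℝ] Space D :=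
      ContinuousMap.evalCLM ℝ (1 : Set.Icc (0 : ℝ) 1)
    have hev : ContDiffAt ℝ ∞ (fun q => Γ q 1) (x₀, 0, 0) := ev.contDiff.contDiffAt.comp _ hΓ
    refine hev.congr_of_eventuallyEq ?_
    filter_upwards [hscale] with q hq
    have := hq 1 Set.right_mem_uIcc
    simp only [one_mul, Set.IccExtend_right] at this
    exact this
  · filter_upwards [hcurve, hscale] with q ⟨_, hq⟩ hs t ht
    have h1 := hq t ht
    rw [← hs t ht] at h1
    exact h1.congr (fun s hs' => hs s hs') (hs t ht)

theorem contDiffAt_flowPair (hf : ContDiff ℝ ∞ f) (hg : ContDiff ℝ ∞ g) (x₀ : Space D) :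
    ContDiffAt ℝ ∞ (flowPair f g) (x₀, 0, 0) :=
  (flowPair_spec hf hg x₀).1

end FlowPair

/-! ### Lie series of flows and their composition -/

/-- The smooth maps of `ℝ^D` to itself. -/
def smoothMaps (D : ℕ) : Submodule ℝ (Space D → Space D) where
  carrier := {h | ContDiff ℝ ∞ h}
  add_mem' := fun {h h'} (hh : ContDiff ℝ ∞ h) (hh' : ContDiff ℝ ∞ h') => hh.add hh'
  zero_mem' := (contDiff_const : ContDiff ℝ ∞ fun _ : Space D => (0 : Space D))
  smul_mem' := fun c h (hh : ContDiff ℝ ∞ h) => hh.const_smul c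

theorem contDiff_smoothMaps {D : ℕ} (h : smoothMaps D) : ContDiff ℝ ∞ h.1 := h.2

/-- The Lie derivative along a smooth vector field. -/
noncomputable def lieDeriv {D : ℕ} (f : smoothMaps D) : Module.End ℝ (smoothMaps D) where
  toFun h := ⟨fun x => fderiv ℝ h.1 x (f.1 x), by
    have : ContDiff ℝ ∞ fun x => fderiv ℝ h.1 x (f.1 x) :=
      ((contDiff_smoothMaps h).fderiv_right (m := ∞) (by simp)).clm_apply (contDiff_smoothMaps f)
    exact this⟩
  map_add' h h' := by
    ext1
    funext x
    have h1 : DifferentiableAt ℝ h.1 x := (contDiff_smoothMaps h).differentiable (by simp) x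
    have h2 : DifferentiableAt ℝ h'.1 x := (contDiff_smoothMaps h').differentiable (by simp) x
    simp [fderiv_add h1 h2]
  map_smul' c h := by
    ext1
    funext x
    have h1 : DifferentiableAt ℝ h.1 x := (contDiff_smoothMaps h).differentiable (by simp) x
    simp [fderiv_const_smul h1 c]

theorem lieDeriv_apply {D : ℕ} (f h : smoothMaps D) (x : Space D) :
    (lieDeriv f h).1 x = fderiv ℝ h.1 x (f.1 x) := rfl

/-- The array `S` satisfies the recursion of the coefficients of `exp (τ • A + η • B)`; the first
index is the degree in `B`. -/
def IsExpArray {R : Type*} [Ring R] [Algebra ℝ R] (A B : R) (S : ℕ → ℕ → R) : Prop :=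
  S 0 0 = 1 ∧ ∀ k p, ((k + p : ℕ) : ℝ) • S k p =
    (if p = 0 then 0 else S k (p - 1) * A) + (if k = 0 then 0 else S (k - 1) p * B)

section LieSeries

variable {D : ℕ}

/-- The part of degree `n` of a bivariate series of operators, applied to a smooth map. -/
noncomputable def homPart (S : ℕ → ℕ → Module.End ℝ (smoothMaps D)) (n : ℕ) (h : smoothMaps D)
    (q : Space D × ℝ × ℝ) : Space D :=
  ∑ x ∈ Finset.HasAntidiagonal.antidiagonal n, (q.2.1 ^ x.2 * q.2.2 ^ x.1) • (S x.1 x.2 h).1 q.1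

theorem homPart_scale (S : ℕ → ℕ → Module.End ℝ (smoothMaps D)) (n : ℕ) (h : smoothMaps D)
    (q : Space D × ℝ × ℝ) (t : ℝ) :
    homPart S n h (q.1, t * q.2.1, t * q.2.2) = t ^ n • homPart S n h q := by
  rw [homPart, homPart, Finset.smul_sum]
  refine Finset.sum_congr rfl fun x hx => ?_
  rw [smul_smul, ← Finset.HasAntidiagonal.mem_antidiagonal.1 hx]
  congr 1
  ring

theorem IsExpArray.homPart_succ {A B : Module.End ℝ (smoothMaps D)}
    {S : ℕ → ℕ → Module.End ℝ (smoothMaps D)} (hS : IsExpArray A B S) (n : ℕ) (h : smoothMaps D)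
    (q : Space D × ℝ × ℝ) :
    ((n + 1 : ℕ) : ℝ) • homPart S (n + 1) h q =
      q.2.1 • homPart S n (A h) q + q.2.2 • homPart S n (B h) q := by
  have h1 : ∀ x ∈ Finset.HasAntidiagonal.antidiagonal (n + 1),
      ((n + 1 : ℕ) : ℝ) • ((q.2.1 ^ x.2 * q.2.2 ^ x.1) • (S x.1 x.2 h).1 q.1) =
      (q.2.1 ^ x.2 * q.2.2 ^ x.1) • (if x.2 = 0 then 0 else (S x.1 (x.2 - 1) (A h)).1 q.1) +
      (q.2.1 ^ x.2 * q.2.2 ^ x.1) • (if x.1 = 0 then 0 else (S (x.1 - 1) x.2 (B h)).1 q.1) := by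
    intro x hx
    have h2 := congrArg (fun T : Module.End ℝ (smoothMaps D) => (T h).1 q.1) (hS.2 x.1 x.2)
    rw [Finset.HasAntidiagonal.mem_antidiagonal.1 hx] at h2
    rw [smul_comm, ← smul_add]
    congr 1
    refine h2.trans ?_
    split_ifs <;> simp
  rw [homPart, Finset.smul_sum, Finset.sum_congr rfl h1, Finset.sum_add_distrib,
    Finset.Nat.sum_antidiagonal_succ', Finset.Nat.sum_antidiagonal_succ]
  simp only [if_true, smul_zero, zero_add, Nat.add_eq_zero_iff, one_ne_zero, and_false, if_false,
    Nat.add_sub_cancel, homPart, Finset.smul_sum, smul_smul]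
  congr 1 <;> refine Finset.sum_congr rfl fun x _ => ?_ <;> congr 1 <;> ring

/-- Lie series of the flow of `τ • f + η • g`. -/
theorem flowPair_isBigO {f g : smoothMaps D} {S : ℕ → ℕ → Module.End ℝ (smoothMaps D)}
    (hS : IsExpArray (lieDeriv f) (lieDeriv g) S) (x₀ : Space D) (N : ℕ) (h : smoothMaps D) :
    (fun q : Space D × ℝ × ℝ => h.1 (flowPair f.1 g.1 q) -
      ∑ n ∈ Finset.range N, homPart S n h q) =O[𝓝 (x₀, 0, 0)] fun q => ‖q.2‖ ^ N := by
  induction N generalizing h with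
  | zero =>
    simp only [Finset.range_zero, Finset.sum_empty, sub_zero, pow_zero]
    have hc : ContinuousAt (fun q => h.1 (flowPair f.1 g.1 q)) (x₀, 0, 0) :=
      (contDiff_smoothMaps h).continuous.continuousAt.comp
        (contDiffAt_flowPair f.2 g.2 x₀).continuousAt
    exact hc.isBigO_one ℝ
  | succ N ih =>
    obtain ⟨C₁, hC₁⟩ := (ih (lieDeriv f h)).bound
    obtain ⟨C₂, hC₂⟩ := (ih (lieDeriv g h)).bound
    obtain ⟨δ, hδ, hball⟩ := Metric.eventually_nhds_iff_ball.1
      ((hC₁.and hC₂).and (flowPair_spec f.2 g.2 x₀).2)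
    refine IsBigO.of_bound (|C₁| + |C₂|) ?_
    filter_upwards [Metric.ball_mem_nhds _ hδ] with q hq
    have hqt : ∀ t ∈ Set.Icc (0 : ℝ) 1,
        ((q.1, t * q.2.1, t * q.2.2) : Space D × ℝ × ℝ) ∈ Metric.ball (x₀, (0 : ℝ), (0 : ℝ)) δ := by
      intro t ht
      rw [Metric.mem_ball, Prod.dist_eq, Prod.dist_eq, max_lt_iff, max_lt_iff] at hq ⊢
      simp only [dist_zero_right, norm_mul, Real.norm_of_nonneg ht.1] at hq ⊢
      exact ⟨hq.1, (mul_le_of_le_one_left (norm_nonneg _) ht.2).trans_lt hq.2.1,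
        (mul_le_of_le_one_left (norm_nonneg _) ht.2).trans_lt hq.2.2⟩
    have hcurve := (hball q hq).2
    rw [Set.uIcc_of_le zero_le_one] at hcurve
    -- Flow and partial sum are compared along the ray `(t τ, t η)`. The derivative of their
    -- difference consists of the remainders of order `N` for the two Lie derivatives of `h`.
    let φ : ℝ → Space D := fun t => flowPair f.1 g.1 (q.1, t * q.2.1, t * q.2.2)
    let P : ℝ → Space D := fun t => ∑ n ∈ Finset.range (N + 1), t ^ n • homPart S n h q
    have hφ : ∀ t ∈ Set.Icc (0 : ℝ) 1, HasDerivWithinAt (fun t => h.1 (φ t))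
        (q.2.1 • (lieDeriv f h).1 (φ t) + q.2.2 • (lieDeriv g h).1 (φ t)) (Set.Icc 0 1) t := by
      intro t ht
      have h1 : HasFDerivAt h.1 (fderiv ℝ h.1 (φ t)) (φ t) :=
        ((contDiff_smoothMaps h).differentiable (by simp) _).hasFDerivAt
      have h2 := h1.comp_hasDerivWithinAt t (hcurve t ht)
      refine h2.congr_deriv ?_
      rw [map_add, map_smul, map_smul]
      rfl
    have hP : ∀ t, HasDerivAt P (∑ n ∈ Finset.range N, t ^ n •
        (q.2.1 • homPart S n (lieDeriv f h) q + q.2.2 • homPart S n (lieDeriv g h) q)) t := by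
      intro t
      have h1 : HasDerivAt P (∑ n ∈ Finset.range (N + 1),
          ((n : ℝ) * t ^ (n - 1)) • homPart S n h q) t :=
        HasDerivAt.fun_sum fun n _ => (hasDerivAt_pow n t).smul_const _
      refine h1.congr_deriv ?_
      rw [Finset.sum_range_succ']
      simp only [Nat.cast_zero, zero_mul, zero_smul, add_zero, Nat.add_sub_cancel]
      refine Finset.sum_congr rfl fun n _ => ?_
      rw [← hS.homPart_succ, smul_smul, mul_comm]
    have hmv := norm_image_sub_le_of_norm_deriv_le_segment_01'
      (f := fun t => h.1 (φ t) - P t) (C := (|C₁| + |C₂|) * ‖q.2‖ ^ (N + 1))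
      (fun t ht => (hφ t ht).sub (hP t).hasDerivWithinAt) (fun t ht => by
        have ht' : t ∈ Set.Icc (0 : ℝ) 1 := Set.Ico_subset_Icc_self ht
        obtain ⟨⟨hb₁, hb₂⟩, -⟩ := hball _ (hqt t ht')
        simp only [homPart_scale] at hb₁ hb₂
        have hn : ‖((t * q.2.1, t * q.2.2) : ℝ × ℝ)‖ ^ N ≤ ‖q.2‖ ^ N := by
          have : ((t * q.2.1, t * q.2.2) : ℝ × ℝ) = t • q.2 := rfl
          rw [this, norm_smul, Real.norm_of_nonneg ht'.1]
          exact pow_le_pow_left₀ (by have := ht'.1; positivity)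
            (mul_le_of_le_one_left (norm_nonneg _) ht'.2) N
        have hb : ∀ {C : ℝ} {v : Space D} {τ : ℝ}, |τ| ≤ ‖q.2‖ →
            ‖v‖ ≤ C * ‖‖((t * q.2.1, t * q.2.2) : ℝ × ℝ)‖ ^ N‖ →
            ‖τ • v‖ ≤ |C| * ‖q.2‖ ^ (N + 1) := by
          intro C v τ hτ hv
          rw [norm_pow, norm_norm] at hv
          rw [norm_smul, Real.norm_eq_abs]
          calc |τ| * ‖v‖ ≤ ‖q.2‖ * (|C| * ‖q.2‖ ^ N) := by
                refine mul_le_mul hτ (hv.trans ?_) (norm_nonneg _) (norm_nonneg _)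
                exact mul_le_mul (le_abs_self C) hn (by positivity) (abs_nonneg _)
            _ = |C| * ‖q.2‖ ^ (N + 1) := by ring
        have hsplit : q.2.1 • (lieDeriv f h).1 (φ t) + q.2.2 • (lieDeriv g h).1 (φ t) -
            ∑ n ∈ Finset.range N, t ^ n •
              (q.2.1 • homPart S n (lieDeriv f h) q + q.2.2 • homPart S n (lieDeriv g h) q) =
            q.2.1 • ((lieDeriv f h).1 (φ t) -
              ∑ n ∈ Finset.range N, t ^ n • homPart S n (lieDeriv f h) q) +
            q.2.2 • ((lieDeriv g h).1 (φ t) -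
              ∑ n ∈ Finset.range N, t ^ n • homPart S n (lieDeriv g h) q) := by
          simp only [smul_add, Finset.sum_add_distrib, smul_sub, Finset.smul_sum]
          simp only [smul_comm (_ ^ _ : ℝ)]
          abel
        rw [hsplit, add_mul]
        refine (norm_add_le _ _).trans (add_le_add (hb ?_ hb₁) (hb ?_ hb₂))
        · exact norm_fst_le q.2
        · exact norm_snd_le q.2)
    have h0 : h.1 (φ 0) - P 0 = 0 := by
      have h1 : φ 0 = q.1 := by
        simp only [φ, zero_mul]
        exact flowPair_zero f.1 g.1 q.1
      rw [h1]
      simp only [P, Finset.sum_range_succ']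
      simp [homPart, hS.1]
    rw [h0, sub_zero] at hmv
    rw [norm_pow, norm_norm]
    simpa [φ, P] using hmv

end LieSeries

theorem sum_range_antidiagonal {M : Type*} [AddCommMonoid M] (N : ℕ) (F : ℕ → ℕ → M) :
    ∑ K ∈ Finset.range N, ∑ x ∈ Finset.HasAntidiagonal.antidiagonal K, F x.1 x.2 =
      ∑ i ∈ Finset.range N, ∑ j ∈ Finset.range N, if i + j < N then F i j else 0 := by
  simp_rw [Finset.Nat.sum_antidiagonal_eq_sum_range_succ F]
  rw [Finset.sum_range_diag_flip N F]
  refine Finset.sum_congr rfl fun i hi => ?_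
  rw [← Finset.sum_filter]
  refine Finset.sum_congr ?_ fun _ _ => rfl
  ext j
  simp only [Finset.mem_range, Finset.mem_filter]
  omega

section Series

variable {D : ℕ}

theorem isBigO_monomial_smul {x₀ : Space D} {p k N : ℕ} (h : N ≤ p + k)
    {v : Space D × ℝ × ℝ → Space D}
    (hv : v =O[𝓝 (x₀, 0, 0)] fun _ => (1 : ℝ)) :
    (fun q : Space D × ℝ × ℝ => (q.2.1 ^ p * q.2.2 ^ k) • v q) =O[𝓝 (x₀, 0, 0)]
      fun q => ‖q.2‖ ^ N := by
  have h1 : (fun q : Space D × ℝ × ℝ => q.2.1 ^ p * q.2.2 ^ k) =O[𝓝 (x₀, 0, 0)]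
      fun q => ‖q.2‖ ^ N := by
    refine IsBigO.of_bound 1 ?_
    have hlt : ∀ᶠ q in 𝓝 ((x₀, 0, 0) : Space D × ℝ × ℝ), ‖q.2‖ < 1 := by
      have : Tendsto (fun q : Space D × ℝ × ℝ => ‖q.2‖) (𝓝 (x₀, 0, 0)) (𝓝 ‖((0, 0) : ℝ × ℝ)‖) :=
        (continuous_norm.comp continuous_snd).tendsto _
      exact this.eventually_lt_const (by simp)
    filter_upwards [hlt] with q hq
    rw [norm_mul, norm_pow, norm_pow, one_mul, norm_pow, norm_norm]
    calc ‖q.2.1‖ ^ p * ‖q.2.2‖ ^ k ≤ ‖q.2‖ ^ p * ‖q.2‖ ^ k := by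
          gcongr
          · exact norm_fst_le q.2
          · exact norm_snd_le q.2
      _ = ‖q.2‖ ^ (p + k) := (pow_add _ _ _).symm
      _ ≤ ‖q.2‖ ^ N := pow_le_pow_of_le_one (norm_nonneg _) hq.le h
  simpa using h1.smul hv

/-- Partial sums of a bivariate series of operators, applied to a smooth map. -/
noncomputable def partialSum (S : PowerSeries (PowerSeries (Module.End ℝ (smoothMaps D)))) (N : ℕ)
    (h : smoothMaps D) (q : Space D × ℝ × ℝ) : Space D :=
  ∑ k ∈ Finset.range N, ∑ p ∈ Finset.range N,
    (q.2.1 ^ p * q.2.2 ^ k) • ((S.coeff k).coeff p h).1 q.1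

/-- The family of maps `χ (·, τ, η)` is smooth near `x₀` and for small `τ` and `η`, fixes `x₀` for
`τ = η = 0`, and has the Lie series `S`. -/
def HasSeries (x₀ : Space D) (χ : Space D × ℝ × ℝ → Space D)
    (S : PowerSeries (PowerSeries (Module.End ℝ (smoothMaps D)))) : Prop :=
  ContDiffAt ℝ ∞ χ (x₀, 0, 0) ∧ χ (x₀, 0, 0) = x₀ ∧ ∀ (h : smoothMaps D) (N : ℕ),
    (fun q => h.1 (χ q) - partialSum S N h q) =O[𝓝 (x₀, 0, 0)] fun q => ‖q.2‖ ^ N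

theorem isBigO_one_smoothMaps {x₀ : Space D} (h : smoothMaps D) :
    (fun q : Space D × ℝ × ℝ => h.1 q.1) =O[𝓝 (x₀, 0, 0)] fun _ => (1 : ℝ) :=
  ((contDiff_smoothMaps h).continuous.comp continuous_fst).continuousAt.isBigO_one ℝ

theorem hasSeries_flowPair {f g : smoothMaps D}
    {S : PowerSeries (PowerSeries (Module.End ℝ (smoothMaps D)))}
    (hS : IsExpArray (lieDeriv f) (lieDeriv g) fun k p => (S.coeff k).coeff p) (x₀ : Space D) :
    HasSeries x₀ (flowPair f.1 g.1) S := by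
  refine ⟨contDiffAt_flowPair f.2 g.2 x₀, flowPair_zero _ _ _, fun h N => ?_⟩
  · have h1 := flowPair_isBigO hS x₀ N h
    have h2 : (fun q : Space D × ℝ × ℝ => ∑ k ∈ Finset.range N, ∑ p ∈ Finset.range N,
        if k + p < N then 0 else (q.2.1 ^ p * q.2.2 ^ k) • ((S.coeff k).coeff p h).1 q.1)
        =O[𝓝 (x₀, 0, 0)] fun q => ‖q.2‖ ^ N := by
      refine IsBigO.fun_sum fun k _ => IsBigO.fun_sum fun p _ => ?_
      split_ifs with hkp
      · exact isBigO_zero _ _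
      · exact isBigO_monomial_smul (by omega) (isBigO_one_smoothMaps _)
    refine (h1.sub h2).congr_left fun q => ?_
    rw [sub_sub]
    congr 1
    simp only [homPart, partialSum]
    rw [sum_range_antidiagonal N fun k p => (q.2.1 ^ p * q.2.2 ^ k) • ((S.coeff k).coeff p h).1 q.1,
      ← Finset.sum_add_distrib]
    refine Finset.sum_congr rfl fun k _ => ?_
    rw [← Finset.sum_add_distrib]
    refine Finset.sum_congr rfl fun p _ => ?_
    split_ifs <;> simp

theorem partialSum_mul (S S' : PowerSeries (PowerSeries (Module.End ℝ (smoothMaps D)))) (N : ℕ)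
    (h : smoothMaps D) (q : Space D × ℝ × ℝ) :
    partialSum (S * S') N h q =
      ∑ k ∈ Finset.range N, ∑ k' ∈ Finset.range N, ∑ p ∈ Finset.range N, ∑ p' ∈ Finset.range N,
        if k + k' < N ∧ p + p' < N then (q.2.1 ^ (p + p') * q.2.2 ^ (k + k')) •
          ((S.coeff k).coeff p ((S'.coeff k').coeff p' h)).1 q.1 else 0 := by
  have h1 : ∀ k p, ((q.2.1 ^ p * q.2.2 ^ k) • (((S * S').coeff k).coeff p h).1 q.1) =
      ∑ x ∈ Finset.HasAntidiagonal.antidiagonal k, ∑ y ∈ Finset.HasAntidiagonal.antidiagonal p,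
        (q.2.1 ^ (y.1 + y.2) * q.2.2 ^ (x.1 + x.2)) •
          ((S.coeff x.1).coeff y.1 ((S'.coeff x.2).coeff y.2 h)).1 q.1 := by
    intro k p
    have h2 : (((S * S').coeff k).coeff p h).1 q.1 =
        ∑ x ∈ Finset.HasAntidiagonal.antidiagonal k, ∑ y ∈ Finset.HasAntidiagonal.antidiagonal p,
          ((S.coeff x.1).coeff y.1 ((S'.coeff x.2).coeff y.2 h)).1 q.1 := by
      simp only [PowerSeries.coeff_mul, map_sum, LinearMap.sum_apply, Submodule.coe_sum,
        Finset.sum_apply, Module.End.mul_apply]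
    rw [h2, Finset.smul_sum]
    refine Finset.sum_congr rfl fun x hx => ?_
    rw [Finset.smul_sum]
    refine Finset.sum_congr rfl fun y hy => ?_
    rw [Finset.HasAntidiagonal.mem_antidiagonal.1 hx, Finset.HasAntidiagonal.mem_antidiagonal.1 hy]
  simp only [partialSum, h1]
  have h3 : ∀ k ∈ Finset.range N, (∑ p ∈ Finset.range N,
      ∑ x ∈ Finset.HasAntidiagonal.antidiagonal k, ∑ y ∈ Finset.HasAntidiagonal.antidiagonal p,
        (q.2.1 ^ (y.1 + y.2) * q.2.2 ^ (x.1 + x.2)) •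
          ((S.coeff x.1).coeff y.1 ((S'.coeff x.2).coeff y.2 h)).1 q.1) =
      ∑ x ∈ Finset.HasAntidiagonal.antidiagonal k, ∑ p ∈ Finset.range N, ∑ p' ∈ Finset.range N,
        if p + p' < N then (q.2.1 ^ (p + p') * q.2.2 ^ (x.1 + x.2)) •
          ((S.coeff x.1).coeff p ((S'.coeff x.2).coeff p' h)).1 q.1 else 0 := by
    intro k _
    rw [Finset.sum_comm]
    refine Finset.sum_congr rfl fun x _ => ?_
    exact sum_range_antidiagonal N fun p p' => (q.2.1 ^ (p + p') * q.2.2 ^ (x.1 + x.2)) •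
          ((S.coeff x.1).coeff p ((S'.coeff x.2).coeff p' h)).1 q.1
  rw [Finset.sum_congr rfl h3, sum_range_antidiagonal N fun k k' => ∑ p ∈ Finset.range N,
    ∑ p' ∈ Finset.range N, if p + p' < N then (q.2.1 ^ (p + p') * q.2.2 ^ (k + k')) •
          ((S.coeff k).coeff p ((S'.coeff k').coeff p' h)).1 q.1 else 0]
  refine Finset.sum_congr rfl fun k _ => Finset.sum_congr rfl fun k' _ => ?_
  by_cases hk : k + k' < N <;> simp [hk]

/-- Expand `h ∘ χ'` at `χ q` by `S'`; its coefficients are smooth maps again, and each is expanded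
by `S`. Operators act on functions, so the map applied first gives the left factor. Excess products
have total degree at least `N`. -/
theorem HasSeries.comp {x₀ : Space D} {χ χ' : Space D × ℝ × ℝ → Space D}
    {S S' : PowerSeries (PowerSeries (Module.End ℝ (smoothMaps D)))} (hχ : HasSeries x₀ χ S)
    (hχ' : HasSeries x₀ χ' S') : HasSeries x₀ (fun q => χ' (χ q, q.2)) (S * S') := by
  have hΦ' : ContDiffAt ℝ ∞ (fun q : Space D × ℝ × ℝ => (χ q, q.2)) (x₀, 0, 0) :=
    hχ.1.prodMk contDiffAt_snd
  have hΦ : Tendsto (fun q : Space D × ℝ × ℝ => (χ q, q.2)) (𝓝 (x₀, 0, 0)) (𝓝 (x₀, 0, 0)) := by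
    have := hΦ'.continuousAt.tendsto
    rwa [hχ.2.1] at this
  refine ⟨ContDiffAt.comp (x₀, 0, 0) (by rw [hχ.2.1]; exact hχ'.1) hΦ', ?_, fun h N => ?_⟩
  · simp only [hχ.2.1]
    exact hχ'.2.1
  have h1 := (hχ'.2.2 h N).comp_tendsto hΦ
  have h2 : (fun q : Space D × ℝ × ℝ => ∑ k' ∈ Finset.range N, ∑ p' ∈ Finset.range N,
      (q.2.1 ^ p' * q.2.2 ^ k') • (((S'.coeff k').coeff p' h).1 (χ q) -
        partialSum S N ((S'.coeff k').coeff p' h) q)) =O[𝓝 (x₀, 0, 0)] fun q => ‖q.2‖ ^ N := by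
    refine IsBigO.fun_sum fun k' _ => IsBigO.fun_sum fun p' _ => ?_
    have hc : Continuous fun q : Space D × ℝ × ℝ => q.2.1 ^ p' * q.2.2 ^ k' := by fun_prop
    simpa using (hc.continuousAt.isBigO_one ℝ).smul (hχ.2.2 ((S'.coeff k').coeff p' h) N)
  have h3 : (fun q : Space D × ℝ × ℝ => ∑ k ∈ Finset.range N, ∑ k' ∈ Finset.range N,
      ∑ p ∈ Finset.range N, ∑ p' ∈ Finset.range N,
        if k + k' < N ∧ p + p' < N then 0 else (q.2.1 ^ (p + p') * q.2.2 ^ (k + k')) •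
          ((S.coeff k).coeff p ((S'.coeff k').coeff p' h)).1 q.1) =O[𝓝 (x₀, 0, 0)]
      fun q => ‖q.2‖ ^ N := by
    refine IsBigO.fun_sum fun k _ => IsBigO.fun_sum fun k' _ =>
      IsBigO.fun_sum fun p _ => IsBigO.fun_sum fun p' _ => ?_
    split_ifs with hkp
    · exact isBigO_zero _ _
    · exact isBigO_monomial_smul (by omega) (isBigO_one_smoothMaps _)
  refine ((h1.add h2).add h3).congr_left fun q => ?_
  have h4 : ∑ k' ∈ Finset.range N, ∑ p' ∈ Finset.range N,
      (q.2.1 ^ p' * q.2.2 ^ k') • partialSum S N ((S'.coeff k').coeff p' h) q =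
      partialSum (S * S') N h q + ∑ k ∈ Finset.range N, ∑ k' ∈ Finset.range N,
      ∑ p ∈ Finset.range N, ∑ p' ∈ Finset.range N,
        if k + k' < N ∧ p + p' < N then 0 else (q.2.1 ^ (p + p') * q.2.2 ^ (k + k')) •
          ((S.coeff k).coeff p ((S'.coeff k').coeff p' h)).1 q.1 := by
    rw [partialSum_mul]
    simp only [partialSum, Finset.smul_sum, ← Finset.sum_add_distrib]
    have h5 : ∀ k' ∈ Finset.range N, ∀ G : ℕ → ℕ → ℕ → Space D, (∑ p' ∈ Finset.range N,
        ∑ k ∈ Finset.range N, ∑ p ∈ Finset.range N, G p' k p) =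
        ∑ k ∈ Finset.range N, ∑ p ∈ Finset.range N, ∑ p' ∈ Finset.range N, G p' k p := by
      intro k' _ G
      rw [Finset.sum_comm]
      exact Finset.sum_congr rfl fun k _ => Finset.sum_comm
    rw [Finset.sum_congr rfl fun k' hk' => h5 k' hk' _, Finset.sum_comm]
    refine Finset.sum_congr rfl fun k _ => Finset.sum_congr rfl fun k' _ =>
      Finset.sum_congr rfl fun p _ => Finset.sum_congr rfl fun p' _ => ?_
    have h6 : (q.2.1 ^ p' * q.2.2 ^ k') • (q.2.1 ^ p * q.2.2 ^ k) •
        ((S.coeff k).coeff p ((S'.coeff k').coeff p' h)).1 q.1 =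
        (q.2.1 ^ (p + p') * q.2.2 ^ (k + k')) •
          ((S.coeff k).coeff p ((S'.coeff k').coeff p' h)).1 q.1 := by
      rw [smul_smul]
      congr 1
      ring
    rw [h6]
    split_ifs <;> simp
  simp only [Function.comp_apply, smul_sub, Finset.sum_sub_distrib]
  rw [h4]
  simp only [partialSum]
  abel

end Series

/-! ### Formal series in noncommuting operators -/

/-- The series `∑ G_q Y_q τ ^ q`. -/
noncomputable def appendSeries {R : Type*} [Ring R] (Y : ℕ → R)
    (G : ℕ → PowerSeries R) : PowerSeries R :=
  PowerSeries.mk fun p =>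
    ∑ x ∈ Finset.HasAntidiagonal.antidiagonal p, (G x.2).coeff x.1 * Y x.2

theorem coeff_appendSeries {R : Type*} [Ring R] (Y : ℕ → R) (G : ℕ → PowerSeries R) (p : ℕ) :
    (appendSeries Y G).coeff p =
      ∑ x ∈ Finset.HasAntidiagonal.antidiagonal p, (G x.2).coeff x.1 * Y x.2 :=
  PowerSeries.coeff_mk _ _

section Formal

variable {R : Type*} [Ring R] [Algebra ℝ R]

/-- The Euler operator `τ d/dτ` on power series in `τ`. -/
noncomputable def euler (F : PowerSeries R) : PowerSeries R :=
  PowerSeries.mk fun p => (p : ℝ) • F.coeff p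

theorem coeff_euler (F : PowerSeries R) (p : ℕ) : (euler F).coeff p = (p : ℝ) • F.coeff p :=
  PowerSeries.coeff_mk _ _

theorem euler_mul (F G : PowerSeries R) : euler (F * G) = euler F * G + F * euler G := by
  ext p
  simp only [coeff_euler, map_add, PowerSeries.coeff_mul, Finset.smul_sum,
    ← Finset.sum_add_distrib]
  refine Finset.sum_congr rfl fun x hx => ?_
  rw [← Finset.HasAntidiagonal.mem_antidiagonal.1 hx, smul_mul_assoc, mul_smul_comm, ← add_smul,
    Nat.cast_add]

theorem euler_C (B : R) : euler (PowerSeries.C B) = 0 := by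
  ext p
  rw [coeff_euler, PowerSeries.coeff_C]
  split_ifs with h <;> simp [h]

/-- The series `∑ c ^ p τ ^ p A ^ p / p!`. -/
noncomputable def expSeries (A : R) (c : ℝ) : PowerSeries R :=
  PowerSeries.mk fun p => (c ^ p / p.factorial) • A ^ p

theorem euler_expSeries (A : R) (c : ℝ) :
    euler (expSeries A c) = PowerSeries.X * (PowerSeries.C (c • A) * expSeries A c) := by
  ext p
  rw [coeff_euler]
  cases p with
  | zero => simp
  | succ p =>
    rw [PowerSeries.coeff_succ_X_mul, PowerSeries.coeff_C_mul, expSeries, PowerSeries.coeff_mk,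
      PowerSeries.coeff_mk, smul_smul, smul_mul_smul_comm, pow_succ' A, Nat.factorial_succ]
    congr 1
    have : (p.factorial : ℝ) ≠ 0 := by positivity
    push_cast
    field_simp
    ring

theorem expSeries_mul_C (A : R) (c d : ℝ) :
    expSeries A c * PowerSeries.C (d • A) = PowerSeries.C (d • A) * expSeries A c := by
  ext p
  rw [PowerSeries.coeff_C_mul, PowerSeries.coeff_mul_C, expSeries, PowerSeries.coeff_mk,
    smul_mul_smul_comm, smul_mul_smul_comm, ← pow_succ, ← pow_succ', mul_comm d]

theorem coeff_zero_expSeries (A : R) (c : ℝ) : (expSeries A c).coeff 0 = 1 := by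
  simp [expSeries]

theorem expSeries_zero (A : R) : expSeries A 0 = 1 := by
  ext p
  rw [expSeries, PowerSeries.coeff_mk, PowerSeries.coeff_one]
  split_ifs with h <;> simp [h]

/-- Uniqueness for linear equations `τ dF/dτ = τ A F`. -/
theorem eq_of_euler_eq {A : R} {F G : PowerSeries R}
    (hF : euler F = PowerSeries.X * (PowerSeries.C A * F))
    (hG : euler G = PowerSeries.X * (PowerSeries.C A * G)) (h0 : F.coeff 0 = G.coeff 0) : F = G := by
  ext p
  induction p with
  | zero => exact h0
  | succ p ih =>
    have h1 := congrArg (PowerSeries.coeff (p + 1)) hF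
    have h2 := congrArg (PowerSeries.coeff (p + 1)) hG
    rw [coeff_euler, PowerSeries.coeff_succ_X_mul, PowerSeries.coeff_C_mul] at h1 h2
    rw [ih, ← h2] at h1
    exact smul_right_injective R (Nat.cast_ne_zero.2 p.succ_ne_zero) h1

theorem expSeries_add (A : R) (c d : ℝ) :
    expSeries A (c + d) = expSeries A c * expSeries A d := by
  refine eq_of_euler_eq (euler_expSeries A _) ?_ ?_
  · rw [euler_mul, euler_expSeries, euler_expSeries, add_smul, map_add, ← mul_assoc (expSeries A c),
      ← PowerSeries.X_mul, mul_assoc _ (expSeries A c), ← mul_assoc (expSeries A c),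
      expSeries_mul_C]
    simp only [mul_assoc, mul_add, add_mul]
  · simp [PowerSeries.coeff_mul, coeff_zero_expSeries]

/-- The operators `ad_A ^ q B / q!`. -/
noncomputable def adCoeff (A B : R) : ℕ → R
  | 0 => B
  | q + 1 => ((q + 1 : ℕ) : ℝ)⁻¹ • (A * adCoeff A B q - adCoeff A B q * A)

/-- The series `∑ c ^ q τ ^ q ad_A ^ q B / q!`. -/
noncomputable def adSeries (A B : R) (c : ℝ) : PowerSeries R :=
  PowerSeries.mk fun q => c ^ q • adCoeff A B q

theorem euler_adSeries (A B : R) (c : ℝ) :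
    euler (adSeries A B c) = PowerSeries.X *
      (PowerSeries.C (c • A) * adSeries A B c - adSeries A B c * PowerSeries.C (c • A)) := by
  ext q
  rw [coeff_euler]
  cases q with
  | zero => simp
  | succ q =>
    rw [PowerSeries.coeff_succ_X_mul, map_sub, PowerSeries.coeff_C_mul, PowerSeries.coeff_mul_C,
      adSeries, PowerSeries.coeff_mk, PowerSeries.coeff_mk, adCoeff, smul_mul_smul_comm,
      smul_mul_smul_comm, smul_smul, smul_smul, mul_comm c, ← pow_succ, ← smul_sub]
    congr 1
    have : ((q + 1 : ℕ) : ℝ) ≠ 0 := Nat.cast_ne_zero.2 q.succ_ne_zero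
    field_simp

/-- The identity `exp(cτA) B exp(-cτA) = exp(cτ ad_A) B`: both sides solve the same linear equation
with the same initial value. -/
theorem expSeries_mul_C_eq (A B : R) (c : ℝ) :
    expSeries A c * PowerSeries.C B = adSeries A B c * expSeries A c := by
  refine eq_of_euler_eq (A := c • A) ?_ ?_ ?_
  · rw [euler_mul, euler_C, mul_zero, add_zero, euler_expSeries]
    simp only [mul_assoc]
  · rw [euler_mul, euler_adSeries, euler_expSeries, ← mul_assoc (adSeries A B c) PowerSeries.X,
      ← PowerSeries.X_mul]
    simp only [mul_sub, sub_mul, mul_assoc, sub_add_cancel]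
  · simp [PowerSeries.coeff_mul, coeff_zero_expSeries, adSeries, adCoeff, PowerSeries.coeff_C]

theorem appendSeries_add (Y : ℕ → R) (G G' : ℕ → PowerSeries R) :
    appendSeries Y (fun q => G q + G' q) = appendSeries Y G + appendSeries Y G' := by
  ext p
  simp only [coeff_appendSeries, map_add, add_mul, Finset.sum_add_distrib]

theorem appendSeries_smul (Y : ℕ → R) (t : ℝ) (G : ℕ → PowerSeries R) :
    appendSeries Y (fun q => t • G q) = t • appendSeries Y G := by
  ext p
  simp only [coeff_appendSeries, PowerSeries.coeff_smul, smul_mul_assoc, Finset.smul_sum]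

theorem appendSeries_sum {ι : Type*} (Y : ℕ → R) (t : Finset ι) (G : ι → ℕ → PowerSeries R) :
    appendSeries Y (fun q => ∑ i ∈ t, G i q) = ∑ i ∈ t, appendSeries Y (G i) := by
  ext p
  simp only [coeff_appendSeries, map_sum, Finset.sum_mul]
  exact Finset.sum_comm

theorem mul_appendSeries (F : PowerSeries R) (Y : ℕ → R) (G : ℕ → PowerSeries R) :
    F * appendSeries Y G = appendSeries Y fun q => F * G q := by
  ext p
  simp only [coeff_appendSeries, PowerSeries.coeff_mul, Finset.mul_sum, Finset.sum_mul]
  rw [Finset.sum_sigma', Finset.sum_sigma']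
  refine Finset.sum_nbij' (fun x => ⟨(x.1.1 + x.2.1, x.2.2), (x.1.1, x.2.1)⟩)
    (fun x => ⟨(x.2.1, x.2.2 + x.1.2), (x.2.2, x.1.2)⟩) ?_ ?_ ?_ ?_ ?_
  · rintro ⟨⟨i, j⟩, k, l⟩ h
    simp only [Finset.mem_sigma, Finset.HasAntidiagonal.mem_antidiagonal] at h ⊢
    exact ⟨by rw [← h.1, ← h.2, add_assoc], trivial⟩
  · rintro ⟨⟨i, j⟩, k, l⟩ h
    simp only [Finset.mem_sigma, Finset.HasAntidiagonal.mem_antidiagonal] at h ⊢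
    exact ⟨by rw [← h.1, ← h.2, add_assoc], trivial⟩
  · rintro ⟨⟨i, j⟩, k, l⟩ h
    simp only [Finset.mem_sigma, Finset.HasAntidiagonal.mem_antidiagonal] at h ⊢
    rw [h.2]
  · rintro ⟨⟨i, j⟩, k, l⟩ h
    simp only [Finset.mem_sigma, Finset.HasAntidiagonal.mem_antidiagonal] at h ⊢
    rw [h.2]
  · rintro ⟨⟨i, j⟩, k, l⟩ h
    simp only [mul_assoc]

/-- The series `∑ χ (j₁, …, j_k) Y_{j₁ - 1} ⋯ Y_{j_k - 1} τ ^ (j₁ + ⋯ + j_k - k)` over the words of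
length `k`, which are listed backwards. -/
noncomputable def wordSeries (Y : ℕ → R) : ℕ → (List ℕ → ℝ) → PowerSeries R
  | 0, χ => χ [] • 1
  | k + 1, χ => appendSeries Y fun q => wordSeries Y k fun w => χ ((q + 1) :: w)

theorem coeff_wordSeries_congr (Y : ℕ → R) {k p : ℕ} {χ ξ : List ℕ → ℝ}
    (h : ∀ w : List ℕ, (∀ n ∈ w, 0 < n) → w.length = k → w.sum = p + k → χ w = ξ w) :
    (wordSeries Y k χ).coeff p = (wordSeries Y k ξ).coeff p := by
  induction k generalizing p χ ξ with
  | zero =>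
    simp only [wordSeries, PowerSeries.coeff_smul, PowerSeries.coeff_one]
    split_ifs with hp
    · rw [h [] (by simp) rfl (by simp [hp])]
    · simp
  | succ k ih =>
    simp only [wordSeries, coeff_appendSeries]
    refine Finset.sum_congr rfl fun x hx => ?_
    have hx' := Finset.HasAntidiagonal.mem_antidiagonal.1 hx
    congr 1
    refine ih fun w hw hl hs => h _ ?_ (by simp [hl]) ?_
    · simpa using hw
    · simp only [List.sum_cons, hs]
      omega

theorem wordSeries_congr (Y : ℕ → R) {k : ℕ} {χ ξ : List ℕ → ℝ}
    (h : ∀ w : List ℕ, (∀ n ∈ w, 0 < n) → w.length = k → χ w = ξ w) :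
    wordSeries Y k χ = wordSeries Y k ξ := by
  ext p
  exact coeff_wordSeries_congr Y fun w hw hl _ => h w hw hl

theorem wordSeries_add (Y : ℕ → R) (k : ℕ) (χ ξ : List ℕ → ℝ) :
    wordSeries Y k (fun w => χ w + ξ w) = wordSeries Y k χ + wordSeries Y k ξ := by
  induction k generalizing χ ξ with
  | zero => simp only [wordSeries, add_smul]
  | succ k ih => simp only [wordSeries, ih, appendSeries_add]

theorem wordSeries_smul (Y : ℕ → R) (k : ℕ) (t : ℝ) (χ : List ℕ → ℝ) :
    wordSeries Y k (fun w => t * χ w) = t • wordSeries Y k χ := by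
  induction k generalizing χ with
  | zero => simp only [wordSeries, mul_smul]
  | succ k ih => simp only [wordSeries, ih, appendSeries_smul]

theorem wordSeries_conv (Y : ℕ → R) (k : ℕ) (χ ξ : List ℕ → ℝ) :
    wordSeries Y k (conv χ ξ) =
      ∑ x ∈ Finset.HasAntidiagonal.antidiagonal k, wordSeries Y x.1 χ * wordSeries Y x.2 ξ := by
  induction k generalizing ξ with
  | zero => simp [wordSeries, conv_nil, smul_smul, mul_comm]
  | succ k ih =>
    rw [Finset.Nat.sum_antidiagonal_succ']
    have h1 : ∀ q : ℕ, (wordSeries Y k fun w => conv χ ξ ((q + 1) :: w)) =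
        ξ [] • (wordSeries Y k fun w => χ ((q + 1) :: w)) +
        ∑ x ∈ Finset.HasAntidiagonal.antidiagonal k,
          wordSeries Y x.1 χ * wordSeries Y x.2 fun w => ξ ((q + 1) :: w) := by
      intro q
      rw [← ih, ← wordSeries_smul, ← wordSeries_add]
      refine wordSeries_congr Y fun w _ _ => ?_
      rw [conv_cons, mul_comm]
    simp only [wordSeries, h1, appendSeries_add, appendSeries_smul, appendSeries_sum,
      mul_appendSeries, mul_smul_comm, mul_one]

theorem wordSeries_unitChar (Y : ℕ → R) (k : ℕ) :
    wordSeries Y k unitChar = if k = 0 then 1 else 0 := by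
  cases k with
  | zero => simp [wordSeries, unitChar]
  | succ k =>
    have h0 : (fun w : List ℕ => (0 : ℝ)) = fun w => 0 * unitChar w := by simp
    simp only [wordSeries, unitChar]
    rw [h0]
    simp only [wordSeries_smul, zero_smul]
    ext p
    simp [coeff_appendSeries]

theorem wordSeries_expChar (A B : R) (k : ℕ) (b c : ℝ) :
    wordSeries (adCoeff A B) k (expChar b c) = (b ^ k / k.factorial) • adSeries A B c ^ k := by
  induction k with
  | zero => simp [wordSeries, expChar]
  | succ k ih =>
    have h1 : ∀ q : ℕ, (wordSeries (adCoeff A B) k fun w => expChar b c ((q + 1) :: w)) =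
        c ^ q • ((b / (k + 1)) • wordSeries (adCoeff A B) k (expChar b c)) := by
      intro q
      rw [← wordSeries_smul, ← wordSeries_smul]
      refine wordSeries_congr _ fun w _ hl => ?_
      rw [expChar, hl, Nat.add_sub_cancel]
      ring
    have h2 : ∀ F : PowerSeries R, appendSeries (adCoeff A B) (fun q => c ^ q • F) =
        F * adSeries A B c := by
      intro F
      ext p
      simp only [coeff_appendSeries, PowerSeries.coeff_mul, adSeries, PowerSeries.coeff_mk,
        PowerSeries.coeff_smul, smul_mul_assoc, mul_smul_comm]
    simp only [wordSeries, h1]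
    rw [h2, ih, smul_smul, smul_mul_assoc, ← pow_succ, Nat.factorial_succ]
    congr 1
    have : (k.factorial : ℝ) ≠ 0 := by positivity
    push_cast
    field_simp
    ring

/-- The left-hand operator multiplies each word by its weight, which cancels the denominator of the
outermost integral; the head letter then splits off as a factor. -/
theorem euler_wordSeries_intChar (A B : R) (k : ℕ) :
    euler (wordSeries (adCoeff A B) (k + 1) intChar) +
        ((k + 1 : ℕ) : ℝ) • wordSeries (adCoeff A B) (k + 1) intChar =
      wordSeries (adCoeff A B) k intChar * adSeries A B 1 := by
  ext p
  rw [map_add, coeff_euler, PowerSeries.coeff_smul, ← add_smul, ← Nat.cast_add,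
    PowerSeries.coeff_mul, wordSeries, coeff_appendSeries, Finset.smul_sum]
  refine Finset.sum_congr rfl fun x hx => ?_
  have hx' := Finset.HasAntidiagonal.mem_antidiagonal.1 hx
  have h1 : (wordSeries (adCoeff A B) k fun w => intChar ((x.2 + 1) :: w)).coeff x.1 =
      (((p + (k + 1) : ℕ) : ℝ)⁻¹ • wordSeries (adCoeff A B) k intChar).coeff x.1 := by
    rw [← wordSeries_smul]
    refine coeff_wordSeries_congr _ fun w _ _ hs => ?_
    rw [intChar, hs, div_eq_inv_mul]
    congr 3
    omega
  rw [h1, PowerSeries.coeff_smul, adSeries, PowerSeries.coeff_mk, one_pow, one_smul, smul_mul_assoc,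
    smul_smul, mul_inv_cancel₀ (Nat.cast_ne_zero.2 (by omega)), one_smul]

/-- The sum of `wordSeries Y k χ η ^ k`. -/
noncomputable def fullSeries (Y : ℕ → R) (χ : List ℕ → ℝ) : PowerSeries (PowerSeries R) :=
  PowerSeries.mk fun k => wordSeries Y k χ

theorem coeff_fullSeries (Y : ℕ → R) (χ : List ℕ → ℝ) (k : ℕ) :
    (fullSeries Y χ).coeff k = wordSeries Y k χ := PowerSeries.coeff_mk _ _

theorem fullSeries_conv (Y : ℕ → R) (χ ξ : List ℕ → ℝ) :
    fullSeries Y (conv χ ξ) = fullSeries Y χ * fullSeries Y ξ := by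
  ext1 k
  simp only [PowerSeries.coeff_mul, coeff_fullSeries, wordSeries_conv]

theorem fullSeries_unitChar (Y : ℕ → R) : fullSeries Y unitChar = 1 := by
  ext1 k
  rw [coeff_fullSeries, wordSeries_unitChar, PowerSeries.coeff_one]

/-- The series `∑ b ^ k η ^ k B ^ k / k!`. -/
noncomputable def kickSeries (B : R) (b : ℝ) : PowerSeries (PowerSeries R) :=
  PowerSeries.mk fun k => PowerSeries.C ((b ^ k / k.factorial) • B ^ k)

/-- Moving a kick to the left of the drift conjugates `B` into `adSeries A B c`, and the exponential
of that series is the word series of `expChar`. -/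
theorem C_expSeries_mul_kickSeries (A B : R) (b c : ℝ) :
    PowerSeries.C (expSeries A c) * kickSeries B b =
      fullSeries (adCoeff A B) (expChar b c) * PowerSeries.C (expSeries A c) := by
  have h1 : ∀ k : ℕ, expSeries A c * PowerSeries.C (B ^ k) =
      adSeries A B c ^ k * expSeries A c := by
    intro k
    induction k with
    | zero => simp
    | succ k ih =>
      rw [pow_succ, map_mul, ← mul_assoc, ih, mul_assoc, expSeries_mul_C_eq, ← mul_assoc,
        ← pow_succ]
  ext1 k
  have h2 : PowerSeries.C ((b ^ k / k.factorial) • B ^ k) =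
      (b ^ k / k.factorial : ℝ) • PowerSeries.C (B ^ k) := by
    ext p
    rw [PowerSeries.coeff_smul, PowerSeries.coeff_C, PowerSeries.coeff_C]
    split_ifs <;> simp
  rw [PowerSeries.coeff_C_mul, PowerSeries.coeff_mul_C, coeff_fullSeries, wordSeries_expChar,
    kickSeries, PowerSeries.coeff_mk, h2, mul_smul_comm, h1, smul_mul_assoc]

theorem isExpArray_expSeries (A : R) (c : ℝ) :
    IsExpArray (c • A) 0 fun k p =>
      ((PowerSeries.C (expSeries A c) : PowerSeries (PowerSeries R)).coeff k).coeff p := by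
  have hA : expSeries A c * PowerSeries.C (c • A) = PowerSeries.C (c • A) * expSeries A c :=
    expSeries_mul_C A c c
  refine ⟨by simp [coeff_zero_expSeries], fun k p => ?_⟩
  simp only [PowerSeries.coeff_C, mul_zero, ite_self, add_zero]
  cases k with
  | zero =>
    simp only [if_true, zero_add]
    rw [← coeff_euler, euler_expSeries, ← hA]
    cases p with
    | zero => simp
    | succ p => rw [PowerSeries.coeff_succ_X_mul, PowerSeries.coeff_mul_C]; simp
  | succ k => simp

theorem isExpArray_kickSeries (B : R) (b : ℝ) :
    IsExpArray 0 (b • B) fun k p => ((kickSeries B b).coeff k).coeff p := by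
  refine ⟨by simp [kickSeries], fun k p => ?_⟩
  simp only [kickSeries, PowerSeries.coeff_mk, PowerSeries.coeff_C, mul_zero, ite_self, zero_add]
  cases p with
  | zero =>
    cases k with
    | zero => simp
    | succ k =>
      simp only [if_true, add_zero, Nat.add_sub_cancel, smul_mul_smul_comm, smul_smul,
        Nat.succ_ne_zero, if_false, Nat.factorial_succ, ← pow_succ]
      congr 1
      have : (k.factorial : ℝ) ≠ 0 := by positivity
      push_cast
      field_simp
      ring
  | succ p => simp

/-- Variation of constants: `exp(τA + ηB)` is the iterated-integral series times `exp(τA)`. The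
Leibniz rule for `euler` yields both terms of the recursion: differentiating the drift appends `A`,
and differentiating the integrals appends `B` after moving it past the drift. -/
theorem isExpArray_fullSeries_intChar (A B : R) :
    IsExpArray A B fun k p => ((fullSeries (adCoeff A B) intChar *
      PowerSeries.C (expSeries A 1)).coeff k).coeff p := by
  simp only [PowerSeries.coeff_mul_C, coeff_fullSeries]
  have hE : euler (expSeries A 1) = expSeries A 1 * PowerSeries.C A * PowerSeries.X := by
    have := expSeries_mul_C A 1 1
    rw [one_smul] at this
    rw [euler_expSeries, one_smul, PowerSeries.X_mul, this]
  have hXA : ∀ (F : PowerSeries R) (p : ℕ), (F * (expSeries A 1 * PowerSeries.C A *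
      PowerSeries.X)).coeff p = if p = 0 then 0 else (F * expSeries A 1).coeff (p - 1) * A := by
    intro F p
    cases p with
    | zero => simp
    | succ p =>
      rw [← mul_assoc, PowerSeries.coeff_succ_mul_X, ← mul_assoc, PowerSeries.coeff_mul_C]
      simp
  refine ⟨by simp [wordSeries, intChar, coeff_zero_expSeries], fun k p => ?_⟩
  cases k with
  | zero =>
    simp only [zero_add, if_true, add_zero, wordSeries, intChar, one_smul]
    rw [← hXA, ← hE, one_mul, one_mul, coeff_euler]
  | succ k =>
    simp only [Nat.succ_ne_zero, if_false, Nat.add_sub_cancel]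
    rw [← hXA, ← hE, ← PowerSeries.coeff_mul_C, mul_assoc (wordSeries _ k _), expSeries_mul_C_eq,
      ← mul_assoc (wordSeries _ k _), ← euler_wordSeries_intChar, add_mul, map_add,
      add_comm (k + 1) p, Nat.cast_add, add_smul, ← coeff_euler, euler_mul, map_add, smul_mul_assoc,
      PowerSeries.coeff_smul]
    abel

end Formal

/-! ### Taylor coefficients in the perturbation parameter -/

section Expansion

variable {E : Type*} [NormedAddCommGroup E] [NormedSpace ℝ E]

/-- Taylor expansion in the second variable. -/
theorem exists_partial_taylor {G : ℝ × ℝ → E} (hG : ContDiffAt ℝ ∞ G (0, 0)) (n : ℕ) :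
    ∃ g : ℕ → ℝ → E, (∀ k, g k =O[𝓝 0] fun _ => (1 : ℝ)) ∧
      (fun p : ℝ × ℝ => G p - ∑ k ∈ Finset.range n, p.2 ^ k • g k p.1) =O[𝓝 (0, 0)]
        fun p => p.2 ^ n := by
  induction n generalizing G with
  | zero => exact ⟨fun _ _ => 0, fun _ => isBigO_zero _ _, by
      simpa using hG.continuousAt.isBigO_one ℝ⟩
  | succ n ih =>
    -- The expansion of the derivative in the second variable is integrated term by term; the mean
    -- value inequality gains one power of `p.2`.
    have hG' : ContDiffAt ℝ ∞ (fun p => fderiv ℝ G p (0, 1)) (0, 0) :=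
      (hG.fderiv_right (m := ∞) (by simp)).clm_apply contDiffAt_const
    obtain ⟨g', hg', hO⟩ := ih hG'
    refine ⟨fun k => match k with
      | 0 => fun τ => G (τ, 0)
      | k + 1 => fun τ => ((k + 1 : ℕ) : ℝ)⁻¹ • g' k τ, ?_, ?_⟩
    · rintro (_ | k)
      · have hc : ContinuousAt (fun τ : ℝ => G (τ, 0)) 0 :=
          ContinuousAt.comp (f := fun τ : ℝ => (τ, (0 : ℝ))) hG.continuousAt (by fun_prop)
        exact hc.isBigO_one ℝ
      · exact (hg' k).const_smul_left _
    · obtain ⟨C, hC⟩ := hO.bound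
      have hdiff : ∀ᶠ p in 𝓝 ((0, 0) : ℝ × ℝ), DifferentiableAt ℝ G p := by
        have h1 : ContDiffAt ℝ 1 G (0, 0) := hG.of_le (by simp)
        filter_upwards [h1.eventually (by simp)] with p hp
        exact hp.differentiableAt (by simp)
      obtain ⟨δ, hδ, hball⟩ := Metric.eventually_nhds_iff_ball.1 (hC.and hdiff)
      refine IsBigO.of_bound |C| ?_
      filter_upwards [Metric.ball_mem_nhds _ hδ] with p hp
      have hmem : ∀ u ∈ Set.uIcc 0 p.2, (p.1, u) ∈ Metric.ball ((0, 0) : ℝ × ℝ) δ ∧ |u| ≤ |p.2| := by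
        intro u hu
        have h1 : |u| ≤ |p.2| := by simpa using Set.abs_sub_left_of_mem_uIcc hu
        refine ⟨?_, h1⟩
        rw [Metric.mem_ball, Prod.dist_eq, max_lt_iff] at hp ⊢
        simp only [dist_zero_right, Real.norm_eq_abs] at hp ⊢
        exact ⟨hp.1, h1.trans_lt hp.2⟩
      let P : ℝ → E := fun u => G (p.1, 0) +
        ∑ k ∈ Finset.range n, u ^ (k + 1) • ((k + 1 : ℕ) : ℝ)⁻¹ • g' k p.1
      have hP : ∀ u, HasDerivAt P (∑ k ∈ Finset.range n, u ^ k • g' k p.1) u := by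
        intro u
        have h1 : HasDerivAt P (∑ k ∈ Finset.range n, (((k + 1 : ℕ) : ℝ) * u ^ (k + 1 - 1)) •
            ((k + 1 : ℕ) : ℝ)⁻¹ • g' k p.1) u :=
          (HasDerivAt.fun_sum fun k _ => (hasDerivAt_pow (k + 1) u).smul_const _).const_add _
        refine h1.congr_deriv (Finset.sum_congr rfl fun k _ => ?_)
        have : ((k + 1 : ℕ) : ℝ) ≠ 0 := Nat.cast_ne_zero.2 k.succ_ne_zero
        rw [smul_smul, Nat.add_sub_cancel, mul_comm, ← mul_assoc, inv_mul_cancel₀ this, one_mul]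
      have hD : ∀ u ∈ Set.uIcc 0 p.2, HasDerivWithinAt (fun u => G (p.1, u) - P u)
          (fderiv ℝ G (p.1, u) (0, 1) - ∑ k ∈ Finset.range n, u ^ k • g' k p.1)
          (Set.uIcc 0 p.2) u := by
        intro u hu
        have h1 := (hball _ (hmem u hu).1).2.hasFDerivAt
        have h2 : HasDerivAt (fun u : ℝ => (p.1, u)) (0, 1) u :=
          (hasDerivAt_const u p.1).prodMk (hasDerivAt_id u)
        exact ((h1.comp_hasDerivAt u h2).sub (hP u)).hasDerivWithinAt
      have hmv := (convex_uIcc 0 p.2).norm_image_sub_le_of_norm_hasDerivWithin_le hD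
        (C := |C| * |p.2| ^ n) (fun u hu => by
          refine (hball _ (hmem u hu).1).1.trans ?_
          rw [norm_pow, Real.norm_eq_abs]
          exact mul_le_mul (le_abs_self C) (pow_le_pow_left₀ (abs_nonneg _) (hmem u hu).2 n)
            (by positivity) (abs_nonneg _)) Set.left_mem_uIcc Set.right_mem_uIcc
      have h0 : G (p.1, 0) - P 0 = 0 := by simp [P]
      rw [h0, sub_zero, sub_zero, Real.norm_eq_abs, mul_assoc, ← pow_succ] at hmv
      rw [norm_pow, Real.norm_eq_abs, Finset.sum_range_succ']
      simp only [pow_zero, one_smul]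
      rw [add_comm (Finset.sum _ _)]
      exact hmv

/-- If a smooth map has a bivariate Taylor expansion, then so have the coefficients of its expansion
in the second variable. -/
theorem isBigO_coeff_of_isBigO {G : ℝ × ℝ → E} {n : ℕ} {d : ℕ → ℕ → E} {g : ℕ → ℝ → E}
    (hd : (fun p : ℝ × ℝ => G p - ∑ k ∈ Finset.range n, ∑ l ∈ Finset.range n,
      (p.1 ^ l * p.2 ^ k) • d k l) =O[𝓝 (0, 0)] fun p => ‖p‖ ^ n)
    (hg : (fun p : ℝ × ℝ => G p - ∑ k ∈ Finset.range n, p.2 ^ k • g k p.1) =O[𝓝 (0, 0)]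
        fun p => p.2 ^ n) {k : ℕ} (hk : k < n) :
    (fun τ : ℝ => τ ^ k • g k τ - ∑ l ∈ Finset.range n, τ ^ (l + k) • d k l) =O[𝓝 0]
      fun τ => τ ^ n := by
  let v : ℕ → ℝ → E := fun k τ => g k τ - ∑ l ∈ Finset.range n, τ ^ l • d k l
  have h1 : (fun p : ℝ × ℝ => ∑ k ∈ Finset.range n, p.2 ^ k • v k p.1) =O[𝓝 (0, 0)]
      fun p => ‖p‖ ^ n := by
    have h2 : (fun p : ℝ × ℝ => p.2 ^ n) =O[𝓝 (0, 0)] fun p => ‖p‖ ^ n := by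
      refine IsBigO.of_bound 1 (Eventually.of_forall fun p => ?_)
      rw [norm_pow, norm_pow, norm_norm, one_mul]
      exact pow_le_pow_left₀ (norm_nonneg _) (norm_snd_le p) n
    refine (hd.sub (hg.trans h2)).congr_left fun p => ?_
    have h3 : ∑ k ∈ Finset.range n, ∑ l ∈ Finset.range n, (p.1 ^ l * p.2 ^ k) • d k l =
        ∑ k ∈ Finset.range n, p.2 ^ k • ∑ l ∈ Finset.range n, p.1 ^ l • d k l := by
      refine Finset.sum_congr rfl fun k _ => ?_
      rw [Finset.smul_sum]
      exact Finset.sum_congr rfl fun l _ => by rw [smul_smul, mul_comm]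
    simp only [v, smul_sub, Finset.sum_sub_distrib]
    rw [h3]
    abel
  obtain ⟨C, -, hC⟩ := exists_forall_pow_mul_norm_le E n
  -- On the curves where the second variable is `i |τ|`, the norm of the pair is comparable to
  -- `|τ|`. Letting `i` vary separates the coefficients.
  have h3 : ∀ i : Fin n, ∃ c : ℝ, ∀ᶠ τ in 𝓝 (0 : ℝ),
      ‖∑ k : Fin n, (i * |τ| : ℝ) ^ k.val • v k τ‖ ≤ c * |τ| ^ n := by
    intro i
    have ht : Tendsto (fun τ : ℝ => (τ, (i * |τ| : ℝ))) (𝓝 0) (𝓝 (0, 0)) := by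
      have : Continuous fun τ : ℝ => (τ, (i * |τ| : ℝ)) := by fun_prop
      simpa using this.tendsto 0
    have h4 : (fun τ : ℝ => ‖(τ, (i * |τ| : ℝ))‖ ^ n) =O[𝓝 0] fun τ => τ ^ n := by
      refine IsBigO.pow (IsBigO.of_bound (1 + i) (Eventually.of_forall fun τ => ?_)) n
      rw [norm_norm, Prod.norm_def]
      refine max_le ?_ ?_
      · nlinarith [norm_nonneg τ, (Nat.cast_nonneg (i : ℕ) : (0 : ℝ) ≤ (i : ℕ))]
      · rw [norm_mul, Real.norm_natCast, Real.norm_eq_abs, abs_abs, Real.norm_eq_abs]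
        nlinarith [abs_nonneg τ]
    obtain ⟨c, hc⟩ := ((h1.comp_tendsto ht).trans h4).bound
    refine ⟨c, ?_⟩
    filter_upwards [hc] with τ hτ
    rw [norm_pow, Real.norm_eq_abs] at hτ
    simp only [Function.comp_apply, Finset.sum_range fun k => (i * |τ| : ℝ) ^ k • v k τ] at hτ
    exact hτ
  choose c hc using h3
  refine IsBigO.of_bound (C * ∑ i, |c i|) ?_
  filter_upwards [eventually_all.2 hc] with τ hτ
  have h5 := hC (fun k => v k τ) |τ| ((∑ i, |c i|) * |τ| ^ n) (abs_nonneg _) (fun i => by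
    refine (hτ i).trans (mul_le_mul_of_nonneg_right ?_ (by positivity))
    exact (le_abs_self _).trans (Finset.single_le_sum (f := fun i => |c i|)
      (fun i _ => abs_nonneg _) (Finset.mem_univ i))) ⟨k, hk⟩
  have h6 : τ ^ k • g k τ - ∑ l ∈ Finset.range n, τ ^ (l + k) • d k l = τ ^ k • v k τ := by
    simp only [v, smul_sub, Finset.smul_sum, smul_smul, pow_add, mul_comm]
  rw [h6, norm_smul, norm_pow, norm_pow, Real.norm_eq_abs, mul_assoc]
  exact h5

end Expansion

/-! ### The Lie series of the splitting method -/

/-- One more stage: the drifts add up, and the kick moved to their left sees the accumulated time `c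
+ d` as its node. -/
theorem fullSeries_mul_C_mul_C_mul_kickSeries {R : Type*} [Ring R] [Algebra ℝ R] (A B : R)
    (χ : List ℕ → ℝ) (b c d : ℝ) :
    fullSeries (adCoeff A B) χ * PowerSeries.C (expSeries A c) * PowerSeries.C (expSeries A d) *
        kickSeries B b =
      fullSeries (adCoeff A B) (conv χ (expChar b (c + d))) *
        PowerSeries.C (expSeries A (c + d)) := by
  rw [mul_assoc (fullSeries _ _) (PowerSeries.C _) (PowerSeries.C _), ← map_mul, ← expSeries_add,
    mul_assoc (fullSeries _ _), C_expSeries_mul_kickSeries, ← mul_assoc, ← fullSeries_conv]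

theorem coeff_fullSeries_mul_C_congr {R : Type*} [Ring R] [Algebra ℝ R] (Y : ℕ → R)
    (F : PowerSeries R) {χ ξ : List ℕ → ℝ} {k l : ℕ}
    (h : ∀ w : List ℕ, (∀ n ∈ w, 0 < n) → w.length = k → w.sum ≤ l + k → χ w = ξ w) :
    ((fullSeries Y χ * PowerSeries.C F).coeff k).coeff l =
      ((fullSeries Y ξ * PowerSeries.C F).coeff k).coeff l := by
  rw [PowerSeries.coeff_mul_C, PowerSeries.coeff_mul_C, coeff_fullSeries, coeff_fullSeries,
    PowerSeries.coeff_mul, PowerSeries.coeff_mul]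
  refine Finset.sum_congr rfl fun y hy => ?_
  have hy' := Finset.HasAntidiagonal.mem_antidiagonal.1 hy
  congr 1
  exact coeff_wordSeries_congr _ fun w hw hwl hws => h w hw hwl (by omega)

section Method

variable {D : ℕ}

theorem lieDeriv_smul (c : ℝ) (f : smoothMaps D) : lieDeriv (c • f) = c • lieDeriv f := by
  ext h x
  simp [lieDeriv_apply]

theorem lieDeriv_zero : lieDeriv (0 : smoothMaps D) = 0 := by
  ext h x
  simp [lieDeriv_apply]

theorem hasSeries_fst (x₀ : Space D) : HasSeries x₀ (fun q => q.1) 1 := by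
  have h1 := hasSeries_flowPair (f := (0 : smoothMaps D)) (g := 0) (S := 1) (by
    rw [lieDeriv_zero]
    refine ⟨by simp [PowerSeries.coeff_one], fun k p => ?_⟩
    simp only [PowerSeries.coeff_one, mul_zero, ite_self, add_zero]
    split_ifs with hk
    · rw [PowerSeries.coeff_one]
      split_ifs with hp <;> simp [hk, hp]
    · simp) x₀
  have h2 : flowPair (0 : smoothMaps D).1 (0 : smoothMaps D).1 = fun q => q.1 :=
    funext fun q => flow_zero_field (by simp) _ _
  rwa [h2] at h1

theorem hasSeries_drift (f : smoothMaps D) (c : ℝ) (x₀ : Space D) :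
    HasSeries x₀ (fun q => flow f.1 (c * q.2.1) q.1)
      (PowerSeries.C (expSeries (lieDeriv f) c)) := by
  have h1 := hasSeries_flowPair (f := c • f) (g := 0)
    (S := PowerSeries.C (expSeries (lieDeriv f) c)) (by
      rw [lieDeriv_smul, lieDeriv_zero]
      exact isExpArray_expSeries _ _) x₀
  have h2 : flowPair (c • f).1 (0 : smoothMaps D).1 = fun q => flow f.1 (c * q.2.1) q.1 := by
    funext q
    rw [flow_eq_flow_smul ((contDiff_smoothMaps f).of_le (by simp)), flowPair]
    simp [smul_smul, mul_comm]
  rwa [h2] at h1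

theorem hasSeries_kick (g : smoothMaps D) (b : ℝ) (x₀ : Space D) :
    HasSeries x₀ (fun q => flow (fun z => (b * q.2.2) • g.1 z) 1 q.1)
      (kickSeries (lieDeriv g) b) := by
  have h1 := hasSeries_flowPair (f := (0 : smoothMaps D)) (g := b • g) (S := kickSeries (lieDeriv g) b) (by
      rw [lieDeriv_smul, lieDeriv_zero]
      exact isExpArray_kickSeries _ _) x₀
  have h2 : flowPair (0 : smoothMaps D).1 (b • g : smoothMaps D).1 =
      fun q => flow (fun z => (b * q.2.2) • g.1 z) 1 q.1 := by
    funext q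
    rw [flowPair]
    simp [smul_smul, mul_comm]
  rwa [h2] at h1

theorem hasSeries_flow (f g : smoothMaps D) (x₀ : Space D) :
    HasSeries x₀ (flowPair f.1 g.1) (fullSeries (adCoeff (lieDeriv f) (lieDeriv g)) intChar *
      PowerSeries.C (expSeries (lieDeriv f) 1)) :=
  hasSeries_flowPair (isExpArray_fullSeries_intChar (lieDeriv f) (lieDeriv g)) x₀

/-- The stages of the splitting method, except for the last one, in terms of `τ` and `η = τ * ε`. -/
noncomputable def stages {s : ℕ} (a : Fin (s + 1) → ℝ) (b : Fin s → ℝ) (f g : Space D → Space D)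
    (q : Space D × ℝ × ℝ) : Space D :=
  Fin.foldl s (fun y i => flow (fun z => (b i * q.2.2) • g z) 1 (flow f (a i.castSucc * q.2.1) y))
    q.1

theorem stages_succ {s : ℕ} (a : Fin (s + 2) → ℝ) (b : Fin (s + 1) → ℝ) (f g : Space D → Space D) :
    stages a b f g = fun q : Space D × ℝ × ℝ => flow (fun z => (b (Fin.last s) * q.2.2) • g z) 1
      (flow f (a (Fin.last s).castSucc * q.2.1)
        (stages (fun i => a i.castSucc) (fun i => b i.castSucc) f g q)) :=
  funext fun q => by rw [stages, Fin.foldl_succ_last]; rfl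

theorem step_eq_stages {s : ℕ} (a : Fin (s + 1) → ℝ) (b : Fin s → ℝ) (f : Space D → Space D)
    {g : Space D → Space D} (hg : ContDiff ℝ ∞ g) (τ ε : ℝ) (x : Space D) :
    step a b f g τ ε x = flow f (a (Fin.last s) * τ) (stages a b f g (x, τ, τ * ε)) := by
  rw [step, stages]
  congr 2
  funext y i
  rw [flow_eq_flow_smul ((hg.const_smul ε).of_le (by simp))]
  simp [smul_smul, mul_assoc]

theorem hasSeries_stages {s : ℕ} (a : Fin (s + 1) → ℝ) (b : Fin s → ℝ) (f g : smoothMaps D)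
    (x₀ : Space D) :
    HasSeries x₀ (stages a b f.1 g.1) (fullSeries (adCoeff (lieDeriv f) (lieDeriv g))
      (methodChar b fun i => node a i.castSucc) *
        PowerSeries.C (expSeries (lieDeriv f) (∑ i : Fin s, a i.castSucc))) := by
  induction s with
  | zero =>
    have h1 : stages a b f.1 g.1 = fun q => q.1 := funext fun q => by simp [stages]
    rw [h1, methodChar_zero, fullSeries_unitChar]
    simpa [expSeries_zero] using hasSeries_fst x₀
  | succ s ih =>
    have h1 := ((ih (fun i => a i.castSucc) (fun i => b i.castSucc)).comp
      (hasSeries_drift f (a (Fin.last s).castSucc) x₀)).comp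
        (hasSeries_kick g (b (Fin.last s)) x₀)
    rw [stages_succ, methodChar_succ]
    simp only [node_castSucc a]
    rw [Fin.sum_univ_castSucc, node_last, ← fullSeries_mul_C_mul_C_mul_kickSeries]
    exact h1

/-- The splitting method in terms of `τ` and `η = τ * ε`. -/
theorem hasSeries_step {s : ℕ} (a : Fin (s + 1) → ℝ) (b : Fin s → ℝ) (f g : smoothMaps D)
    (x₀ : Space D) :
    HasSeries x₀ (fun q => flow f.1 (a (Fin.last s) * q.2.1) (stages a b f.1 g.1 q))
      (fullSeries (adCoeff (lieDeriv f) (lieDeriv g)) (methodChar b fun i => node a i.castSucc) *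
        PowerSeries.C (expSeries (lieDeriv f) (node a (Fin.last s)))) := by
  have h1 := (hasSeries_stages a b f g x₀).comp (hasSeries_drift f (a (Fin.last s)) x₀)
  rw [mul_assoc, ← map_mul, ← expSeries_add, ← node_last] at h1
  exact h1

/-- For small times, the flow of a smooth vector field satisfies the group property. -/
theorem exists_curve_flow {f : Space D → Space D} (hf : ContDiff ℝ ∞ f) (x : Space D) :
    ∃ γ : ℝ → Space D, γ 0 = x ∧ ∃ δ > 0, ∀ u t, |u| < δ → |u + t| < δ →
      flow f t (γ u) = γ (u + t) := by
  obtain ⟨γ, h0, δ, hδ, hγ⟩ :=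
    ContDiffAt.exists_forall_mem_closedBall_exists_eq_forall_mem_Ioo_hasDerivAt₀
      (f := f) (x₀ := x) (hf.contDiffAt.of_le (by simp)) 0
  refine ⟨γ, h0, δ, hδ, fun u t hu hut => ?_⟩
  have h2 := flow_eq (f := f) (γ := fun v => γ (u + v)) (x := γ u) (t := t) (hf.of_le (by simp))
    (fun v hv => ?_) (by simp)
  · exact h2
  · have h3 : u + v ∈ Set.uIcc u (u + t) := by
      have := Set.mem_image_of_mem (fun v => u + v) hv
      rwa [Set.image_const_add_uIcc, add_zero] at this
    have h4 : u + v ∈ Set.Ioo (-δ) δ :=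
      Set.ordConnected_Ioo.uIcc_subset (abs_lt.1 hu) (abs_lt.1 hut) h3
    have h5 := hγ (u + v) (by simpa using h4)
    exact (h5.comp_const_add u v).hasDerivWithinAt

/-- Without perturbation the kicks are trivial and the drifts combine, but only for small `τ`, since
flows are local. Exact equality is needed because the generalized order has no term in `ε ^ 0`. -/
theorem step_zero_eventually {s : ℕ} (a : Fin (s + 1) → ℝ) (b : Fin s → ℝ) {f : Space D → Space D}
    (hf : ContDiff ℝ ∞ f) (g : Space D → Space D) (x : Space D) :
    ∀ᶠ τ in 𝓝 (0 : ℝ), step a b f g τ 0 x = flow f (node a (Fin.last s) * τ) x := by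
  obtain ⟨γ, h0, δ, hδ, hγ⟩ := exists_curve_flow hf x
  have hsmall : ∀ c : ℝ, ∀ᶠ τ in 𝓝 (0 : ℝ), |c * τ| < δ := fun c => by
    have : Tendsto (fun τ : ℝ => |c * τ|) (𝓝 0) (𝓝 |c * 0|) :=
      (continuous_abs.comp (continuous_const.mul continuous_id)).tendsto 0
    exact this.eventually_lt_const (by simpa using hδ)
  have hfold : ∀ (s : ℕ) (a : Fin (s + 1) → ℝ) (b : Fin s → ℝ), ∀ᶠ τ in 𝓝 (0 : ℝ),
      stages a b f g (x, τ, 0) = γ ((∑ i : Fin s, a i.castSucc) * τ) := by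
    intro s
    induction s with
    | zero => intro a b; exact Eventually.of_forall fun τ => by simp [stages, h0]
    | succ s ih =>
      intro a b
      filter_upwards [ih (fun i => a i.castSucc) (fun i => b i.castSucc),
        hsmall (∑ i : Fin s, a i.castSucc.castSucc), hsmall (∑ i : Fin (s + 1), a i.castSucc)]
        with τ h1 h2 h3
      rw [stages_succ]
      simp only [h1]
      rw [Fin.sum_univ_castSucc, add_mul] at h3 ⊢
      rw [flow_zero_field (by simp), hγ _ _ h2 h3]
  filter_upwards [hfold s a b, hsmall (∑ i : Fin s, a i.castSucc),
    hsmall (node a (Fin.last s))] with τ h1 h2 h3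
  have h4 : step a b f g τ 0 x = flow f (a (Fin.last s) * τ) (stages a b f g (x, τ, 0)) := by
    rw [step, stages]
    congr 2
    funext y i
    rw [flow_zero_field (f := fun z => (0 : ℝ) • g z) (by simp)]
    exact (flow_zero_field (by simp) _ _).symm
  have h5 := hγ 0 (node a (Fin.last s) * τ) (by simpa using hδ) (by simpa using h3)
  rw [h0, zero_add] at h5
  rw [h4, h1, h5, node_last, add_mul]
  rw [node_last, add_mul] at h3
  exact hγ _ _ h2 h3

end Method

/-! ### Sufficiency of the order conditions and the main theorem -/

theorem isBigO_pow_of_le {α : Type*} {l : Filter α} {u : α → ℝ} (hu : u =O[l] fun _ => (1 : ℝ))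
    {n k : ℕ} (h : n ≤ k) : (fun x => u x ^ k) =O[l] fun x => u x ^ n := by
  have h1 := (isBigO_refl (fun x => u x ^ n) l).mul (hu.pow (k - n))
  simpa [← pow_add, Nat.add_sub_cancel' h] using h1

/-- The order conditions for all multi-indices of length at most `m` are sufficient. -/
theorem hasGeneralizedOrder_of_forall_eq {s m : ℕ} {a : Fin (s + 1) → ℝ} {b : Fin s → ℝ}
    {r : Fin m → ℕ} (ha : node a (Fin.last s) = 1)
    (h : ∀ (k : Fin m) (w : List ℕ), (∀ n ∈ w, 0 < n) → w.length = k + 1 → w.sum ≤ r k →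
      methodChar b (fun i => node a i.castSucc) w = intChar w) :
    HasGeneralizedOrder a b r := by
  intro D fa fb hfa hfb x
  let f : smoothMaps D := ⟨fa, hfa⟩
  let g : smoothMaps D := ⟨fb, hfb⟩
  let id' : smoothMaps D := ⟨fun z => z, by
    have : ContDiff ℝ ∞ fun z : Space D => z := contDiff_id
    exact this⟩
  have h1 := hasSeries_step a b f g x
  have h2 := hasSeries_flow f g x
  rw [ha] at h1
  set S := fullSeries (adCoeff (lieDeriv f) (lieDeriv g)) (methodChar b fun i => node a i.castSucc) *
        PowerSeries.C (expSeries (lieDeriv f) 1) with hS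
  set T := fullSeries (adCoeff (lieDeriv f) (lieDeriv g)) intChar *
        PowerSeries.C (expSeries (lieDeriv f) 1) with hT
  let G : ℝ × ℝ → Space D := fun p => flow fa (a (Fin.last s) * p.1) (stages a b fa fb (x, p.1, p.2)) -
    flowPair fa fb (x, p.1, p.2)
  have hmap : ContDiffAt ℝ ∞ (fun p : ℝ × ℝ => ((x, p.1, p.2) : Space D × ℝ × ℝ)) (0, 0) := by
    fun_prop
  have hG : ContDiffAt ℝ ∞ G (0, 0) :=
    (ContDiffAt.comp (0, 0) h1.1 hmap).sub (ContDiffAt.comp (0, 0) h2.1 hmap)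
  have hlocal : ∀ τ ε, localError a b fa fb x τ ε = G (τ, τ * ε) := fun τ ε => by
    rw [localError, step_eq_stages a b fa hfb, flow_add_eq_flowPair hfa hfb]
  have hG0 : ∀ᶠ τ in 𝓝 (0 : ℝ), G (τ, 0) = 0 := by
    filter_upwards [step_zero_eventually a b hfa fb x] with τ hτ
    have h3 := hlocal τ 0
    rw [mul_zero] at h3
    rw [← h3, localError, hτ, ha, one_mul]
    simp
  obtain ⟨K, hK⟩ : ∃ K, ∀ k, r k ≤ K := ⟨∑ k, r k, fun k =>
    Finset.single_le_sum (f := r) (fun _ _ => Nat.zero_le _) (Finset.mem_univ k)⟩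
  -- Large enough to exceed both `m` and every `r k`.
  let n := m + K + 1
  let d : ℕ → ℕ → Space D := fun k p =>
    ((S.coeff k).coeff p id').1 x - ((T.coeff k).coeff p id').1 x
  have hd : (fun p : ℝ × ℝ => G p - ∑ k ∈ Finset.range n, ∑ l ∈ Finset.range n,
      (p.1 ^ l * p.2 ^ k) • d k l) =O[𝓝 (0, 0)] fun p => ‖p‖ ^ n := by
    have h3 := ((h1.2.2 id' n).sub (h2.2.2 id' n)).comp_tendsto (k := fun p : ℝ × ℝ => (x, p.1, p.2))
      (l' := 𝓝 (0, 0)) hmap.continuousAt.tendsto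
    refine h3.congr_left fun p => ?_
    simp only [Function.comp_apply, partialSum, d, smul_sub, Finset.sum_sub_distrib, G, id', f, g]
    abel
  have hd0 : ∀ (k : Fin m) (l : ℕ), l + (k.val + 1) ≤ r k → d (k.val + 1) l = 0 := by
    intro k l hl
    have h3 : (S.coeff (k.val + 1)).coeff l = (T.coeff (k.val + 1)).coeff l := by
      have h4 := coeff_fullSeries_mul_C_congr (adCoeff (lieDeriv f) (lieDeriv g))
        (expSeries (lieDeriv f) 1) (χ := methodChar b fun i => node a i.castSucc) (ξ := intChar)
        (k := k.val + 1) (l := l) fun w hw hwl hws => h k w hw hwl (hws.trans hl)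
      rw [hS, hT]
      exact h4
    simp only [d, h3, sub_self]
  obtain ⟨e, he1, he⟩ := exists_partial_taylor hG n
  have hcoeff : ∀ k < n, _ := fun k hk => isBigO_coeff_of_isBigO hd he hk
  have he0 : ∀ᶠ τ in 𝓝 (0 : ℝ), e 0 τ = 0 := by
    have ht : Tendsto (fun τ : ℝ => (τ, (0 : ℝ))) (𝓝 0) (𝓝 (0, 0)) :=
      (Continuous.prodMk_left 0).tendsto 0
    obtain ⟨C, hC⟩ := (he.comp_tendsto ht).bound
    filter_upwards [hC, hG0] with τ hτ hτ0
    simp only [Function.comp_apply, hτ0, n, Finset.sum_range_succ'] at hτ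
    simpa using hτ
  -- The powers of `τ` come from `η ^ k = τ ^ k ε ^ k`.
  refine ⟨fun k τ => τ ^ (k.val + 1) • e (k.val + 1) τ, fun k => ?_, ?_⟩
  · have h3 := hcoeff (k.val + 1) (by have := k.isLt; omega)
    have h4 : (fun τ : ℝ => τ ^ n) =O[𝓝 0] fun τ => τ ^ (r k + 1) :=
      isBigO_pow_of_le (continuousAt_id.isBigO_one ℝ) (by have := hK k; omega)
    have h5 : (fun τ : ℝ => ∑ l ∈ Finset.range n, τ ^ (l + (k.val + 1)) • d (k.val + 1) l)
        =O[𝓝 0] fun τ => τ ^ (r k + 1) := by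
      refine IsBigO.fun_sum fun l _ => ?_
      by_cases hl : l + (k.val + 1) ≤ r k
      · simp only [hd0 k l hl, smul_zero]
        exact isBigO_zero _ _
      · have h6 := (isBigO_pow_of_le (l := 𝓝 0) (u := fun τ : ℝ => τ) (continuousAt_id.isBigO_one ℝ)
          (show r k + 1 ≤ l + (k.val + 1) by omega)).smul
            (isBigO_refl (fun _ : ℝ => d (k.val + 1) l) (𝓝 0))
        have h7 : (fun _ : ℝ => d (k.val + 1) l) =O[𝓝 0] fun _ => (1 : ℝ) :=
          continuousAt_const.isBigO_one ℝ
        simpa using h6.trans ((isBigO_refl _ _).smul h7)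
    refine ((h3.trans h4).add h5).congr_left fun τ => ?_
    abel
  · have ht : Tendsto (fun p : ℝ × ℝ => (p.1, p.1 * p.2)) (𝓝 (0, 0)) (𝓝 (0, 0)) := by
      have : Continuous fun p : ℝ × ℝ => (p.1, p.1 * p.2) := by fun_prop
      simpa using this.tendsto (0, 0)
    have hbdd : ∀ k, (fun p : ℝ × ℝ => p.1 ^ k) =O[𝓝 (0, 0)] fun _ => (1 : ℝ) := fun k =>
      (continuous_fst.pow k).continuousAt.isBigO_one ℝ
    have hpow : ∀ k, m + 1 ≤ k → (fun p : ℝ × ℝ => p.2 ^ k) =O[𝓝 (0, 0)] fun p => p.2 ^ (m + 1) :=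
      fun k hk => isBigO_pow_of_le (continuous_snd.continuousAt.isBigO_one ℝ) hk
    have hfst : Tendsto (fun p : ℝ × ℝ => p.1) (𝓝 (0, 0)) (𝓝 0) := continuous_fst.tendsto (0, 0)
    have hrem : (fun p : ℝ × ℝ => G (p.1, p.1 * p.2) -
        ∑ k ∈ Finset.range n, (p.1 * p.2) ^ k • e k p.1) =O[𝓝 (0, 0)] fun p => p.2 ^ (m + 1) := by
      refine (he.comp_tendsto ht).trans ?_
      have h3 := (hbdd n).mul (hpow n (by omega))
      simp only [one_mul] at h3
      exact h3.congr_left fun p => (mul_pow _ _ _).symm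
    have htail : (fun p : ℝ × ℝ => ∑ k ∈ Finset.range K, (p.1 * p.2) ^ (m + 1 + k) •
        e (m + 1 + k) p.1) =O[𝓝 (0, 0)] fun p => p.2 ^ (m + 1) := by
      refine IsBigO.fun_sum fun k _ => ?_
      have h3 := ((hbdd (m + 1 + k)).mul (hpow (m + 1 + k) (by omega))).smul
        ((he1 (m + 1 + k)).comp_tendsto hfst)
      simp only [one_mul, Function.comp_apply, smul_eq_mul, mul_one] at h3
      exact h3.congr_left fun p => by rw [mul_pow]
    refine (hrem.add htail).congr' ?_ EventuallyEq.rfl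
    filter_upwards [hfst.eventually he0] with p hp
    rw [hlocal]
    have h3 : ∑ k ∈ Finset.range n, (p.1 * p.2) ^ k • e k p.1 =
        ∑ k : Fin m, p.2 ^ (k.val + 1) • p.1 ^ (k.val + 1) • e (k.val + 1) p.1 +
        ∑ k ∈ Finset.range K, (p.1 * p.2) ^ (m + 1 + k) • e (m + 1 + k) p.1 := by
      have hn : n = m + 1 + K := by omega
      rw [hn, Finset.sum_range_add, Finset.sum_range_succ', hp, smul_zero, add_zero,
        Finset.sum_range fun k => (p.1 * p.2) ^ (k + 1) • e (k + 1) p.1]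
      congr 1
      refine Finset.sum_congr rfl fun k _ => ?_
      rw [smul_smul, mul_pow, mul_comm]
    rw [h3]
    abel

theorem node_eq_one_and_orderConditions {s m : ℕ} {a : Fin (s + 1) → ℝ} {b : Fin s → ℝ}
    {r : Fin m → ℕ} (h : HasGeneralizedOrder a b r) :
    node a (Fin.last s) = 1 ∧ ∀ (k : Fin m) (j : Fin (k.val + 1) → ℕ), IsLyndon (List.ofFn j) →
      ∑ l, j l ≤ r k → OrderCondition a b j :=
  ⟨node_last_eq_one_of_hasGeneralizedOrder h, fun k j hj hsum =>
    orderCondition_of_hasGeneralizedOrder h k j (fun l => hj.2.1 _ (List.mem_ofFn.2 ⟨l, rfl⟩)) hsum⟩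

/-- It suffices to verify the order conditions for Lyndon multi-indices, where the conditions of lower
weight may be assumed. -/
theorem hasGeneralizedOrder_of_forall_isLyndon {s m : ℕ} {a : Fin (s + 1) → ℝ} {b : Fin s → ℝ}
    {r : Fin m → ℕ} (hr : Antitone r) (ha : node a (Fin.last s) = 1)
    (h : ∀ (k : Fin m) (j : Fin (k.val + 1) → ℕ), IsLyndon (List.ofFn j) → ∑ l, j l ≤ r k →
      (∀ w : List ℕ, (∀ n ∈ w, 0 < n) → w ≠ [] → w.length ≤ k.val + 1 → w.sum < ∑ l, j l →
        methodChar b (fun i => node a i.castSucc) w = intChar w) → OrderCondition a b j) :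
    HasGeneralizedOrder a b r := by
  let P : List ℕ → Prop := fun w => ∃ k : Fin m, w.length = k.val + 1 ∧ w.sum ≤ r k
  -- Monotonicity of `r` enters here: shorter words are subject to a weaker bound on the weight.
  have hP : ∀ w w', P w → w' ≠ [] → w'.sum ≤ w.sum → w'.length ≤ w.length → P w' := by
    rintro w w' ⟨k, hk, hs⟩ h0 hsum hlen
    have h1 : 0 < w'.length := List.length_pos_iff.2 h0
    have hlt : w'.length - 1 < m := by omega
    refine ⟨⟨w'.length - 1, hlt⟩, by simp only; omega, (hsum.trans hs).trans (hr ?_)⟩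
    rw [Fin.le_def]
    simp only
    omega
  have key := eq_of_forall_isLyndon (P := P)
    (fun u v _ _ => (isShuffleChar_methodChar b fun i => node a i.castSucc).2 u v)
    intChar_shuffle hP (by
      rintro w hw ⟨k, hk, hs⟩ hlow
      obtain ⟨j, rfl⟩ : ∃ j : Fin (k.val + 1) → ℕ, w = List.ofFn j := by
        refine ⟨fun i => w.get (i.cast hk.symm), ?_⟩
        refine List.ext_get (by rw [List.length_ofFn, hk]) fun i h1 h2 => ?_
        rw [List.get_ofFn]
        rfl
      rw [← orderCondition_iff]
      rw [List.sum_ofFn] at hs hlow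
      refine h k j hw hs fun v hv hv0 hlen hsum => ?_
      have h1 := hlow v.reverse (by simpa using hv) (by simpa using hv0)
        (hP (List.ofFn j) _ ⟨k, hk, by rwa [List.sum_ofFn]⟩ (by simpa using hv0)
          (by rw [List.sum_ofFn, List.sum_reverse]; exact hsum.le) (by simpa using hlen))
        (by rwa [List.sum_reverse])
      rwa [List.reverse_reverse] at h1)
  refine hasGeneralizedOrder_of_forall_eq ha fun k w hw hlen hsum => ?_
  have h1 := key w.reverse (by simpa using hw) (by rintro h0; simp_all) ⟨k, by simpa using hlen, by
    rwa [List.sum_reverse]⟩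
  rwa [List.reverse_reverse] at h1

end Splitting

theorem theorem1 {s m : ℕ} (hm : 0 < m) (a : Fin (s + 1) → ℝ) (b : Fin s → ℝ)
    (r : Fin m → ℕ) (hr : Antitone r) :
    (Splitting.HasGeneralizedOrder a b r ↔
      Splitting.node a (Fin.last s) = 1 ∧
        ∀ (k : Fin m) (j : Fin (k.val + 1) → ℕ), Splitting.IsLyndon (List.ofFn j) →
          ∑ l, j l ≤ r k → Splitting.OrderCondition a b j) ∧
    (Splitting.IsSymmetric a b →
      (Splitting.HasGeneralizedOrder a b r ↔
        Splitting.node a (Fin.last s) = 1 ∧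
          ∀ (k : Fin m) (j : Fin (k.val + 1) → ℕ), Splitting.IsLyndon (List.ofFn j) →
            ∑ l, j l ≤ r k → Odd (∑ l, j l) → Splitting.OrderCondition a b j)) := by
  open Splitting in
  refine ⟨⟨node_eq_one_and_orderConditions, fun ⟨ha, h⟩ =>
    hasGeneralizedOrder_of_forall_isLyndon hr ha fun k j hj hs _ => h k j hj hs⟩, fun hsym =>
    ⟨fun h => ?_, fun ⟨ha, h⟩ => hasGeneralizedOrder_of_forall_isLyndon hr ha
      fun k j hj hs hlow => ?_⟩⟩
  · exact ⟨(node_eq_one_and_orderConditions h).1, fun k j hj hs _ =>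
      (node_eq_one_and_orderConditions h).2 k j hj hs⟩
  · rcases Nat.even_or_odd (∑ l, j l) with heven | hodd
    · rw [orderCondition_iff]
      have hpos : ∀ n ∈ (List.ofFn j).reverse, 0 < n := by
        intro n hn
        exact hj.2.1 n (List.mem_reverse.1 hn)
      have h0 : (List.ofFn j).reverse ≠ [] := by simp
      refine eq_of_even_sum (isShuffleChar_methodChar _ _).1 rfl hpos h0
        (conv_methodChar_shift_of_isSymmetric hsym ha hpos h0)
        (conv_intChar_shift_scale_neg_one hpos h0) (by rwa [List.sum_reverse, List.sum_ofFn])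
        fun v hv hv0 hlen hsum => hlow v hv hv0 (by simpa using hlen) ?_
      rwa [List.sum_reverse, List.sum_ofFn] at hsum
    · exact h k j hj hs hodd
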